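/- **Conventions.** A *finite-dimensional weak $C^*$-Hopf algebra* is a finite-dimensional (unital) $C^*$-algebra $A$ with linear maps $\Delta:A\to A\otimes A$, $\varepsilon:A\to\mathbb C$, $S:A\to A$ such that $(A,\Delta,\varepsilon)$ is a coalgebra (coassociative, counital) and, in Sweedler notation, for all $x,y,z\in A$: $\Delta(xy)=\Delta(x)\Delta(y)$, $\Delta(x^*)=\Delta(x)^*$, $(\Delta(1)\otimes1)(1\otimes\Delta(1))=1_{(1)}\otimes1_{(2)}\otimes1_{(3)}=(1\otimes\Delta(1))(\Delta(1)\otimes1)$, $\varepsilon(xy_{(1)})\varepsilon(y_{(2)}z)=\varepsilon(xyz)=\varepsilon(xy_{(2)})\varepsilon(y_{(1)}z)$, $S(x_{(1)})x_{(2)}=1_{(1)}\varepsilon(x1_{(2)})$, $x_{(1)}S(x_{(2)})=\varepsilon(1_{(1)}x)1_{(2)}$, $S(x_{(1)})x_{(2)}S(x_{(3)})=S(x)$. The dual space $\hat A$, with canonical pairing $\langle\cdot|\cdot\rangle$, is again a weak $C^*$-Hopf algebra with $\langle\varphi\psi|x\rangle=\langle\varphi|x_{(1)}\rangle\langle\psi|x_{(2)}\rangle$,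 $\hat1=\varepsilon$, $\langle\hat\Delta\varphi|x\otimes y\rangle=\langle\varphi|xy\rangle$, $\hat\varepsilon(\varphi)=\langle\varphi|1\rangle$, $\langle\hat S\varphi|x\rangle=\langle\varphi|S(x)\rangle$, $\langle\varphi^*|x\rangle=\overline{\langle\varphi|S(x)^*\rangle}$; the dual of $\hat A$ is identified with $A$. Put $A_L=\{(\varphi\otimes\mathrm{id})\Delta(1):\varphi\in\hat A\}$, $A_R=\{(\mathrm{id}\otimes\varphi)\Delta(1):\varphi\in\hat A\}$, let $C(\cdot)$ denote the center, and $\varphi\rightharpoonup a=a_{(1)}\langle\varphi|a_{(2)}\rangle$ for $\varphi\in\hat A$, $a\in A$. All notions below are used for $A$ and for $\hat A$, with the roles of $A$ and $\hat A$ exchanged in the second case. An element $l\in A$ is a *left integral* if $al=\varepsilon(1_{(1)}a)1_{(2)}\,l$ for all $a\in A$, and a *right integral* if $la=l\,1_{(1)}\varepsilon(a1_{(2)})$ for all $a\in A$. A left integral is *positive*, resp. *nondegenerate*, if the functional $\varphi\mapsto\langle\varphi|l\rangle$ on $\hat A$ is positive, resp. the bilinear form $(\varphi,\psi)\mapsto\langle\varphi\psi|l\rangle$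 on $\hat A$ is nondegenerate. The *Haar integral* $h\in A$ is the unique element that is both a left and a right integral and satisfies $S(h_{(1)})h_{(2)}=h_{(1)}S(h_{(2)})=1$. For a left integral $l$ put $d_R(l)=1_{(1)}\varepsilon(l1_{(2)})$ (so that $l=h\,d_R(l)$), $n_R(l)=1_{(1)}\varepsilon(1_{(2)}l)$ and, if $l$ is positive, $e_l=d_R(l)^{1/2}\,h\,d_R(l)^{1/2}$. The *p-dual* of a positive nondegenerate left integral $l\in A$ is the unique positive nondegenerate left integral $\lambda\in\hat A$ with $\lambda\rightharpoonup e_l=1$. The *Watatani index* of a linear map $E$ from an algebra $B$ to a subalgebra of $B$ is $\sum_iu_iv_i$, where $u_i,v_i\in B$ is a finite quasi-basis, i.e. $\sum_iu_iE(v_im)=m=\sum_iE(mu_i)v_i$ for all $m\in B$; it does not depend on the quasi-basis, and $E$ is *of index-finite type* if a quasi-basis exists. For a nondegenerate left integral $l\in A$, $\mathrm{Ind}\,l\in\hat A$ is the Watatani index of $E_l:\hat A\to\hat A_L$, $\varphi\mapsto l\rightharpoonup\varphi=\varphi_{(1)}\langle\varphi_{(2)}|l\rangle$; for a nondegenerate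 left integral $\lambda\in\hat A$, $\mathrm{Ind}\,\lambda\in A$ is the Watatani index of $\hat E_\lambda:A\to A_L$, $a\mapsto\lambda\rightharpoonup a$. An *$A$-module algebra* is a unital complex $*$-algebra $M$ with a linear left action $a\otimes m\mapsto a\triangleright m$ such that $(ab)\triangleright m=a\triangleright(b\triangleright m)$, $1\triangleright m=m$, $a\triangleright(mn)=(a_{(1)}\triangleright m)(a_{(2)}\triangleright n)$, $(a\triangleright m)^*=S(a)^*\triangleright m^*$ and $a\triangleright1_M=\varepsilon(1_{(1)}a)1_{(2)}\triangleright1_M$. The *crossed product* $M\rtimes A=M\otimes_{A_L}A$ is the quotient of $M\otimes A$ by the relations $m(b\triangleright1_M)\rtimes a=m\rtimes ba$ ($b\in A_L$), with product $(m\rtimes a)(m'\rtimes a')=m(a_{(1)}\triangleright m')\rtimes a_{(2)}a'$. It is an $\hat A$-module algebra under the dual action $\varphi\triangleright(m\rtimes a)=m\rtimes(\varphi\rightharpoonup a)$, so $(M\rtimes A)\rtimes\hat A$ is defined. An element $a\in A$ is viewed in it as $(1_M\rtimes a)\rtimes\hat1$, an element $\varphi\in\hat A$ as $(1_M\rtimes1)\rtimes\varphi$.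 **Theorem (p-duality and TLJ-algebra).** Let $A$ be a finite-dimensional weak $C^*$-Hopf algebra and $l\in A$ a positive nondegenerate left integral. Then the p-dual of $l$ exists. If $\lambda\in\hat A$ denotes the p-dual of $l$, then: 1. $l$ is the p-dual of $\lambda$. 2. $E_l$ and $\hat E_\lambda$ are of index-finite type, the indices $\mathrm{Ind}\,l$ and $\mathrm{Ind}\,\lambda$ are both positive and invertible, and $$\mathrm{Ind}\,l=n_R(\lambda)\in C(\hat A)\cap\hat A_R,\qquad \mathrm{Ind}\,\lambda=n_R(l)\in C(A)\cap A_R.$$ 3. For every $A$-module algebra $M$ the elements $e=(1_M\rtimes e_l)\rtimes\hat1$ and $\hat e=(1_M\rtimes1)\rtimes e_\lambda$ of $(M\rtimes A)\rtimes\hat A$ satisfy $$e^2=e\,\mathrm{Ind}\,\lambda,\qquad \hat e^2=\hat e\,\mathrm{Ind}\,l,\qquad \hat e\,e\,\hat e=\hat e,\qquad e\,\hat e\,e=e.$$ -/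

import Mathlib

open scoped TensorProduct ComplexOrder

universe u v

namespace WeakHopf

open Coalgebra (comul counit)

section Counital

variable {H : Type u} [Ring H] [Algebra ℂ H] [CoalgebraStruct ℂ H]

/-- The linear map `x ↦ ε(1₍₁₎ x) 1₍₂₎`. -/
noncomputable def counitalL : H →ₗ[ℂ] H where
  toFun x := TensorProduct.lid ℂ H
    (((counit (R := ℂ)).comp (LinearMap.mulRight ℂ x)).rTensor H (comul (R := ℂ) (1 : H)))
  map_add' x y := by
    rw [show LinearMap.mulRight ℂ (x + y) = LinearMap.mulRight ℂ x + LinearMap.mulRight ℂ y by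
      ext; simp [mul_add], LinearMap.comp_add, LinearMap.rTensor_add, LinearMap.add_apply, map_add]
  map_smul' c x := by
    rw [show LinearMap.mulRight ℂ (c • x) = c • LinearMap.mulRight ℂ x by ext; simp,
      LinearMap.comp_smul, LinearMap.rTensor_smul, LinearMap.smul_apply, map_smul, RingHom.id_apply]

/-- The linear map `x ↦ 1₍₁₎ ε(x 1₍₂₎)`. -/
noncomputable def counitalR : H →ₗ[ℂ] H where
  toFun x := TensorProduct.rid ℂ H
    (((counit (R := ℂ)).comp (LinearMap.mulLeft ℂ x)).lTensor H (comul (R := ℂ) (1 : H)))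
  map_add' x y := by
    rw [show LinearMap.mulLeft ℂ (x + y) = LinearMap.mulLeft ℂ x + LinearMap.mulLeft ℂ y by
      ext; simp [add_mul], LinearMap.comp_add, LinearMap.lTensor_add, LinearMap.add_apply, map_add]
  map_smul' c x := by
    rw [show LinearMap.mulLeft ℂ (c • x) = c • LinearMap.mulLeft ℂ x by ext; simp,
      LinearMap.comp_smul, LinearMap.lTensor_smul, LinearMap.smul_apply, map_smul, RingHom.id_apply]

end Counital

/-- Weak Hopf algebras over `ℂ`. The fields `weak_comul_one`, `weak_comul_one'` are
`(Δ(1) ⊗ 1)(1 ⊗ Δ(1)) = 1₍₁₎ ⊗ 1₍₂₎ ⊗ 1₍₃₎ = (1 ⊗ Δ(1))(Δ(1) ⊗ 1)`; the fields `weak_counit`,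
`weak_counit'` are `ε(x y₍₁₎) ε(y₍₂₎ z) = ε(xyz) = ε(x y₍₂₎) ε(y₍₁₎ z)`. In the presence of an
involution with `Δ(x*) = Δ(x)*` the primed identities follow from the unprimed ones. The last three
fields are `S(x₍₁₎) x₍₂₎ = 1₍₁₎ ε(x 1₍₂₎)`, `x₍₁₎ S(x₍₂₎) = ε(1₍₁₎ x) 1₍₂₎` and
`S(x₍₁₎) x₍₂₎ S(x₍₃₎) = S(x)`. -/
class WeakHopfAlgebra (H : Type u) [Ring H] [Algebra ℂ H] extends Coalgebra ℂ H where
  comul_mul : ∀ x y : H, comul (x * y) = comul x * comul y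
  weak_comul_one :
    TensorProduct.assoc ℂ H H H (comul (1 : H) ⊗ₜ[ℂ] (1 : H)) * ((1 : H) ⊗ₜ[ℂ] comul (1 : H)) =
      comul.lTensor H (comul (1 : H))
  weak_comul_one' :
    ((1 : H) ⊗ₜ[ℂ] comul (1 : H)) * TensorProduct.assoc ℂ H H H (comul (1 : H) ⊗ₜ[ℂ] (1 : H)) =
      comul.lTensor H (comul (1 : H))
  weak_counit : ∀ x y z : H,
    LinearMap.mul' ℂ ℂ (TensorProduct.map (counit.comp (LinearMap.mulLeft ℂ x))
      (counit.comp (LinearMap.mulRight ℂ z)) (comul y)) = counit (x * y * z)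
  weak_counit' : ∀ x y z : H,
    LinearMap.mul' ℂ ℂ (TensorProduct.map (counit.comp (LinearMap.mulRight ℂ z))
      (counit.comp (LinearMap.mulLeft ℂ x)) (comul y)) = counit (x * y * z)
  /-- The antipode. -/
  antipode : H →ₗ[ℂ] H
  antipode_mul : ∀ x : H,
    LinearMap.mul' ℂ H (TensorProduct.map antipode LinearMap.id (comul x)) = counitalR x
  mul_antipode : ∀ x : H,
    LinearMap.mul' ℂ H (TensorProduct.map LinearMap.id antipode (comul x)) = counitalL x
  antipode_mul_antipode : ∀ x : H,
    LinearMap.mul' ℂ H (TensorProduct.map antipode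
      ((LinearMap.mul' ℂ H).comp (TensorProduct.map LinearMap.id antipode))
        (comul.lTensor H (comul x))) = antipode x

/-- Weak `C*`-Hopf algebras: weak Hopf algebras whose underlying algebra is a `C*`-algebra such that
`Δ(x*) = Δ(x)*`. -/
class WeakCStarHopfAlgebra (A : Type u) [CStarAlgebra A] extends WeakHopfAlgebra A where
  comul_star : ∀ x : A, comul (star x) = star (comul x)

open WeakHopfAlgebra (antipode)

section Basic

variable {H : Type u} [Ring H] [Algebra ℂ H] [WeakHopfAlgebra H]

/-- The subspace `A_L = {(φ ⊗ id)(Δ(1)) | φ}`. -/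
noncomputable def subL (H : Type u) [Ring H] [Algebra ℂ H] [WeakHopfAlgebra H] : Submodule ℂ H :=
  Submodule.span ℂ (Set.range fun φ : Module.Dual ℂ H =>
    TensorProduct.lid ℂ H (φ.rTensor H (comul (R := ℂ) (1 : H))))

/-- The subspace `A_R = {(id ⊗ φ)(Δ(1)) | φ}`. -/
noncomputable def subR (H : Type u) [Ring H] [Algebra ℂ H] [WeakHopfAlgebra H] : Submodule ℂ H :=
  Submodule.span ℂ (Set.range fun φ : Module.Dual ℂ H =>
    TensorProduct.rid ℂ H (φ.lTensor H (comul (R := ℂ) (1 : H))))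

lemma sum_repr_eq {a : H} (r : Coalgebra.Repr ℂ a (H × H)) :
    comul (R := ℂ) a = ∑ i ∈ r.index, r.left i ⊗ₜ[ℂ] r.right i := r.eq.symm

lemma counitalL_eq (r : Coalgebra.Repr ℂ (1 : H) (H × H)) (x : H) :
    counitalL x = ∑ i ∈ r.index, counit (R := ℂ) (r.left i * x) • r.right i := by
  simp [counitalL, sum_repr_eq r]

lemma counitalR_eq (r : Coalgebra.Repr ℂ (1 : H) (H × H)) (x : H) :
    counitalR x = ∑ i ∈ r.index, counit (R := ℂ) (x * r.right i) • r.left i := by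
  simp [counitalR, sum_repr_eq r]

lemma counitalL_mem (x : H) : counitalL x ∈ subL H :=
  Submodule.subset_span ⟨(counit (R := ℂ)).comp (LinearMap.mulRight ℂ x), rfl⟩

lemma comul_of_mem_subL {b : H} (hb : b ∈ subL H) :
    comul (R := ℂ) b = (b ⊗ₜ[ℂ] 1) * comul (R := ℂ) (1 : H) ∧
      comul (R := ℂ) b = comul (R := ℂ) (1 : H) * (b ⊗ₜ[ℂ] 1) := by
  induction hb using Submodule.span_induction with
  | mem b hb =>
    obtain ⟨φ, rfl⟩ := hb
    have key : comul (R := ℂ) (TensorProduct.lid ℂ H (φ.rTensor H (comul (R := ℂ) (1 : H)))) =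
        TensorProduct.lid ℂ (H ⊗[ℂ] H) (φ.rTensor (H ⊗[ℂ] H)
          (comul.lTensor H (comul (R := ℂ) (1 : H)))) := by
      set t := comul (R := ℂ) (1 : H)
      induction t with
      | zero => simp
      | add x y hx hy => simp only [map_add, hx, hy]
      | tmul x y => simp
    have r := Coalgebra.Repr.arbitrary ℂ (1 : H)
    constructor
    · refine key.trans ?_
      rw [← WeakHopfAlgebra.weak_comul_one]
      simp only [sum_repr_eq r, TensorProduct.sum_tmul, TensorProduct.tmul_sum, map_sum,
        Finset.sum_mul, Finset.mul_sum, TensorProduct.assoc_tmul,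
        Algebra.TensorProduct.tmul_mul_tmul, one_mul, mul_one, LinearMap.rTensor_tmul,
        TensorProduct.lid_tmul]
      simp [TensorProduct.smul_tmul']
    · refine key.trans ?_
      rw [← WeakHopfAlgebra.weak_comul_one']
      simp only [sum_repr_eq r, TensorProduct.sum_tmul, TensorProduct.tmul_sum, map_sum,
        Finset.sum_mul, Finset.mul_sum, TensorProduct.assoc_tmul,
        Algebra.TensorProduct.tmul_mul_tmul, one_mul, mul_one, LinearMap.rTensor_tmul,
        TensorProduct.lid_tmul]
      simp [TensorProduct.smul_tmul']
  | zero => simp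
  | add x y _ _ hx hy =>
    exact ⟨by rw [map_add, hx.1, hy.1, TensorProduct.add_tmul, add_mul],
      by rw [map_add, hx.2, hy.2, TensorProduct.add_tmul, mul_add]⟩
  | smul c x _ hx =>
    exact ⟨by rw [map_smul, hx.1, ← TensorProduct.smul_tmul', smul_mul_assoc],
      by rw [map_smul, hx.2, ← TensorProduct.smul_tmul', mul_smul_comm]⟩

lemma comul_mul_of_mem_subL {b : H} (hb : b ∈ subL H) (a : H) :
    comul (R := ℂ) (a * b) = comul (R := ℂ) a * (b ⊗ₜ[ℂ] 1) := by
  rw [WeakHopfAlgebra.comul_mul, (comul_of_mem_subL hb).2, ← mul_assoc,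
    ← WeakHopfAlgebra.comul_mul, mul_one]

lemma comul_mul_of_mem_subL' {b : H} (hb : b ∈ subL H) (a : H) :
    comul (R := ℂ) (b * a) = (b ⊗ₜ[ℂ] 1) * comul (R := ℂ) a := by
  rw [WeakHopfAlgebra.comul_mul, (comul_of_mem_subL hb).1, mul_assoc,
    ← WeakHopfAlgebra.comul_mul, one_mul]

lemma counitalL_mul_comul (a : H) :
    LinearMap.mul' ℂ H (counitalL.rTensor H (comul (R := ℂ) a)) = a := by
  have h1 : comul (R := ℂ) (1 : H) * comul (R := ℂ) a = comul (R := ℂ) a := by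
    rw [← WeakHopfAlgebra.comul_mul, one_mul]
  have h2 := congrArg (fun t => TensorProduct.lid ℂ H ((counit (R := ℂ)).rTensor H t)) h1
  have r := Coalgebra.Repr.arbitrary ℂ (1 : H)
  have s := Coalgebra.Repr.arbitrary ℂ a
  simp only [Coalgebra.rTensor_counit_comul, TensorProduct.lid_tmul, one_smul] at h2
  simp only [sum_repr_eq r, sum_repr_eq s, Finset.sum_mul, Finset.mul_sum, map_sum,
    Algebra.TensorProduct.tmul_mul_tmul, LinearMap.rTensor_tmul, TensorProduct.lid_tmul] at h2
  simp only [sum_repr_eq s, map_sum, LinearMap.rTensor_tmul, LinearMap.mul'_apply, counitalL_eq r,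
    Finset.sum_mul, smul_mul_assoc]
  exact h2

lemma counitalL_lTensor_comul_one :
    (counitalL).lTensor H (comul (R := ℂ) (1 : H)) = comul (R := ℂ) (1 : H) := by
  have h1 := congrArg (fun t => (TensorProduct.lid ℂ H).toLinearMap.lTensor H
    (((counit (R := ℂ)).rTensor H).lTensor H t)) (WeakHopfAlgebra.weak_comul_one' (H := H))
  have h3 : (TensorProduct.lid ℂ H).toLinearMap.lTensor H
      (((counit (R := ℂ)).rTensor H).lTensor H (comul.lTensor H (comul (R := ℂ) (1 : H)))) =
      comul (R := ℂ) (1 : H) := by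
    rw [← LinearMap.comp_apply, ← LinearMap.comp_apply, ← LinearMap.lTensor_comp,
      ← LinearMap.lTensor_comp, LinearMap.comp_assoc, show (TensorProduct.lid ℂ H).toLinearMap.comp
        (((counit (R := ℂ)).rTensor H).comp comul) = LinearMap.id by ext; simp,
      LinearMap.lTensor_id, LinearMap.id_apply]
  have r := Coalgebra.Repr.arbitrary ℂ (1 : H)
  refine Eq.trans ?_ (h1.trans h3)
  simp only [sum_repr_eq r, TensorProduct.sum_tmul, TensorProduct.tmul_sum, map_sum,
    Finset.sum_mul, Finset.mul_sum, TensorProduct.assoc_tmul,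
    Algebra.TensorProduct.tmul_mul_tmul, one_mul, mul_one, LinearMap.rTensor_tmul,
    TensorProduct.lid_tmul, LinearMap.lTensor_tmul, counitalL_eq r, LinearEquiv.coe_coe]

end Basic

/-- The dual space `Â` of a weak Hopf algebra `A` with the convolution product
`⟨φψ | a⟩ = ⟨φ | a₍₁₎⟩ ⟨ψ | a₍₂₎⟩`, whose unit is the counit of `A`. -/
def Hat (H : Type u) [Ring H] [Algebra ℂ H] : Type u := WithConv (H →ₗ[ℂ] ℂ)

namespace Hat

section AlgebraStructure

variable {H : Type u} [Ring H] [Algebra ℂ H] [WeakHopfAlgebra H]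

noncomputable instance : Ring (Hat H) := inferInstanceAs (Ring (WithConv (H →ₗ[ℂ] ℂ)))

noncomputable instance : Algebra ℂ (Hat H) := inferInstanceAs (Algebra ℂ (WithConv (H →ₗ[ℂ] ℂ)))

/-- `Â` is the space of all linear functionals on `A`. -/
noncomputable def toDual (H : Type u) [Ring H] [Algebra ℂ H] [WeakHopfAlgebra H] :
    Hat H ≃ₗ[ℂ] Module.Dual ℂ H where
  toFun φ := WithConv.ofConv φ
  invFun f := WithConv.toConv f
  map_add' _ _ := rfl
  map_smul' _ _ := rfl
  left_inv _ := rfl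
  right_inv _ := rfl

instance [Module.Finite ℂ H] : Module.Finite ℂ (Hat H) :=
  Module.Finite.equiv (toDual H).symm

/-- The canonical pairing `⟨φ | a⟩ = φ(a)` of `Â` and `A`. -/
noncomputable def pairing (H : Type u) [Ring H] [Algebra ℂ H] [WeakHopfAlgebra H] :
    Hat H →ₗ[ℂ] H →ₗ[ℂ] ℂ :=
  (toDual H).toLinearMap

lemma ext {φ ψ : Hat H} (h : ∀ a, pairing H φ a = pairing H ψ a) : φ = ψ :=
  (toDual H).injective (LinearMap.ext h)

/-- A linear functional, as an element of `Â`. -/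
noncomputable def of (f : H →ₗ[ℂ] ℂ) : Hat H := (toDual H).symm f

@[simp] lemma pairing_of (f : H →ₗ[ℂ] ℂ) (a : H) : pairing H (of f) a = f a := rfl

lemma pairing_mul (φ ψ : Hat H) (a : H) : pairing H (φ * ψ) a =
    LinearMap.mul' ℂ ℂ (TensorProduct.map (pairing H φ) (pairing H ψ) (comul (R := ℂ) a)) := rfl

lemma pairing_one (a : H) : pairing H 1 a = counit (R := ℂ) a := rfl

lemma pairing_mul_repr (φ ψ : Hat H) {a : H} (r : Coalgebra.Repr ℂ a (H × H)) :
    pairing H (φ * ψ) a = ∑ i ∈ r.index, pairing H φ (r.left i) * pairing H ψ (r.right i) := by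
  simp [pairing_mul, sum_repr_eq r]

lemma sum_mul_counit (f : H →ₗ[ℂ] ℂ) {a : H} (r : Coalgebra.Repr ℂ a (H × H)) :
    ∑ i ∈ r.index, f (r.left i) * counit (R := ℂ) (r.right i) = f a := by
  have := congrArg (fun t => f (TensorProduct.rid ℂ H t))
    (Coalgebra.lTensor_counit_comul (R := ℂ) a)
  rw [sum_repr_eq r] at this
  simpa [-Coalgebra.sum_tmul_counit_eq, mul_comm] using this

lemma sum_counit_mul (f : H →ₗ[ℂ] ℂ) {a : H} (r : Coalgebra.Repr ℂ a (H × H)) :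
    ∑ i ∈ r.index, counit (R := ℂ) (r.left i) * f (r.right i) = f a := by
  have := congrArg (fun t => f (TensorProduct.lid ℂ H t))
    (Coalgebra.rTensor_counit_comul (R := ℂ) a)
  rw [sum_repr_eq r] at this
  simpa [-Coalgebra.sum_counit_tmul_eq] using this

/-- The antipode of `Â`: `⟨Ŝ(φ) | a⟩ = ⟨φ | S(a)⟩`. -/
noncomputable def antipodeMap (H : Type u) [Ring H] [Algebra ℂ H] [WeakHopfAlgebra H] :
    Hat H →ₗ[ℂ] Hat H :=
  (toDual H).symm.toLinearMap.comp
    ((LinearMap.lcomp ℂ ℂ (antipode (H := H))).comp (pairing H))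

lemma pairing_antipodeMap (φ : Hat H) (a : H) :
    pairing H (antipodeMap H φ) a = pairing H φ (antipode a) := rfl

lemma map_comp_lTensor {M : Type*} [AddCommGroup M] [Module ℂ M] {N P : Type*} [AddCommGroup N]
    [Module ℂ N] [AddCommGroup P] [Module ℂ P] (f : M →ₗ[ℂ] N) (g : M ⊗[ℂ] M →ₗ[ℂ] P)
    (h : M →ₗ[ℂ] M ⊗[ℂ] M) (t : M ⊗[ℂ] M) :
    TensorProduct.map f g (h.lTensor M t) = TensorProduct.map f (g.comp h) t := by
  induction t with
  | zero => simp
  | add x y hx hy => simp only [map_add, hx, hy]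
  | tmul φ ψ => simp

lemma pairing_mul_mul_one (φ ψ χ : Hat H) :
    pairing H (φ * ψ * χ) 1 = LinearMap.mul' ℂ ℂ (TensorProduct.map (pairing H φ)
      ((LinearMap.mul' ℂ ℂ).comp (TensorProduct.map (pairing H ψ) (pairing H χ)))
      ((comul (R := ℂ)).lTensor H (comul (R := ℂ) (1 : H)))) := by
  rw [mul_assoc, pairing_mul, map_comp_lTensor]
  rfl

end AlgebraStructure

section Star

variable {A : Type u} [Ring A] [Algebra ℂ A] [StarRing A] [StarModule ℂ A] [WeakHopfAlgebra A]

/-- The involution of `Â`: `⟨φ* | a⟩` is the complex conjugate of `⟨φ | S(a)*⟩`. -/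
noncomputable instance : Star (Hat A) where
  star φ := of
    { toFun := fun a => star (pairing A φ (star (antipode a)))
      map_add' := fun a b => by simp only [map_add, star_add]
      map_smul' := fun c a => by simp only [map_smul, star_smul, smul_eq_mul, star_mul', star_star,
        RingHom.id_apply] }

end Star

section Dual

variable {H : Type u} [Ring H] [Algebra ℂ H] [WeakHopfAlgebra H] [Module.Finite ℂ H]

/-- The pairing of `Â ⊗ Â` with `A ⊗ A`. -/
noncomputable def pairing₂ (H : Type u) [Ring H] [Algebra ℂ H] [WeakHopfAlgebra H]
    [Module.Finite ℂ H] :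
    (Hat H ⊗[ℂ] Hat H) ≃ₗ[ℂ] ((H ⊗[ℂ] H) →ₗ[ℂ] ℂ) :=
  (TensorProduct.congr (toDual H) (toDual H)).trans (TensorProduct.dualDistribEquiv ℂ H H)

@[simp] lemma pairing₂_tmul (φ ψ : Hat H) (a b : H) :
    pairing₂ H (φ ⊗ₜ ψ) (a ⊗ₜ b) = pairing H φ a * pairing H ψ b :=
  TensorProduct.dualDistrib_apply (R := ℂ) (M := H) (N := H) (toDual H φ) (toDual H ψ) a b

lemma ext₂ {s t : Hat H ⊗[ℂ] Hat H}
    (h : ∀ a b, pairing₂ H s (a ⊗ₜ b) = pairing₂ H t (a ⊗ₜ b)) : s = t :=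
  (pairing₂ H).injective (TensorProduct.ext' h)

/-- The pairing of `Â ⊗ Â ⊗ Â` with `A ⊗ A ⊗ A`. -/
noncomputable def pairing₃ (H : Type u) [Ring H] [Algebra ℂ H] [WeakHopfAlgebra H]
    [Module.Finite ℂ H] :
    (Hat H ⊗[ℂ] (Hat H ⊗[ℂ] Hat H)) ≃ₗ[ℂ] ((H ⊗[ℂ] (H ⊗[ℂ] H)) →ₗ[ℂ] ℂ) :=
  (TensorProduct.congr (toDual H) (pairing₂ H)).trans
    (TensorProduct.dualDistribEquiv ℂ H (H ⊗[ℂ] H))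

@[simp] lemma pairing₃_tmul (φ : Hat H) (s : Hat H ⊗[ℂ] Hat H) (a : H) (t : H ⊗[ℂ] H) :
    pairing₃ H (φ ⊗ₜ s) (a ⊗ₜ t) = pairing H φ a * pairing₂ H s t :=
  TensorProduct.dualDistrib_apply (R := ℂ) (M := H) (N := H ⊗[ℂ] H) (toDual H φ) (pairing₂ H s) a t

lemma ext₃ {s t : Hat H ⊗[ℂ] (Hat H ⊗[ℂ] Hat H)}
    (h : ∀ a b c, pairing₃ H s (a ⊗ₜ (b ⊗ₜ c)) = pairing₃ H t (a ⊗ₜ (b ⊗ₜ c))) : s = t := by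
  refine (pairing₃ H).injective (LinearMap.ext fun x => ?_)
  induction x with
  | zero => simp
  | add x y hx hy => simp only [map_add, hx, hy]
  | tmul a x =>
    induction x with
    | zero => simp
    | add x y hx hy => simp only [TensorProduct.tmul_add, map_add, hx, hy]
    | tmul b c => exact h a b c

/-- The coproduct and counit of `Â`: `⟨Δ̂(φ) | a ⊗ b⟩ = ⟨φ | ab⟩` and `ε̂(φ) = ⟨φ | 1⟩`. -/
noncomputable instance : CoalgebraStruct ℂ (Hat H) where
  comul := (pairing₂ H).symm.toLinearMap.comp
    ((LinearMap.lcomp ℂ ℂ (LinearMap.mul' ℂ H)).comp (pairing H))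
  counit := (pairing H).flip 1

lemma pairing₂_comul (φ : Hat H) (t : H ⊗[ℂ] H) :
    pairing₂ H (comul (R := ℂ) φ) t = pairing H φ (LinearMap.mul' ℂ H t) := by
  simp [CoalgebraStruct.comul]

lemma counit_apply (φ : Hat H) : counit (R := ℂ) φ = pairing H φ 1 := rfl

lemma pairing₃_lTensor_comul (t : Hat H ⊗[ℂ] Hat H) (a b c : H) :
    pairing₃ H ((comul (R := ℂ)).lTensor (Hat H) t) (a ⊗ₜ (b ⊗ₜ c)) =
      pairing₂ H t (a ⊗ₜ (b * c)) := by
  induction t with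
  | zero => simp
  | add x y hx hy => simp only [map_add, LinearMap.add_apply, hx, hy]
  | tmul φ ψ => simp [pairing₂_comul]

lemma pairing₃_assoc (t : Hat H ⊗[ℂ] Hat H) (φ : Hat H) (a b c : H) :
    pairing₃ H (TensorProduct.assoc ℂ _ _ _ (t ⊗ₜ φ)) (a ⊗ₜ (b ⊗ₜ c)) =
      pairing₂ H t (a ⊗ₜ b) * pairing H φ c := by
  induction t with
  | zero => simp
  | add x y hx hy =>
    simp only [TensorProduct.add_tmul, map_add, LinearMap.add_apply, hx, hy, add_mul]
  | tmul φ ψ => simp [mul_assoc]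

lemma pairing₃_rTensor_comul (t : Hat H ⊗[ℂ] Hat H) (a b c : H) :
    pairing₃ H (TensorProduct.assoc ℂ _ _ _ ((comul (R := ℂ)).rTensor (Hat H) t))
      (a ⊗ₜ (b ⊗ₜ c)) = pairing₂ H t ((a * b) ⊗ₜ c) := by
  induction t with
  | zero => simp
  | add x y hx hy => simp only [map_add, LinearMap.add_apply, hx, hy]
  | tmul φ ψ => simp [pairing₃_assoc, pairing₂_comul]

lemma lid_counit (t : Hat H ⊗[ℂ] Hat H) (a : H) :
    pairing H (TensorProduct.lid ℂ _ ((counit (R := ℂ)).rTensor (Hat H) t)) a =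
      pairing₂ H t (1 ⊗ₜ a) := by
  induction t with
  | zero => simp
  | add x y hx hy => simp only [map_add, LinearMap.add_apply, hx, hy]
  | tmul φ ψ => simp [counit_apply]

lemma rid_counit (t : Hat H ⊗[ℂ] Hat H) (a : H) :
    pairing H (TensorProduct.rid ℂ _ ((counit (R := ℂ)).lTensor (Hat H) t)) a =
      pairing₂ H t (a ⊗ₜ 1) := by
  induction t with
  | zero => simp
  | add x y hx hy => simp only [map_add, LinearMap.add_apply, hx, hy]
  | tmul φ ψ => simp [counit_apply, mul_comm]

noncomputable instance : Coalgebra ℂ (Hat H) where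
  coassoc := LinearMap.ext fun φ => ext₃ fun a b c => by
    simp [pairing₃_rTensor_comul, pairing₃_lTensor_comul, pairing₂_comul, mul_assoc]
  rTensor_counit_comp_comul := LinearMap.ext fun φ => by
    apply (TensorProduct.lid ℂ (Hat H)).injective
    refine ext fun a => ?_
    rw [LinearMap.comp_apply, lid_counit, pairing₂_comul]
    simp
  lTensor_counit_comp_comul := LinearMap.ext fun φ => by
    apply (TensorProduct.rid ℂ (Hat H)).injective
    refine ext fun a => ?_
    rw [LinearMap.comp_apply, rid_counit, pairing₂_comul]
    simp

lemma pairing₂_mul (s t : Hat H ⊗[ℂ] Hat H) {a b : H} (r : Coalgebra.Repr ℂ a (H × H))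
    (r' : Coalgebra.Repr ℂ b (H × H)) :
    pairing₂ H (s * t) (a ⊗ₜ b) = ∑ i ∈ r.index, ∑ j ∈ r'.index,
      pairing₂ H s (r.left i ⊗ₜ r'.left j) * pairing₂ H t (r.right i ⊗ₜ r'.right j) := by
  induction s with
  | zero => simp
  | add x y hx hy =>
    simp only [map_add, LinearMap.add_apply, hx, hy, add_mul, Finset.sum_add_distrib]
  | tmul φ ψ =>
    induction t with
    | zero => simp
    | add x y hx hy =>
      simp only [map_add, LinearMap.add_apply, hx, hy, mul_add, Finset.sum_add_distrib]
    | tmul φ' ψ' =>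
      simp only [Algebra.TensorProduct.tmul_mul_tmul, pairing₂_tmul, pairing_mul_repr _ _ r,
        pairing_mul_repr _ _ r', Finset.sum_mul_sum]
      exact Finset.sum_congr rfl fun i _ => Finset.sum_congr rfl fun j _ => by ring

lemma pairing₃_mul (s t : Hat H ⊗[ℂ] (Hat H ⊗[ℂ] Hat H)) {a b c : H}
    (r : Coalgebra.Repr ℂ a (H × H)) (r' : Coalgebra.Repr ℂ b (H × H))
    (r'' : Coalgebra.Repr ℂ c (H × H)) :
    pairing₃ H (s * t) (a ⊗ₜ (b ⊗ₜ c)) =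
      ∑ i ∈ r.index, ∑ j ∈ r'.index, ∑ k ∈ r''.index,
        pairing₃ H s (r.left i ⊗ₜ (r'.left j ⊗ₜ r''.left k)) *
          pairing₃ H t (r.right i ⊗ₜ (r'.right j ⊗ₜ r''.right k)) := by
  induction s with
  | zero => simp
  | add x y hx hy =>
    simp only [map_add, LinearMap.add_apply, hx, hy, add_mul, Finset.sum_add_distrib]
  | tmul φ s =>
    induction t with
    | zero => simp
    | add x y hx hy =>
      simp only [map_add, LinearMap.add_apply, hx, hy, mul_add, Finset.sum_add_distrib]
    | tmul ψ t =>
      simp only [Algebra.TensorProduct.tmul_mul_tmul, pairing₃_tmul, pairing_mul_repr _ _ r,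
        pairing₂_mul _ _ r' r'', Finset.sum_mul]
      refine Finset.sum_congr rfl fun i _ => ?_
      simp only [Finset.mul_sum]
      exact Finset.sum_congr rfl fun j _ => Finset.sum_congr rfl fun k _ => by ring

lemma pairing_mul' (t : Hat H ⊗[ℂ] Hat H) {a : H} (r : Coalgebra.Repr ℂ a (H × H)) :
    pairing H (LinearMap.mul' ℂ (Hat H) t) a =
      ∑ i ∈ r.index, pairing₂ H t (r.left i ⊗ₜ r.right i) := by
  induction t with
  | zero => simp
  | add x y hx hy => simp only [map_add, LinearMap.add_apply, hx, hy, Finset.sum_add_distrib]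
  | tmul φ ψ => simp [pairing_mul_repr _ _ r]

lemma pairing_counitalR (φ : Hat H) (x : H) :
    pairing H (counitalR φ) x = pairing H φ (counitalR x) := by
  have r := Coalgebra.Repr.arbitrary ℂ (1 : H)
  have key : ∀ t : Hat H ⊗[ℂ] Hat H, pairing H (TensorProduct.rid ℂ (Hat H)
      (((counit (R := ℂ)).comp (LinearMap.mulLeft ℂ φ)).lTensor (Hat H) t)) x =
      ∑ i ∈ r.index, pairing H φ (r.left i) * pairing₂ H t (x ⊗ₜ r.right i) := by
    intro t
    induction t with
    | zero => simp
    | add x y hx hy =>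
      simp only [map_add, LinearMap.add_apply, hx, hy, mul_add, Finset.sum_add_distrib]
    | tmul α β =>
      simp only [LinearMap.lTensor_tmul, TensorProduct.rid_tmul,
        LinearMap.comp_apply, LinearMap.mulLeft_apply, counit_apply, pairing_mul_repr _ _ r, map_smul,
        LinearMap.smul_apply, smul_eq_mul, pairing₂_tmul, Finset.sum_mul]
      exact Finset.sum_congr rfl fun i _ => by ring
  rw [counitalR_eq r]
  refine (key _).trans ?_
  simp [pairing₂_comul, pairing_one, mul_comm]

lemma pairing_counitalL (φ : Hat H) (x : H) :
    pairing H (counitalL φ) x = pairing H φ (counitalL x) := by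
  have r := Coalgebra.Repr.arbitrary ℂ (1 : H)
  have key : ∀ t : Hat H ⊗[ℂ] Hat H, pairing H (TensorProduct.lid ℂ (Hat H)
      (((counit (R := ℂ)).comp (LinearMap.mulRight ℂ φ)).rTensor (Hat H) t)) x =
      ∑ i ∈ r.index, pairing H φ (r.right i) * pairing₂ H t (r.left i ⊗ₜ x) := by
    intro t
    induction t with
    | zero => simp
    | add x y hx hy =>
      simp only [map_add, LinearMap.add_apply, hx, hy, mul_add, Finset.sum_add_distrib]
    | tmul α β =>
      simp only [LinearMap.rTensor_tmul, TensorProduct.lid_tmul,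
        LinearMap.comp_apply, LinearMap.mulRight_apply, counit_apply, pairing_mul_repr _ _ r, map_smul,
        LinearMap.smul_apply, smul_eq_mul, pairing₂_tmul, Finset.sum_mul]
      exact Finset.sum_congr rfl fun i _ => by ring
  rw [counitalL_eq r]
  refine (key _).trans ?_
  simp [pairing₂_comul, pairing_one, mul_comm]

lemma pairing₂_map (t : Hat H ⊗[ℂ] Hat H) (f g : Hat H →ₗ[ℂ] Hat H) (f' g' : H →ₗ[ℂ] H)
    (hf : ∀ φ a, pairing H (f φ) a = pairing H φ (f' a))
    (hg : ∀ φ a, pairing H (g φ) a = pairing H φ (g' a)) (a b : H) :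
    pairing₂ H (TensorProduct.map f g t) (a ⊗ₜ b) = pairing₂ H t (f' a ⊗ₜ g' b) := by
  induction t with
  | zero => simp
  | add x y hx hy => simp only [map_add, LinearMap.add_apply, hx, hy]
  | tmul φ ψ => simp [hf, hg]

lemma pairing_mul'_map (φ : Hat H) (f g : Hat H →ₗ[ℂ] Hat H) (f' g' : H →ₗ[ℂ] H)
    (hf : ∀ φ a, pairing H (f φ) a = pairing H φ (f' a))
    (hg : ∀ φ a, pairing H (g φ) a = pairing H φ (g' a)) (a : H) :
    pairing H (LinearMap.mul' ℂ (Hat H) (TensorProduct.map f g (comul (R := ℂ) φ))) a =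
      pairing H φ (LinearMap.mul' ℂ H (TensorProduct.map f' g' (comul (R := ℂ) a))) := by
  have r := Coalgebra.Repr.arbitrary ℂ a
  rw [pairing_mul' _ r]
  simp [pairing₂_map _ f g f' g' hf hg, pairing₂_comul, sum_repr_eq r]

noncomputable instance : WeakHopfAlgebra (Hat H) where
  comul_mul φ ψ := ext₂ fun a b => by
    have r := Coalgebra.Repr.arbitrary ℂ a
    have r' := Coalgebra.Repr.arbitrary ℂ b
    rw [pairing₂_comul, LinearMap.mul'_apply, pairing₂_mul _ _ r r', pairing_mul,
      WeakHopfAlgebra.comul_mul]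
    simp [sum_repr_eq r, sum_repr_eq r', Finset.sum_mul_sum, pairing₂_comul]
  weak_comul_one := ext₃ fun a b c => by
    have r := Coalgebra.Repr.arbitrary ℂ a
    have r' := Coalgebra.Repr.arbitrary ℂ b
    have r'' := Coalgebra.Repr.arbitrary ℂ c
    rw [pairing₃_lTensor_comul, pairing₂_comul, pairing₃_mul _ _ r r' r'', LinearMap.mul'_apply,
      pairing_one, ← mul_assoc, ← WeakHopfAlgebra.weak_counit a b c, Finset.sum_comm]
    simp only [pairing₃_assoc, pairing₃_tmul, pairing₂_comul, pairing_one, LinearMap.mul'_apply,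
      sum_repr_eq r', map_sum, TensorProduct.map_tmul, LinearMap.comp_apply,
      LinearMap.mulLeft_apply, LinearMap.mulRight_apply]
    refine Finset.sum_congr rfl fun j _ => ?_
    have h1 := sum_mul_counit ((counit (R := ℂ)).comp (LinearMap.mulRight ℂ (r'.left j))) r
    have h2 := sum_counit_mul ((counit (R := ℂ)).comp (LinearMap.mulLeft ℂ (r'.right j))) r''
    simp only [LinearMap.comp_apply, LinearMap.mulLeft_apply, LinearMap.mulRight_apply] at h1 h2
    rw [← h1, ← h2, Finset.sum_mul_sum]
    exact Finset.sum_congr rfl fun i _ => Finset.sum_congr rfl fun k _ => by ring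
  weak_comul_one' := ext₃ fun a b c => by
    have r := Coalgebra.Repr.arbitrary ℂ a
    have r' := Coalgebra.Repr.arbitrary ℂ b
    have r'' := Coalgebra.Repr.arbitrary ℂ c
    rw [pairing₃_lTensor_comul, pairing₂_comul, pairing₃_mul _ _ r r' r'', LinearMap.mul'_apply,
      pairing_one, ← mul_assoc, ← WeakHopfAlgebra.weak_counit' a b c, Finset.sum_comm]
    simp only [pairing₃_assoc, pairing₃_tmul, pairing₂_comul, pairing_one, LinearMap.mul'_apply,
      sum_repr_eq r', map_sum, TensorProduct.map_tmul, LinearMap.comp_apply,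
      LinearMap.mulLeft_apply, LinearMap.mulRight_apply]
    refine Finset.sum_congr rfl fun j _ => ?_
    have h1 := sum_counit_mul ((counit (R := ℂ)).comp (LinearMap.mulRight ℂ (r'.right j))) r
    have h2 := sum_mul_counit ((counit (R := ℂ)).comp (LinearMap.mulLeft ℂ (r'.left j))) r''
    simp only [LinearMap.comp_apply, LinearMap.mulLeft_apply, LinearMap.mulRight_apply] at h1 h2
    rw [← h1, ← h2, mul_comm, Finset.sum_mul_sum]
    exact Finset.sum_congr rfl fun i _ => Finset.sum_congr rfl fun k _ => by ring
  weak_counit φ ψ χ := by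
    have r := Coalgebra.Repr.arbitrary ℂ (1 : H)
    have key : ∀ t : Hat H ⊗[ℂ] Hat H, LinearMap.mul' ℂ ℂ (TensorProduct.map
        ((counit (R := ℂ)).comp (LinearMap.mulLeft ℂ φ))
        ((counit (R := ℂ)).comp (LinearMap.mulRight ℂ χ)) t) =
        ∑ i ∈ r.index, ∑ j ∈ r.index, pairing H φ (r.left i) *
          (pairing₂ H t (r.right i ⊗ₜ r.left j) * pairing H χ (r.right j)) := by
      intro t
      induction t with
      | zero => simp
      | add x y hx hy =>
        simp only [map_add, LinearMap.add_apply, hx, hy, mul_add, add_mul, Finset.sum_add_distrib]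
      | tmul α β =>
        simp only [TensorProduct.map_tmul, LinearMap.comp_apply, LinearMap.mulLeft_apply,
          LinearMap.mulRight_apply, LinearMap.mul'_apply, counit_apply, pairing_mul_repr _ _ r,
          Finset.sum_mul_sum, pairing₂_tmul]
        exact Finset.sum_congr rfl fun i _ => Finset.sum_congr rfl fun k _ => by ring
    refine (key _).trans ?_
    rw [counit_apply, pairing_mul_mul_one, ← WeakHopfAlgebra.weak_comul_one]
    simp [sum_repr_eq r, TensorProduct.sum_tmul, TensorProduct.tmul_sum, Finset.sum_mul_sum,
      pairing₂_comul]
  weak_counit' φ ψ χ := by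
    have r := Coalgebra.Repr.arbitrary ℂ (1 : H)
    have key : ∀ t : Hat H ⊗[ℂ] Hat H, LinearMap.mul' ℂ ℂ (TensorProduct.map
        ((counit (R := ℂ)).comp (LinearMap.mulRight ℂ χ))
        ((counit (R := ℂ)).comp (LinearMap.mulLeft ℂ φ)) t) =
        ∑ j ∈ r.index, ∑ i ∈ r.index, pairing H φ (r.left i) *
          (pairing₂ H t (r.left j ⊗ₜ r.right i) * pairing H χ (r.right j)) := by
      intro t
      induction t with
      | zero => simp
      | add x y hx hy =>
        simp only [map_add, LinearMap.add_apply, hx, hy, mul_add, add_mul, Finset.sum_add_distrib]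
      | tmul α β =>
        simp only [TensorProduct.map_tmul, LinearMap.comp_apply, LinearMap.mulLeft_apply,
          LinearMap.mulRight_apply, LinearMap.mul'_apply, counit_apply, pairing_mul_repr _ _ r,
          Finset.sum_mul_sum, pairing₂_tmul]
        exact Finset.sum_congr rfl fun i _ => Finset.sum_congr rfl fun k _ => by ring
    refine (key _).trans ?_
    rw [counit_apply, pairing_mul_mul_one, ← WeakHopfAlgebra.weak_comul_one']
    simp [sum_repr_eq r, TensorProduct.sum_tmul, TensorProduct.tmul_sum, Finset.sum_mul_sum,
      pairing₂_comul]
  antipode := antipodeMap H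
  antipode_mul φ := ext fun x => by
    rw [pairing_mul'_map φ _ _ antipode LinearMap.id pairing_antipodeMap (fun _ _ => rfl),
      WeakHopfAlgebra.antipode_mul, pairing_counitalR]
  mul_antipode φ := ext fun x => by
    rw [pairing_mul'_map φ _ _ LinearMap.id antipode (fun _ _ => rfl) pairing_antipodeMap,
      WeakHopfAlgebra.mul_antipode, pairing_counitalL]
  antipode_mul_antipode φ := ext fun x => by
    have h1 : ((LinearMap.mul' ℂ H).comp (TensorProduct.map LinearMap.id antipode)).comp comul =
        counitalL := LinearMap.ext fun a => WeakHopfAlgebra.mul_antipode a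
    have h2 : ((LinearMap.mul' ℂ (Hat H)).comp
        (TensorProduct.map LinearMap.id (antipodeMap H))).comp comul = counitalL :=
      LinearMap.ext fun a => ext fun x => by
        rw [LinearMap.comp_apply, LinearMap.comp_apply, pairing_mul'_map a _ _ LinearMap.id antipode
          (fun _ _ => rfl) pairing_antipodeMap, WeakHopfAlgebra.mul_antipode, pairing_counitalL]
    have h3 := WeakHopfAlgebra.antipode_mul_antipode x
    rw [map_comp_lTensor, h1] at h3
    rw [map_comp_lTensor, h2, pairing_mul'_map φ _ _ antipode counitalL pairing_antipodeMap
      pairing_counitalL, h3, pairing_antipodeMap]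

end Dual

end Hat

/-- A left action `a ▷ m` of a weak Hopf algebra `H` on a complex algebra `M` with
`a ▷ (mn) = (a₍₁₎ ▷ m)(a₍₂₎ ▷ n)` and `a ▷ 1 = (ε(1₍₁₎ a) 1₍₂₎) ▷ 1`. -/
structure ModuleAlgebra (H : Type u) [Ring H] [Algebra ℂ H] [WeakHopfAlgebra H]
    (M : Type v) [Ring M] [Algebra ℂ M] where
  /-- The action `a ▷ m`. -/
  act : H →ₐ[ℂ] Module.End ℂ M
  act_mul : ∀ (a : H) (m n : M), act a (m * n) = LinearMap.mul' ℂ M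
    (TensorProduct.map (act.toLinearMap.flip m) (act.toLinearMap.flip n) (comul (R := ℂ) a))
  act_one : ∀ a : H, act a 1 = act (counitalL a) 1

/-- An `H`-module algebra in the `*`-setting: additionally `(a ▷ m)* = S(a)* ▷ m*`. -/
structure StarModuleAlgebra (H : Type u) [Ring H] [Algebra ℂ H] [Star H] [WeakHopfAlgebra H]
    (M : Type v) [Ring M] [Algebra ℂ M] [Star M] extends ModuleAlgebra H M where
  star_act : ∀ (a : H) (m : M), star (act a m) = act (star (antipode a)) (star m)

section CrossedProduct

variable {H : Type u} [Ring H] [Algebra ℂ H] [WeakHopfAlgebra H]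
  {M : Type v} [Ring M] [Algebra ℂ M] (α : ModuleAlgebra H M)

lemma ModuleAlgebra.act_mul_repr {a : H} (r : Coalgebra.Repr ℂ a (H × H)) (m n : M) :
    α.act a (m * n) = ∑ i ∈ r.index, α.act (r.left i) m * α.act (r.right i) n := by
  rw [α.act_mul, sum_repr_eq r]
  simp

/-- The submodule of `M ⊗ H` spanned by the elements `m (b ▷ 1) ⊗ a - m ⊗ b a` with `b ∈ H_L`. -/
def crossedRel : Submodule ℂ (M ⊗[ℂ] H) :=
  Submodule.span ℂ {t | ∃ (m : M) (a b : H), b ∈ subL H ∧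
    t = (m * α.act b 1) ⊗ₜ[ℂ] a - m ⊗ₜ[ℂ] (b * a)}

/-- The crossed product `M ⋊ H = M ⊗_{H_L} H`. -/
def CrossedProduct : Type (max u v) := (M ⊗[ℂ] H) ⧸ crossedRel α

namespace CrossedProduct

noncomputable instance : AddCommGroup (CrossedProduct α) :=
  inferInstanceAs (AddCommGroup ((M ⊗[ℂ] H) ⧸ crossedRel α))

noncomputable instance : Module ℂ (CrossedProduct α) :=
  inferInstanceAs (Module ℂ ((M ⊗[ℂ] H) ⧸ crossedRel α))

/-- The projection `M ⊗ H → M ⋊ H`. -/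
noncomputable def proj : M ⊗[ℂ] H →ₗ[ℂ] CrossedProduct α := (crossedRel α).mkQ

/-- The element `m ⋊ a` of the crossed product. -/
noncomputable def mk (m : M) (a : H) : CrossedProduct α := proj α (m ⊗ₜ[ℂ] a)

lemma proj_surjective : Function.Surjective (proj α) := (crossedRel α).mkQ_surjective

lemma proj_tmul (m : M) (a : H) : proj α (m ⊗ₜ[ℂ] a) = mk α m a := rfl

lemma mk_mul_act (m : M) (a : H) {b : H} (hb : b ∈ subL H) :
    mk α (m * α.act b 1) a = mk α m (b * a) := by
  rw [← sub_eq_zero, mk, mk, ← map_sub]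
  exact (Submodule.Quotient.mk_eq_zero _).2 (Submodule.subset_span ⟨m, a, b, hb, rfl⟩)

lemma induction_on {p : CrossedProduct α → Prop} (x : CrossedProduct α) (zero : p 0)
    (add : ∀ x y, p x → p y → p (x + y)) (mk : ∀ m a, p (mk α m a)) : p x := by
  obtain ⟨t, rfl⟩ := proj_surjective α x
  induction t with
  | zero => simpa using zero
  | add x y hx hy => simpa using add _ _ hx hy
  | tmul m a => exact mk m a

lemma hom_ext {V : Type*} [AddCommGroup V] [Module ℂ V] {f g : CrossedProduct α →ₗ[ℂ] V}
    (h : ∀ m a, f (mk α m a) = g (mk α m a)) : f = g :=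
  LinearMap.ext fun x => induction_on α (p := fun x => f x = g x) x (by rw [map_zero, map_zero])
    (fun x y hx hy => by rw [map_add, map_add, hx, hy]) h

/-- Left multiplication of `M ⊗ H` by `1 ⊗ a`: `m ⊗ b ↦ (a₍₁₎ ▷ m) ⊗ a₍₂₎ b`. -/
noncomputable def leftH : H →ₗ[ℂ] Module.End ℂ (M ⊗[ℂ] H) :=
  (TensorProduct.homTensorHomMap (RingHom.id ℂ) M H M H).comp
    ((TensorProduct.map α.act.toLinearMap (LinearMap.mul ℂ H)).comp (comul (R := ℂ)))

lemma leftH_tmul {a : H} (r : Coalgebra.Repr ℂ a (H × H)) (m : M) (b : H) :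
    leftH α a (m ⊗ₜ[ℂ] b) = ∑ i ∈ r.index, α.act (r.left i) m ⊗ₜ[ℂ] (r.right i * b) := by
  simp [leftH, sum_repr_eq r]

/-- The product `(m ⊗ a)(m' ⊗ a') = m (a₍₁₎ ▷ m') ⊗ a₍₂₎ a'` on `M ⊗ H`. -/
noncomputable def preMul : M ⊗[ℂ] H →ₗ[ℂ] Module.End ℂ (M ⊗[ℂ] H) :=
  TensorProduct.lift (LinearMap.mk₂ ℂ
    (fun m a => ((LinearMap.mulLeft ℂ m).rTensor H).comp (leftH α a))
    (fun m m' a => by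
      rw [show LinearMap.mulLeft ℂ (m + m') = LinearMap.mulLeft ℂ m + LinearMap.mulLeft ℂ m' by
        ext; simp [add_mul], LinearMap.rTensor_add, LinearMap.add_comp])
    (fun c m a => by
      rw [show LinearMap.mulLeft ℂ (c • m) = c • LinearMap.mulLeft ℂ m by ext; simp,
        LinearMap.rTensor_smul, LinearMap.smul_comp])
    (fun m a a' => by rw [map_add, LinearMap.comp_add])
    (fun c m a => by rw [map_smul, LinearMap.comp_smul]))

lemma preMul_tmul (m : M) {a : H} (r : Coalgebra.Repr ℂ a (H × H)) (m' : M) (a' : H) :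
    preMul α (m ⊗ₜ[ℂ] a) (m' ⊗ₜ[ℂ] a') =
      ∑ i ∈ r.index, (m * α.act (r.left i) m') ⊗ₜ[ℂ] (r.right i * a') := by
  simp [preMul, leftH_tmul α r]

lemma act_mul_of_mem {b : H} (hb : b ∈ subL H) (m : M) : α.act b m = α.act b 1 * m := by
  have r := Coalgebra.Repr.arbitrary ℂ (1 : H)
  have h1 := α.act_mul b 1 m
  have h2 := α.act_mul 1 (α.act b 1) m
  rw [one_mul, (comul_of_mem_subL hb).2] at h1
  rw [map_one, Module.End.one_apply] at h2
  rw [h1, h2, sum_repr_eq r]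
  simp [Finset.sum_mul]

lemma preMul_mul (m : M) (a : H) {b : H} (hb : b ∈ subL H) (t : M ⊗[ℂ] H) :
    preMul α (m ⊗ₜ[ℂ] (b * a)) t = preMul α ((m * α.act b 1) ⊗ₜ[ℂ] a) t := by
  have r := Coalgebra.Repr.arbitrary ℂ a
  induction t with
  | zero => simp
  | add x y hx hy => simp only [map_add, hx, hy]
  | tmul m' a' =>
    rw [preMul_tmul α _ r]
    simp only [preMul, TensorProduct.lift.tmul, LinearMap.mk₂_apply, LinearMap.comp_apply, leftH,
      comul_mul_of_mem_subL' hb, sum_repr_eq r, Finset.mul_sum, map_sum,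
      Algebra.TensorProduct.tmul_mul_tmul, one_mul, TensorProduct.map_tmul,
      TensorProduct.homTensorHomMap_apply, LinearMap.sum_apply, LinearMap.rTensor_tmul,
      LinearMap.mulLeft_apply, AlgHom.toLinearMap_apply, LinearMap.mul_apply', map_mul,
      Module.End.mul_apply]
    refine Finset.sum_congr rfl fun i _ => ?_
    rw [act_mul_of_mem α hb, mul_assoc]

/-- Coassociativity for expressions `f(a₍₁₎) g(a₍₂₎) ⊗ h(a₍₃₎)`. -/
lemma sum_coassoc {N P : Type*} [Ring N] [Algebra ℂ N] [AddCommGroup P] [Module ℂ P]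
    (f g : H →ₗ[ℂ] N) (h : H →ₗ[ℂ] P) {a : H} (r : Coalgebra.Repr ℂ a (H × H))
    (s : ∀ b : H, Coalgebra.Repr ℂ b (H × H)) :
    ∑ i ∈ r.index, ∑ j ∈ (s (r.left i)).index,
      (f ((s (r.left i)).left j) * g ((s (r.left i)).right j)) ⊗ₜ[ℂ] h (r.right i) =
    ∑ i ∈ r.index, ∑ j ∈ (s (r.right i)).index,
      (f (r.left i) * g ((s (r.right i)).left j)) ⊗ₜ[ℂ] h ((s (r.right i)).right j) := by
  have key := congrArg (fun t => (LinearMap.mul' ℂ N).rTensor P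
    ((TensorProduct.assoc ℂ N N P).symm (TensorProduct.map f (TensorProduct.map g h) t)))
    (Coalgebra.sum_tmul_tmul_eq r (fun i => s (r.left i)) (fun i => s (r.right i)))
  simpa using key

lemma preMul_assoc (x y z : M ⊗[ℂ] H) :
    preMul α (preMul α x y) z = preMul α x (preMul α y z) := by
  let s : ∀ b : H, Coalgebra.Repr ℂ b (H × H) := fun b => Coalgebra.Repr.arbitrary ℂ b
  induction x with
  | zero => simp
  | add x x' hx hx' => simp only [map_add, LinearMap.add_apply, hx, hx']
  | tmul m a =>
  induction y with
  | zero => simp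
  | add y y' hy hy' => simp only [map_add, LinearMap.add_apply, hy, hy']
  | tmul m' a' =>
  induction z with
  | zero => simp
  | add z z' hz hz' => simp only [map_add, hz, hz']
  | tmul m'' a'' =>
    have h1 : ∀ (n : M) (b : H), preMul α (n ⊗ₜ[ℂ] (b * a')) (m'' ⊗ₜ[ℂ] a'') =
        ∑ j ∈ (s b).index, ∑ k ∈ (s a').index,
          (n * α.act ((s b).left j * (s a').left k) m'') ⊗ₜ[ℂ]
            ((s b).right j * (s a').right k * a'') := by
      intro n b
      simp only [preMul, TensorProduct.lift.tmul, LinearMap.mk₂_apply, LinearMap.comp_apply, leftH,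
        WeakHopfAlgebra.comul_mul, sum_repr_eq (s b), sum_repr_eq (s a'), Finset.sum_mul_sum,
        map_sum,
        Algebra.TensorProduct.tmul_mul_tmul, TensorProduct.map_tmul,
        TensorProduct.homTensorHomMap_apply, LinearMap.sum_apply, LinearMap.rTensor_tmul,
        LinearMap.mulLeft_apply, AlgHom.toLinearMap_apply, LinearMap.mul_apply']
    rw [preMul_tmul α m (s a), preMul_tmul α m' (s a'), map_sum, LinearMap.sum_apply, map_sum]
    simp only [h1, preMul_tmul α m (s a)]
    rw [Finset.sum_comm (s := (s a').index)]
    have h2 := fun k => congrArg (fun t => (LinearMap.mulLeft ℂ m).rTensor H t)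
      (sum_coassoc (α.act.toLinearMap.flip m')
        ((α.act.toLinearMap.flip m'').comp (LinearMap.mulRight ℂ ((s a').left k)))
        (LinearMap.mulRight ℂ ((s a').right k * a'')) (s a) s)
    simp only [map_sum, LinearMap.rTensor_tmul, LinearMap.comp_apply, LinearMap.flip_apply,
      LinearMap.mulLeft_apply, LinearMap.mulRight_apply, AlgHom.toLinearMap_apply] at h2
    simp only [α.act_mul_repr (s _), Finset.mul_sum, TensorProduct.sum_tmul]
    simp only [map_mul, Module.End.mul_apply] at h2
    simp only [map_mul, Module.End.mul_apply, mul_assoc]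
    symm
    rw [Finset.sum_comm, Finset.sum_congr rfl fun k _ => h2 k, Finset.sum_comm]
    exact Finset.sum_congr rfl fun i _ => Finset.sum_comm

lemma act_counitalL_one (a : H) : α.act (counitalL a) 1 = α.act a 1 := (α.act_one a).symm

lemma proj_preMul_rel (x : M ⊗[ℂ] H) (m : M) (a : H) {b : H} (hb : b ∈ subL H) :
    proj α (preMul α x ((m * α.act b 1) ⊗ₜ[ℂ] a)) = proj α (preMul α x (m ⊗ₜ[ℂ] (b * a))) := by
  let s : ∀ b : H, Coalgebra.Repr ℂ b (H × H) := fun b => Coalgebra.Repr.arbitrary ℂ b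
  induction x with
  | zero => simp
  | add x y hx hy => simp only [map_add, LinearMap.add_apply, hx, hy]
  | tmul n c =>
    rw [preMul_tmul α n (s c), preMul_tmul α n (s c)]
    have h2 := congrArg (fun t => (LinearMap.mulLeft ℂ n).rTensor H t)
      (sum_coassoc (α.act.toLinearMap.flip m)
        ((α.act.toLinearMap.flip 1).comp (LinearMap.mulRight ℂ b))
        (LinearMap.mulRight ℂ a) (s c) s)
    simp only [map_sum, LinearMap.rTensor_tmul, LinearMap.comp_apply, LinearMap.flip_apply,
      LinearMap.mulLeft_apply, LinearMap.mulRight_apply, AlgHom.toLinearMap_apply] at h2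
    have h3 : ∀ d : H, ∑ j ∈ (s d).index, counitalL ((s d).left j * b) * (s d).right j = d * b := by
      intro d
      have := counitalL_mul_comul (d * b)
      rw [comul_mul_of_mem_subL hb, sum_repr_eq (s d)] at this
      simpa [Finset.sum_mul] using this
    have h4 : ∑ i ∈ (s c).index, (n * α.act ((s c).left i) (m * α.act b 1)) ⊗ₜ[ℂ]
        ((s c).right i * a) = ∑ i ∈ (s c).index, ∑ j ∈ (s ((s c).right i)).index,
          (n * (α.act ((s c).left i) m * α.act ((s ((s c).right i)).left j * b) 1)) ⊗ₜ[ℂ]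
            ((s ((s c).right i)).right j * a) := by
      rw [← h2]
      simp only [α.act_mul_repr (s _), Finset.mul_sum, TensorProduct.sum_tmul, map_mul,
        Module.End.mul_apply]
    rw [h4]
    simp only [map_sum, proj_tmul]
    refine Finset.sum_congr rfl fun i _ => ?_
    have h5 : ∀ j, mk α (n * (α.act ((s c).left i) m * α.act ((s ((s c).right i)).left j * b) 1))
        ((s ((s c).right i)).right j * a) = mk α (n * α.act ((s c).left i) m)
          (counitalL ((s ((s c).right i)).left j * b) * (s ((s c).right i)).right j * a) := by
      intro j
      rw [← act_counitalL_one, ← mul_assoc, mk_mul_act α _ _ (counitalL_mem _), mul_assoc]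
    simp only [h5]
    rw [← mul_assoc, ← h3 ((s c).right i), Finset.sum_mul]
    simp only [mk, TensorProduct.tmul_sum, map_sum]

/-- The product of the crossed product, as a bilinear map. -/
noncomputable def mulMap : CrossedProduct α →ₗ[ℂ] CrossedProduct α →ₗ[ℂ] CrossedProduct α :=
  (crossedRel α).liftQ
    { toFun := fun x => (crossedRel α).liftQ ((proj α).comp (preMul α x)) (by
        rw [crossedRel, Submodule.span_le]
        rintro _ ⟨m, a, b, hb, rfl⟩
        simp only [SetLike.mem_coe, LinearMap.mem_ker, LinearMap.comp_apply, map_sub]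
        rw [proj_preMul_rel α x m a hb, sub_self])
      map_add' := fun x y => hom_ext α fun m a => by
        change proj α (preMul α (x + y) _) = proj α (preMul α x _) + proj α (preMul α y _)
        rw [map_add, LinearMap.add_apply, map_add]
      map_smul' := fun c x => hom_ext α fun m a => by
        change proj α (preMul α (c • x) _) = c • proj α (preMul α x _)
        rw [map_smul, LinearMap.smul_apply, map_smul] }
    (by
      refine Submodule.span_le.2 ?_
      rintro _ ⟨m, a, b, hb, rfl⟩
      simp only [SetLike.mem_coe, LinearMap.mem_ker]
      refine hom_ext α fun m' a' => ?_
      change proj α (preMul α (_ - _) _) = 0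
      rw [map_sub, LinearMap.sub_apply, preMul_mul α m a hb, sub_self, map_zero])

noncomputable instance : Mul (CrossedProduct α) where
  mul x y := mulMap α x y

lemma proj_mul (x y : M ⊗[ℂ] H) : proj α x * proj α y = proj α (preMul α x y) := rfl

noncomputable instance : One (CrossedProduct α) where
  one := mk α 1 1

lemma one_def : (1 : CrossedProduct α) = mk α 1 1 := rfl

/-- The product of the crossed product: `(m ⋊ a)(m' ⋊ a') = m (a₍₁₎ ▷ m') ⋊ a₍₂₎ a'`. -/
lemma mk_mul_mk (m : M) {a : H} (r : Coalgebra.Repr ℂ a (H × H)) (m' : M) (a' : H) :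
    mk α m a * mk α m' a' =
      ∑ i ∈ r.index, mk α (m * α.act (r.left i) m') (r.right i * a') := by
  rw [mk, mk, proj_mul, preMul_tmul α m r, map_sum]
  rfl

lemma mk_one_mul (m : M) (a : H) : mk α 1 1 * mk α m a = mk α m a := by
  have r := Coalgebra.Repr.arbitrary ℂ (1 : H)
  have h1 := congrArg (fun t => proj α (TensorProduct.map (α.act.toLinearMap.flip m)
    (LinearMap.mulRight ℂ a) t)) (counitalL_lTensor_comul_one (H := H))
  have h2 := α.act_mul_repr r m 1
  rw [map_one, Module.End.one_apply, mul_one] at h2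
  simp only [sum_repr_eq r, map_sum, LinearMap.lTensor_tmul, TensorProduct.map_tmul,
    LinearMap.mulRight_apply, proj_tmul, LinearMap.flip_apply, AlgHom.toLinearMap_apply] at h1
  rw [mk_mul_mk α 1 r]
  simp only [one_mul]
  rw [← h1]
  simp only [← mk_mul_act α _ _ (counitalL_mem _), act_counitalL_one]
  conv_rhs => rw [h2]
  simp only [mk, TensorProduct.sum_tmul, map_sum]

lemma mk_mul_one (m : M) (a : H) : mk α m a * mk α 1 1 = mk α m a := by
  have r := Coalgebra.Repr.arbitrary ℂ a
  have h1 := counitalL_mul_comul a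
  simp only [sum_repr_eq r, map_sum, LinearMap.rTensor_tmul, LinearMap.mul'_apply] at h1
  rw [mk_mul_mk α m r]
  simp only [mul_one, ← act_counitalL_one α (r.left _), mk_mul_act α _ _ (counitalL_mem _)]
  conv_rhs => rw [← h1]
  simp only [mk, TensorProduct.tmul_sum, map_sum]

noncomputable instance : Ring (CrossedProduct α) where
  __ := (inferInstance : AddCommGroup (CrossedProduct α))
  left_distrib x y z := map_add (mulMap α x) y z
  right_distrib x y z := LinearMap.map_add₂ (mulMap α) x y z
  zero_mul x := LinearMap.map_zero₂ (mulMap α) x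
  mul_zero x := map_zero (mulMap α x)
  mul_assoc x y z := by
    obtain ⟨x, rfl⟩ := proj_surjective α x
    obtain ⟨y, rfl⟩ := proj_surjective α y
    obtain ⟨z, rfl⟩ := proj_surjective α z
    simp only [proj_mul, preMul_assoc]
  one_mul x := induction_on α (p := fun x => 1 * x = x) x (map_zero (mulMap α 1))
    (fun x y hx hy => (map_add (mulMap α 1) x y).trans (congrArg₂ _ hx hy)) (mk_one_mul α)
  mul_one x := induction_on α (p := fun x => x * 1 = x) x (LinearMap.map_zero₂ (mulMap α) 1)
    (fun x y hx hy => (LinearMap.map_add₂ (mulMap α) x y 1).trans (congrArg₂ _ hx hy))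
    (mk_mul_one α)

noncomputable instance : Algebra ℂ (CrossedProduct α) :=
  Algebra.ofModule (fun c x y => LinearMap.map_smul₂ (mulMap α) c x y)
    (fun c x y => map_smul (mulMap α x) c y)

end CrossedProduct

end CrossedProduct

section DualAction

variable {H : Type u} [Ring H] [Algebra ℂ H] [WeakHopfAlgebra H]

/-- The action `φ ⇀ a = a₍₁₎ ⟨φ | a₍₂₎⟩` of one algebra on another one, along a bilinear
pairing `⟨φ | a⟩` of the two. For the canonical pairing of `Â` and `A` this is the action of `Â` on
`A`; for the flipped pairing it is the action of `A` on `Â`. -/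
noncomputable def leftAct {K : Type*} [AddCommGroup K] [Module ℂ K] {L : Type*} [AddCommGroup L]
    [Module ℂ L] [CoalgebraStruct ℂ L] (p : K →ₗ[ℂ] L →ₗ[ℂ] ℂ) : K →ₗ[ℂ] L →ₗ[ℂ] L where
  toFun φ := (TensorProduct.rid ℂ L).toLinearMap.comp (((p φ).lTensor L).comp comul)
  map_add' φ ψ := by rw [map_add, LinearMap.lTensor_add, LinearMap.add_comp, LinearMap.comp_add]
  map_smul' c φ := by
    rw [map_smul, LinearMap.lTensor_smul, LinearMap.smul_comp, LinearMap.comp_smul,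
      RingHom.id_apply]

lemma leftAct_repr {K : Type*} [AddCommGroup K] [Module ℂ K] (p : K →ₗ[ℂ] H →ₗ[ℂ] ℂ) (φ : K)
    {a : H} (r : Coalgebra.Repr ℂ a (H × H)) :
    leftAct p φ a = ∑ i ∈ r.index, p φ (r.right i) • r.left i := by
  simp [leftAct, sum_repr_eq r]

lemma leftAct_one (a : H) : leftAct (Hat.pairing H) 1 a = a :=
  (congrArg (TensorProduct.rid ℂ H) (Coalgebra.lTensor_counit_comul (R := ℂ) a)).trans
    (by rw [TensorProduct.rid_tmul, one_smul])

lemma leftAct_mul (φ ψ : Hat H) (a : H) : leftAct (Hat.pairing H) (φ * ψ) a =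
    leftAct (Hat.pairing H) φ (leftAct (Hat.pairing H) ψ a) := by
  let s : ∀ b : H, Coalgebra.Repr ℂ b (H × H) := fun b => Coalgebra.Repr.arbitrary ℂ b
  have key := congrArg (fun t => TensorProduct.rid ℂ H ((LinearMap.mul' ℂ ℂ).lTensor H
    ((TensorProduct.map (Hat.pairing H φ) (Hat.pairing H ψ)).lTensor H t)))
    (Coalgebra.sum_tmul_tmul_eq (s a) (fun i => s ((s a).left i)) (fun i => s ((s a).right i)))
  simp only [map_sum, LinearMap.lTensor_tmul, TensorProduct.map_tmul, LinearMap.mul'_apply,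
    TensorProduct.rid_tmul] at key
  rw [leftAct_repr _ _ (s a), leftAct_repr _ ψ (s a), map_sum]
  simp only [map_smul]
  simp only [leftAct_repr _ φ (s _), Hat.pairing_mul_repr _ _ (s _), Finset.sum_smul,
    Finset.smul_sum, smul_smul]
  rw [← key]
  exact Finset.sum_congr rfl fun i _ => Finset.sum_congr rfl fun j _ => by rw [mul_comm]

lemma leftAct_mem_subL_mul (φ : Hat H) {b : H} (hb : b ∈ subL H) (a : H) :
    leftAct (Hat.pairing H) φ (b * a) = b * leftAct (Hat.pairing H) φ a := by
  have r := Coalgebra.Repr.arbitrary ℂ a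
  rw [leftAct_repr _ _ r]
  simp [leftAct, comul_mul_of_mem_subL' hb, sum_repr_eq r, Finset.mul_sum]

lemma leftAct_counitalL_one [Module.Finite ℂ H] (φ : Hat H) :
    leftAct (Hat.pairing H) (counitalL φ) 1 = leftAct (Hat.pairing H) φ 1 := by
  have r := Coalgebra.Repr.arbitrary ℂ (1 : H)
  have h := congrArg (fun t => TensorProduct.rid ℂ H ((Hat.pairing H φ).lTensor H t))
    (counitalL_lTensor_comul_one (H := H))
  simp only [sum_repr_eq r, map_sum, LinearMap.lTensor_tmul, TensorProduct.rid_tmul] at h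
  rw [leftAct_repr _ _ r, leftAct_repr _ _ r, ← h]
  simp only [Hat.pairing_counitalL]

variable {M : Type v} [Ring M] [Algebra ℂ M] (α : ModuleAlgebra H M)

/-- The map `m ⋊ a ↦ m ⋊ (φ ⇀ a)` of the crossed product. -/
noncomputable def dualActionMap : Hat H →ₗ[ℂ] Module.End ℂ (CrossedProduct α) where
  toFun φ := (crossedRel α).liftQ
    ((CrossedProduct.proj α).comp ((leftAct (Hat.pairing H) φ).lTensor M)) (by
      rw [crossedRel, Submodule.span_le]
      rintro _ ⟨m, a, b, hb, rfl⟩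
      simp only [SetLike.mem_coe, LinearMap.mem_ker, LinearMap.comp_apply, map_sub,
        LinearMap.lTensor_tmul, leftAct_mem_subL_mul φ hb, CrossedProduct.proj_tmul,
        CrossedProduct.mk_mul_act α _ _ hb, sub_self])
  map_add' φ ψ := CrossedProduct.hom_ext α fun m a => by
    change CrossedProduct.mk α m (leftAct _ (φ + ψ) a) =
      CrossedProduct.mk α m (leftAct _ φ a) + CrossedProduct.mk α m (leftAct _ ψ a)
    simp only [CrossedProduct.mk, map_add, LinearMap.add_apply, TensorProduct.tmul_add]
  map_smul' c φ := CrossedProduct.hom_ext α fun m a => by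
    change CrossedProduct.mk α m (leftAct _ (c • φ) a) = c • CrossedProduct.mk α m (leftAct _ φ a)
    simp only [CrossedProduct.mk, map_smul, LinearMap.smul_apply, TensorProduct.tmul_smul]

lemma dualActionMap_mk (φ : Hat H) (m : M) (a : H) :
    dualActionMap α φ (CrossedProduct.mk α m a) =
      CrossedProduct.mk α m (leftAct (Hat.pairing H) φ a) := rfl

variable [Module.Finite ℂ H]

lemma dualActionMap_mul (φ : Hat H) (x y : CrossedProduct α) :
    dualActionMap α φ (x * y) = LinearMap.mul' ℂ (CrossedProduct α) (TensorProduct.map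
      ((dualActionMap α).flip x) ((dualActionMap α).flip y) (comul (R := ℂ) φ)) := by
  let s : ∀ b : H, Coalgebra.Repr ℂ b (H × H) := fun b => Coalgebra.Repr.arbitrary ℂ b
  induction x using CrossedProduct.induction_on with
  | zero => simp
  | add x x' hx hx' =>
    rw [add_mul, map_add, hx, hx', map_add, TensorProduct.map_add_left, LinearMap.add_apply,
      map_add]
  | mk m a =>
  induction y using CrossedProduct.induction_on with
  | zero => simp
  | add y y' hy hy' =>
    rw [mul_add, map_add, hy, hy', map_add, TensorProduct.map_add_right, LinearMap.add_apply,
      map_add]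
  | mk m' a' =>
    have h1 : ∀ t : Hat H ⊗[ℂ] Hat H, LinearMap.mul' ℂ (CrossedProduct α) (TensorProduct.map
        ((dualActionMap α).flip (CrossedProduct.mk α m a))
        ((dualActionMap α).flip (CrossedProduct.mk α m' a')) t) =
        ∑ i ∈ (s a).index, ∑ j ∈ (s a').index,
          Hat.pairing₂ H t ((s a).right i ⊗ₜ (s a').right j) •
            (CrossedProduct.mk α m ((s a).left i) * CrossedProduct.mk α m' ((s a').left j)) := by
      intro t
      induction t with
      | zero => simp
      | add x y hx hy =>
        simp only [map_add, LinearMap.add_apply, hx, hy, add_smul, Finset.sum_add_distrib]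
      | tmul φ ψ =>
        have h : ∀ (φ : Hat H) (m : M) (a : H), dualActionMap α φ (CrossedProduct.mk α m a) =
            ∑ i ∈ (s a).index, Hat.pairing H φ ((s a).right i) •
              CrossedProduct.mk α m ((s a).left i) := by
          intro φ m a
          rw [dualActionMap_mk, leftAct_repr _ _ (s a)]
          simp only [CrossedProduct.mk, TensorProduct.tmul_sum, TensorProduct.tmul_smul, map_sum,
            map_smul]
        simp only [TensorProduct.map_tmul, LinearMap.flip_apply, LinearMap.mul'_apply, h,
          Finset.sum_mul_sum, smul_mul_smul_comm, Hat.pairing₂_tmul]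
    rw [h1, CrossedProduct.mk_mul_mk α m (s a), map_sum]
    simp only [Hat.pairing₂_comul, LinearMap.mul'_apply, CrossedProduct.mk_mul_mk α m (s _),
      dualActionMap_mk]
    have h2 : ∀ b : H, leftAct (Hat.pairing H) φ (b * a') = ∑ j ∈ (s b).index,
        ∑ k ∈ (s a').index, Hat.pairing H φ ((s b).right j * (s a').right k) •
          ((s b).left j * (s a').left k) := by
      intro b
      simp [leftAct, WeakHopfAlgebra.comul_mul, sum_repr_eq (s b), sum_repr_eq (s a'),
        Finset.sum_mul_sum]
    have key := fun k => congrArg (fun t => CrossedProduct.proj α (TensorProduct.map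
        ((LinearMap.mulLeft ℂ m).comp (α.act.toLinearMap.flip m'))
        ((TensorProduct.rid ℂ H).toLinearMap.comp (TensorProduct.map
          (LinearMap.mulRight ℂ ((s a').left k))
          ((Hat.pairing H φ).comp (LinearMap.mulRight ℂ ((s a').right k))))) t))
      (Coalgebra.sum_tmul_tmul_eq (s a) (fun i => s ((s a).left i)) (fun i => s ((s a).right i)))
    simp only [map_sum, TensorProduct.map_tmul, LinearMap.comp_apply, LinearMap.flip_apply,
      LinearMap.mulLeft_apply, LinearMap.mulRight_apply, AlgHom.toLinearMap_apply,
      LinearEquiv.coe_coe, TensorProduct.rid_tmul, TensorProduct.tmul_smul, map_smul,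
      CrossedProduct.proj_tmul] at key
    have h3 : ∀ (n : M) (b : H), CrossedProduct.mk α n (leftAct (Hat.pairing H) φ (b * a')) =
        ∑ j ∈ (s b).index,
        ∑ k ∈ (s a').index, Hat.pairing H φ ((s b).right j * (s a').right k) •
          CrossedProduct.mk α n ((s b).left j * (s a').left k) := by
      intro n b
      rw [h2]
      simp only [CrossedProduct.mk, TensorProduct.tmul_sum, TensorProduct.tmul_smul, map_sum,
        map_smul]
    simp only [h3, Finset.smul_sum]
    trans ∑ k ∈ (s a').index, ∑ i ∈ (s a).index, ∑ j ∈ (s ((s a).right i)).index,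
        Hat.pairing H φ ((s ((s a).right i)).right j * (s a').right k) •
          CrossedProduct.mk α (m * α.act ((s a).left i) m')
            ((s ((s a).right i)).left j * (s a').left k)
    · rw [Finset.sum_comm]
      exact Finset.sum_congr rfl fun i _ => Finset.sum_comm
    · rw [Finset.sum_congr rfl fun k _ => (key k).symm, Finset.sum_comm]

/-- The dual action of `Â` on the crossed product: `φ ▷ (m ⋊ a) = m ⋊ (φ ⇀ a)`. -/
noncomputable def dualAction : ModuleAlgebra (Hat H) (CrossedProduct α) where
  act := AlgHom.ofLinearMap (dualActionMap α)
    (CrossedProduct.hom_ext α fun m a => by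
      rw [dualActionMap_mk, leftAct_one, Module.End.one_apply])
    (fun φ ψ => CrossedProduct.hom_ext α fun m a => by
      simp only [Module.End.mul_apply, dualActionMap_mk, leftAct_mul])
  act_mul φ x y := dualActionMap_mul α φ x y
  act_one φ := by
    change dualActionMap α φ (CrossedProduct.mk α 1 1) =
      dualActionMap α (counitalL φ) (CrossedProduct.mk α 1 1)
    rw [dualActionMap_mk, dualActionMap_mk, leftAct_counitalL_one]

end DualAction

section Integrals

variable {L : Type u} [Ring L] [Algebra ℂ L] [WeakHopfAlgebra L]

/-- Left integrals: `a l = (ε(1₍₁₎ a) 1₍₂₎) l` for all `a`. -/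
def IsLeftIntegral (l : L) : Prop := ∀ a : L, a * l = counitalL a * l

/-- Right integrals: `r a = r (1₍₁₎ ε(a 1₍₂₎))` for all `a`. -/
def IsRightIntegral (r : L) : Prop := ∀ a : L, r * a = r * counitalR a

/-- The Haar integral: a two-sided integral `h` with `h₍₁₎ S(h₍₂₎) = 1 = S(h₍₁₎) h₍₂₎`. There is
at most one such element. -/
structure IsHaar (h : L) : Prop where
  left : IsLeftIntegral h
  right : IsRightIntegral h
  counitalL_eq_one : counitalL h = 1
  counitalR_eq_one : counitalR h = 1

lemma IsHaar.unique {h h' : L} (H : IsHaar h) (H' : IsHaar h') : h = h' := by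
  have h1 := H'.left h
  have h2 := H.right h'
  rw [H.counitalL_eq_one, one_mul] at h1
  rw [H'.counitalR_eq_one, mul_one] at h2
  exact h2.symm.trans h1

open Classical in
/-- The Haar integral of `L` (zero if there is none). -/
noncomputable def haar (L : Type u) [Ring L] [Algebra ℂ L] [WeakHopfAlgebra L] : L :=
  if H : ∃ h : L, IsHaar h then H.choose else 0

/-- The `R`-normalization `n_R(l) = 1₍₁₎ ε(1₍₂₎ l)` of a left integral. -/
noncomputable def nR (l : L) : L :=
  TensorProduct.rid ℂ L
    (((counit (R := ℂ)).comp (LinearMap.mulRight ℂ l)).lTensor L (comul (R := ℂ) (1 : L)))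

/-- Positive elements of a `*`-algebra: elements of the form `y* y`. In a finite-dimensional
`C*`-algebra these are the usual positive elements. -/
def IsPos {B : Type*} [Mul B] [Star B] (x : B) : Prop := ∃ y : B, x = star y * y

open Classical in
/-- The positive square root of a positive element (unique in a `C*`-algebra; zero if there is
none). -/
noncomputable def posSqrt {B : Type*} [Mul B] [Zero B] [Star B] (x : B) : B :=
  if H : ∃ s : B, IsPos s ∧ s * s = x then H.choose else 0

/-- The element `e_l = d^{1/2} h d^{1/2}` for a left integral `l = h d`, where `h` is the Haar
integral and `d = 1₍₁₎ ε(l 1₍₂₎)` is the Radon-Nikodym derivative `d_R(l)`. -/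
noncomputable def jones [Star L] (l : L) : L :=
  posSqrt (counitalR l) * haar L * posSqrt (counitalR l)

end Integrals

section PDual

variable {K : Type u} [Ring K] [Algebra ℂ K] [Star K] [WeakHopfAlgebra K]
  {L : Type u} [Ring L] [Algebra ℂ L] [Star L] [WeakHopfAlgebra L]

/-- Positive nondegenerate left integrals `l` of `L`: positivity and nondegeneracy are those of `l`
as a linear functional `φ ↦ ⟨φ | l⟩` on the algebra `K` in duality with `L`. -/
structure IsPosNondegLeftIntegral (p : K →ₗ[ℂ] L →ₗ[ℂ] ℂ) (l : L) : Prop where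
  isLeftIntegral : IsLeftIntegral l
  pos : ∀ φ : K, 0 ≤ p (star φ * φ) l
  nondeg_left : ∀ φ : K, (∀ ψ : K, p (φ * ψ) l = 0) → φ = 0
  nondeg_right : ∀ ψ : K, (∀ φ : K, p (φ * ψ) l = 0) → ψ = 0

/-- `lam` is the p-dual of `l`: the unique positive nondegenerate left integral with
`lam ⇀ e_l = 1`. -/
structure IsPDual (p : K →ₗ[ℂ] L →ₗ[ℂ] ℂ) (l : L) (lam : K) : Prop where
  isPosNondegLeftIntegral : IsPosNondegLeftIntegral p.flip lam
  act_jones : leftAct p lam (jones l) = 1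
  unique : ∀ μ : K, IsPosNondegLeftIntegral p.flip μ → leftAct p μ (jones l) = 1 → μ = lam

end PDual

section Index

variable {B : Type*} [Ring B] [Algebra ℂ B]

/-- A quasi-basis of a linear map `E` of an algebra `B` into a subalgebra of `B`:
`∑ uᵢ E(vᵢ m) = m = ∑ E(m uᵢ) vᵢ` for all `m`. -/
def IsQuasiBasis (E : B →ₗ[ℂ] B) {n : ℕ} (u v : Fin n → B) : Prop :=
  ∀ m : B, ∑ i, u i * E (v i * m) = m ∧ ∑ i, E (m * u i) * v i = m

/-- `E` is of index-finite type if it has a quasi-basis. -/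
def IndexFiniteType (E : B →ₗ[ℂ] B) : Prop := ∃ (n : ℕ) (u v : Fin n → B), IsQuasiBasis E u v

open Classical in
/-- The Watatani index `∑ uᵢ vᵢ` of `E`, where `u, v` is a quasi-basis (zero if there is none). -/
noncomputable def watataniIndex (E : B →ₗ[ℂ] B) : B :=
  if H : ∃ x : B, ∃ (n : ℕ) (u v : Fin n → B), IsQuasiBasis E u v ∧ x = ∑ i, u i * v i
    then H.choose else 0

/-- The index does not depend on the quasi-basis. -/
lemma IsQuasiBasis.watataniIndex_eq {E : B →ₗ[ℂ] B} {n : ℕ} {u v : Fin n → B}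
    (h : IsQuasiBasis E u v) : watataniIndex E = ∑ i, u i * v i := by
  have H : ∃ x : B, ∃ (n : ℕ) (u v : Fin n → B), IsQuasiBasis E u v ∧ x = ∑ i, u i * v i :=
    ⟨_, n, u, v, h, rfl⟩
  rw [watataniIndex, dif_pos H]
  obtain ⟨k, u', v', h', e⟩ := H.choose_spec
  rw [e]
  have h1 : ∀ i, ∑ j, u j * E (v j * u' i) * v' i = u' i * v' i := fun i => by
    rw [← Finset.sum_mul, (h (u' i)).1]
  have h2 : ∀ j, ∑ i, u j * E (v j * u' i) * v' i = u j * v j := fun j => by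
    simp only [mul_assoc]
    rw [← Finset.mul_sum, (h' (v j)).2]
  rw [← Finset.sum_congr rfl fun i _ => h1 i, ← Finset.sum_congr rfl fun j _ => h2 j]
  exact Finset.sum_comm

end Index

section IntegralIndex

variable {K : Type u} [AddCommGroup K] [Module ℂ K] {L : Type u} [Ring L] [Algebra ℂ L]
  [WeakHopfAlgebra L]

/-- The index `Ind x ∈ L` of a left integral `x ∈ K`: the Watatani index of `a ↦ x ⇀ a` on `L`. -/
noncomputable def integralIndex (p : K →ₗ[ℂ] L →ₗ[ℂ] ℂ) (x : K) : L :=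
  watataniIndex (leftAct p x)

end IntegralIndex

section Iterated

variable {H : Type u} [Ring H] [Algebra ℂ H] [WeakHopfAlgebra H] [Module.Finite ℂ H]
  {M : Type v} [Ring M] [Algebra ℂ M] (α : ModuleAlgebra H M)

/-- The iterated crossed product `(M ⋊ A) ⋊ Â` with respect to the dual action. -/
abbrev IteratedCrossedProduct : Type (max u v) := CrossedProduct (dualAction α)

/-- The element `(1 ⋊ a) ⋊ 1` of the iterated crossed product. -/
noncomputable def inclA (a : H) : IteratedCrossedProduct α :=
  CrossedProduct.mk (dualAction α) (CrossedProduct.mk α 1 a) 1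

/-- The element `(1 ⋊ 1) ⋊ φ` of the iterated crossed product. -/
noncomputable def inclHat (φ : Hat H) : IteratedCrossedProduct α :=
  CrossedProduct.mk (dualAction α) (CrossedProduct.mk α 1 1) φ

end Iterated

end WeakHopf

open WeakHopf

set_option linter.unusedSectionVars false

/-! Write Π^L, Π^R for `counitalL`, `counitalR`. The whole proof rests on one normal form: l = h s²,
with h the Haar integral and s positive and invertible in A_R (`exists_rootDatum`). The counit is a
faithful positive functional on A_R (`IsCStarLike.counit_nonneg`), because there it is the trace
weighted by the inverse of the positive element t = `traceElt`, and S² is conjugation by t on A_R.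
Positivity of l on the elements b ⇀ 1 of Â, with b in A_R, says that ε(b* d b) ≥ 0 for d = d_R(l).
So d is positive, nondegeneracy makes it invertible, and h = l d⁻¹ is Haar. The existence of h is
thus obtained from l and not presupposed.

Existence of the p-dual. Since e_l = S(s) l s⁻¹, nondegeneracy of l makes φ ↦ φ ⇀ e_l injective,
hence bijective by dimension, and λ is the preimage of 1. It is a left integral because φλ and
Π^L(φ)λ act on e_l in the same way. It is positive and faithful because every y has the form ψ(e₁)e₂
with e = e_l, and then λ(y*y) = ⟨S(ψ)*S(ψ) | l⟩ (`apply_star_mul_self_sliceL`).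

Index. An orthonormal basis u of A for ⟨x, y⟩ = λ(x*y) gives the quasi-basis (u, u*), so the index
is ∑ u u*, which is positive, central and invertible by general arguments. A second dual basis, read
off from the coproduct of q = h s S(s), evaluates the sum to q₂ S⁻¹(q₁) = S⁻¹(Π^L(l)) = n_R(l)
(`sum_mul_star_eq_nR`).

Biduality. The claim l ⇀ e_λ = 1 is the hard point, since e_λ contains a square root σ of d_R(λ),
which the equation λ ⇀ e_l = 1 determines only through its square. The map b ↦ b ⇀ 1 carries A_R
onto Â_R, reversing products and twisting the involution by t. With k the Haar integral of Â, the
map y ↦ k ⇀ (h y) intertwines multiplications by A_R with twists by S²; this forces d_R(λ) to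
correspond to z s⁻¹ t s⁻¹ t with z central in A_R and positive. Hence σ corresponds to z^{1/2} s⁻¹ t
by uniqueness of positive roots (`exists_dual_root`), and e_λ can be evaluated explicitly on c h b
for c in A_L and b in A_R.

Temperley–Lieb relations. In the iterated crossed product Â_R commutes with A, A_L commutes with Â,
a left integral k gives φ a k = (φ ⇀ a) k, and a right integral h gives h φ a = h φ(a ·). Together
with the normal forms of e_l and e_λ these yield the two cubic relations.

Everything is stated for a pairing satisfying `IsDualPairing`, so that each result can be read a
second time with A and Â exchanged. On Â no norm is given: the faithful functional l embeds it in a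
C*-algebra by the GNS construction, and `IsCStarLike` is all that is needed. -/

namespace WeakHopf

open Coalgebra (comul counit)
open WeakHopf.WeakHopfAlgebra (antipode)

/-! ### The convolution algebra. -/

section Convolution

variable {C : Type*} [AddCommGroup C] [Module ℂ C] [Coalgebra ℂ C]
  {B : Type*} [Ring B] [Algebra ℂ B]

/-- The convolution product of linear maps from a coalgebra to an algebra. -/
noncomputable def conv (f g : C →ₗ[ℂ] B) : C →ₗ[ℂ] B :=
  (LinearMap.mul' ℂ B) ∘ₗ (TensorProduct.map f g) ∘ₗ comul

lemma conv_apply (f g : C →ₗ[ℂ] B) (a : C) :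
    conv f g a = LinearMap.mul' ℂ B (TensorProduct.map f g (comul (R := ℂ) a)) := rfl

lemma conv_repr (f g : C →ₗ[ℂ] B) {a : C} {ι : Type*} (r : Coalgebra.Repr ℂ a ι) :
    conv f g a = ∑ i ∈ r.index, f (r.left i) * g (r.right i) := by
  simp [conv_apply, ← r.eq]

lemma conv_assoc (f g h : C →ₗ[ℂ] B) : conv (conv f g) h = conv f (conv g h) :=
  congrArg WithConv.ofConv (mul_assoc (WithConv.toConv f) (WithConv.toConv g) (WithConv.toConv h))

lemma mulLeft_comp_conv (b : B) (f g : C →ₗ[ℂ] B) :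
    LinearMap.mulLeft ℂ b ∘ₗ conv f g = conv (LinearMap.mulLeft ℂ b ∘ₗ f) g := by
  ext a
  simp [conv_repr _ _ (Coalgebra.Repr.arbitrary ℂ a), mul_assoc]

lemma mulRight_comp_conv (b : B) (f g : C →ₗ[ℂ] B) :
    LinearMap.mulRight ℂ b ∘ₗ conv f g = conv f (LinearMap.mulRight ℂ b ∘ₗ g) := by
  ext a
  simp [conv_repr _ _ (Coalgebra.Repr.arbitrary ℂ a), mul_assoc]

end Convolution

/-! ### Counital maps, the subspaces A_L and A_R, and the position of Δ(1). -/

section Basic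

variable {H : Type u} [Ring H] [Algebra ℂ H] [WeakHopfAlgebra H]

lemma counitalR_mem (x : H) : counitalR x ∈ subR H :=
  Submodule.subset_span ⟨(counit (R := ℂ)).comp (LinearMap.mulLeft ℂ x), rfl⟩

/-- Obtained by applying ε to the middle leg of the axiom for (1 ⊗ Δ(1))(Δ(1) ⊗ 1). -/
lemma counitalR_rTensor_comul_one :
    (counitalR).rTensor H (comul (R := ℂ) (1 : H)) = comul (R := ℂ) (1 : H) := by
  have h1 := congrArg (fun t => (TensorProduct.lid ℂ H).toLinearMap.lTensor H
    (((counit (R := ℂ)).rTensor H).lTensor H t)) (WeakHopfAlgebra.weak_comul_one' (H := H))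
  have h3 : (TensorProduct.lid ℂ H).toLinearMap.lTensor H
      (((counit (R := ℂ)).rTensor H).lTensor H (comul.lTensor H (comul (R := ℂ) (1 : H)))) =
      comul (R := ℂ) (1 : H) := by
    rw [← LinearMap.comp_apply, ← LinearMap.comp_apply, ← LinearMap.lTensor_comp,
      ← LinearMap.lTensor_comp, LinearMap.comp_assoc, show (TensorProduct.lid ℂ H).toLinearMap.comp
        (((counit (R := ℂ)).rTensor H).comp comul) = LinearMap.id by ext; simp,
      LinearMap.lTensor_id, LinearMap.id_apply]
  have r := Coalgebra.Repr.arbitrary ℂ (1 : H)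
  refine Eq.trans ?_ (h1.trans h3)
  simp only [sum_repr_eq r, TensorProduct.sum_tmul, TensorProduct.tmul_sum, map_sum,
    Finset.sum_mul, Finset.mul_sum, TensorProduct.assoc_tmul,
    Algebra.TensorProduct.tmul_mul_tmul, one_mul, mul_one, LinearMap.rTensor_tmul,
    TensorProduct.lid_tmul, LinearMap.lTensor_tmul, counitalR_eq r, LinearEquiv.coe_coe,
    TensorProduct.tmul_smul, TensorProduct.smul_tmul']
  rw [Finset.sum_comm]

/-- `Δ(1)` has a representation with left legs in `H_R` and right legs in `H_L`. -/
lemma exists_repr_one : ∃ r : Coalgebra.Repr ℂ (1 : H) (H × H),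
    (∀ i, r.left i ∈ subR H) ∧ ∀ i, r.right i ∈ subL H := by
  have r := Coalgebra.Repr.arbitrary ℂ (1 : H)
  refine ⟨⟨r.index, fun i => counitalR (r.left i), fun i => counitalL (r.right i), ?_⟩,
    fun i => counitalR_mem _, fun i => counitalL_mem _⟩
  have h := congrArg (counitalL.lTensor H) (counitalR_rTensor_comul_one (H := H))
  rw [counitalL_lTensor_comul_one] at h
  rw [← h, sum_repr_eq r]
  simp

lemma counitalL_of_mem {b : H} (hb : b ∈ subL H) : counitalL b = b := by
  induction hb using Submodule.span_induction with
  | mem b hb =>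
    obtain ⟨φ, rfl⟩ := hb
    conv_rhs => rw [← counitalL_lTensor_comul_one]
    simp [sum_repr_eq (Coalgebra.Repr.arbitrary ℂ (1 : H))]
  | zero => simp
  | add x y _ _ hx hy => rw [map_add, hx, hy]
  | smul c x _ hx => rw [map_smul, hx]

lemma counitalR_of_mem {b : H} (hb : b ∈ subR H) : counitalR b = b := by
  induction hb using Submodule.span_induction with
  | mem b hb =>
    obtain ⟨φ, rfl⟩ := hb
    conv_rhs => rw [← counitalR_rTensor_comul_one]
    simp [sum_repr_eq (Coalgebra.Repr.arbitrary ℂ (1 : H))]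
  | zero => simp
  | add x y _ _ hx hy => rw [map_add, hx, hy]
  | smul c x _ hx => rw [map_smul, hx]

lemma comul_of_mem_subR {b : H} (hb : b ∈ subR H) :
    comul (R := ℂ) b = (1 ⊗ₜ[ℂ] b) * comul (R := ℂ) (1 : H) ∧
      comul (R := ℂ) b = comul (R := ℂ) (1 : H) * (1 ⊗ₜ[ℂ] b) := by
  induction hb using Submodule.span_induction with
  | mem b hb =>
    obtain ⟨φ, rfl⟩ := hb
    have key : comul (R := ℂ) (TensorProduct.rid ℂ H (φ.lTensor H (comul (R := ℂ) (1 : H)))) =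
        TensorProduct.rid ℂ (H ⊗[ℂ] H) (φ.lTensor (H ⊗[ℂ] H)
          (comul.rTensor H (comul (R := ℂ) (1 : H)))) := by
      set t := comul (R := ℂ) (1 : H)
      induction t with
      | zero => simp
      | add x y hx hy => simp only [map_add, hx, hy]
      | tmul x y => simp
    have r := Coalgebra.Repr.arbitrary ℂ (1 : H)
    have e := Coalgebra.coassoc_apply (R := ℂ) (1 : H)
    rw [← LinearEquiv.eq_symm_apply] at e
    constructor
    · refine key.trans ?_
      rw [e, ← WeakHopfAlgebra.weak_comul_one']
      simp only [sum_repr_eq r, TensorProduct.sum_tmul, TensorProduct.tmul_sum, map_sum,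
        Finset.sum_mul, Finset.mul_sum, TensorProduct.assoc_tmul,
        Algebra.TensorProduct.tmul_mul_tmul, one_mul, mul_one, LinearMap.lTensor_tmul,
        TensorProduct.rid_tmul, TensorProduct.assoc_symm_tmul]
      simp [TensorProduct.smul_tmul']
    · refine key.trans ?_
      rw [e, ← WeakHopfAlgebra.weak_comul_one]
      simp only [sum_repr_eq r, TensorProduct.sum_tmul, TensorProduct.tmul_sum, map_sum,
        Finset.sum_mul, Finset.mul_sum, TensorProduct.assoc_tmul,
        Algebra.TensorProduct.tmul_mul_tmul, one_mul, mul_one, LinearMap.lTensor_tmul,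
        TensorProduct.rid_tmul, TensorProduct.assoc_symm_tmul]
      simp [TensorProduct.smul_tmul']
  | zero => simp
  | add x y _ _ hx hy =>
    exact ⟨by rw [map_add, hx.1, hy.1, TensorProduct.tmul_add, add_mul],
      by rw [map_add, hx.2, hy.2, TensorProduct.tmul_add, mul_add]⟩
  | smul c x _ hx =>
    exact ⟨by rw [map_smul, hx.1, TensorProduct.tmul_smul, smul_mul_assoc],
      by rw [map_smul, hx.2, TensorProduct.tmul_smul, mul_smul_comm]⟩

lemma comul_mul_of_mem_subR {b : H} (hb : b ∈ subR H) (a : H) :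
    comul (R := ℂ) (a * b) = comul (R := ℂ) a * (1 ⊗ₜ[ℂ] b) := by
  rw [WeakHopfAlgebra.comul_mul, (comul_of_mem_subR hb).2, ← mul_assoc,
    ← WeakHopfAlgebra.comul_mul, mul_one]

lemma comul_mul_of_mem_subR' {b : H} (hb : b ∈ subR H) (a : H) :
    comul (R := ℂ) (b * a) = (1 ⊗ₜ[ℂ] b) * comul (R := ℂ) a := by
  rw [WeakHopfAlgebra.comul_mul, (comul_of_mem_subR hb).1, mul_assoc,
    ← WeakHopfAlgebra.comul_mul, one_mul]

lemma conv_antipode_id : conv antipode LinearMap.id = counitalR (H := H) :=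
  LinearMap.ext WeakHopfAlgebra.antipode_mul

lemma conv_id_antipode : conv LinearMap.id antipode = counitalL (H := H) :=
  LinearMap.ext WeakHopfAlgebra.mul_antipode

lemma conv_antipode_counitalL : conv antipode counitalL = antipode (H := H) := by
  ext x
  rw [← conv_id_antipode, ← WeakHopfAlgebra.antipode_mul_antipode x, Hat.map_comp_lTensor]
  rfl

lemma conv_counitalR_antipode : conv counitalR antipode = antipode (H := H) := by
  rw [← conv_antipode_id, conv_assoc, conv_id_antipode, conv_antipode_counitalL]

lemma conv_counitalL_id : conv counitalL LinearMap.id = LinearMap.id (R := ℂ) (M := H) :=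
  LinearMap.ext fun x => counitalL_mul_comul x

lemma conv_id_counitalR : conv LinearMap.id counitalR = LinearMap.id (R := ℂ) (M := H) := by
  rw [← conv_antipode_id, ← conv_assoc, conv_id_antipode, conv_counitalL_id]

/-- `x₍₁₎ ⊗ (ε(1₍₁₎ x₍₂₎) 1₍₂₎) = 1₍₁₎ x ⊗ 1₍₂₎`. -/
lemma counitalL_lTensor_comul (x : H) :
    counitalL.lTensor H (comul (R := ℂ) x) = comul (R := ℂ) (1 : H) * (x ⊗ₜ[ℂ] 1) := by
  have r := Coalgebra.Repr.arbitrary ℂ (1 : H)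
  have s := Coalgebra.Repr.arbitrary ℂ x
  -- The axiom for Δ(1) is multiplied on the right by Δ(x) ⊗ 1, and ε is applied to the middle leg.
  have h := congrArg (fun t => (TensorProduct.lid ℂ H).toLinearMap.lTensor H
    (((counit (R := ℂ)).rTensor H).lTensor H (t * TensorProduct.assoc ℂ H H H
      (comul (R := ℂ) x ⊗ₜ[ℂ] (1 : H))))) (WeakHopfAlgebra.weak_comul_one' (H := H))
  have hl : (1 : H) ⊗ₜ[ℂ] comul (R := ℂ) (1 : H) *
      (TensorProduct.assoc ℂ H H H (comul (R := ℂ) (1 : H) ⊗ₜ[ℂ] (1 : H))) *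
      TensorProduct.assoc ℂ H H H (comul (R := ℂ) x ⊗ₜ[ℂ] (1 : H)) =
      (1 : H) ⊗ₜ[ℂ] comul (R := ℂ) (1 : H) *
      TensorProduct.assoc ℂ H H H (comul (R := ℂ) x ⊗ₜ[ℂ] (1 : H)) := by
    have e : ∀ y : H ⊗[ℂ] H ⊗[ℂ] H, TensorProduct.assoc ℂ H H H y =
      Algebra.TensorProduct.assoc ℂ ℂ ℂ H H H y := fun y => rfl
    rw [mul_assoc]
    simp only [e]
    rw [← map_mul, Algebra.TensorProduct.tmul_mul_tmul, ← WeakHopfAlgebra.comul_mul, one_mul,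
      mul_one]
  simp only [hl] at h
  have e2 : comul.lTensor H (comul (R := ℂ) (1 : H)) =
    TensorProduct.assoc ℂ H H H (comul.rTensor H (comul (R := ℂ) (1 : H))) :=
    (Coalgebra.coassoc_apply (R := ℂ) (1 : H)).symm
  have e3 : TensorProduct.assoc ℂ H H H (comul.rTensor H (comul (R := ℂ) (1 : H))) *
      TensorProduct.assoc ℂ H H H (comul (R := ℂ) x ⊗ₜ[ℂ] (1 : H)) =
      TensorProduct.assoc ℂ H H H (comul.rTensor H (comul (R := ℂ) (1 : H) * (x ⊗ₜ[ℂ] 1))) := by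
    have e : ∀ y : H ⊗[ℂ] H ⊗[ℂ] H, TensorProduct.assoc ℂ H H H y =
      Algebra.TensorProduct.assoc ℂ ℂ ℂ H H H y := fun y => rfl
    simp only [e]
    rw [← map_mul]
    congr 1
    simp [sum_repr_eq r, Finset.sum_mul, WeakHopfAlgebra.comul_mul]
  rw [e2, e3] at h
  have e4 : ∀ y : H ⊗[ℂ] H, (TensorProduct.lid ℂ H).toLinearMap.lTensor H
      (((counit (R := ℂ)).rTensor H).lTensor H (TensorProduct.assoc ℂ H H H
        (comul.rTensor H y))) = y := by
    intro y
    induction y with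
    | zero => simp
    | add x y hx hy => simp only [map_add, hx, hy]
    | tmul x y =>
      have s := Coalgebra.Repr.arbitrary ℂ x
      have h5 := congrArg (fun t => (TensorProduct.rid ℂ H t) ⊗ₜ[ℂ] y)
        (Coalgebra.lTensor_counit_comul (R := ℂ) x)
      simp only [LinearMap.rTensor_tmul, sum_repr_eq s, TensorProduct.sum_tmul, map_sum,
        TensorProduct.assoc_tmul, LinearMap.lTensor_tmul, LinearEquiv.coe_coe,
        TensorProduct.lid_tmul, TensorProduct.tmul_smul, TensorProduct.smul_tmul',
        TensorProduct.rid_tmul, one_smul] at h5 ⊢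
      simpa using h5
  rw [e4] at h
  rw [← h]
  simp only [sum_repr_eq r, sum_repr_eq s, TensorProduct.sum_tmul, TensorProduct.tmul_sum, map_sum,
    Finset.sum_mul, Finset.mul_sum, TensorProduct.assoc_tmul,
    Algebra.TensorProduct.tmul_mul_tmul, one_mul, mul_one, LinearMap.rTensor_tmul,
    TensorProduct.lid_tmul, LinearMap.lTensor_tmul, counitalL_eq r, LinearEquiv.coe_coe]
end Basic

/-! ### Commutation of A_L with A_R, and antimultiplicativity of the antipode. -/

section Basic

variable {H : Type u} [Ring H] [Algebra ℂ H] [WeakHopfAlgebra H]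

/-- `(1₍₁₎ ε(x₍₁₎ 1₍₂₎)) ⊗ x₍₂₎ = 1₍₁₎ ⊗ x 1₍₂₎`. -/
lemma counitalR_rTensor_comul (x : H) :
    counitalR.rTensor H (comul (R := ℂ) x) = (1 ⊗ₜ[ℂ] x) * comul (R := ℂ) (1 : H) := by
  have r := Coalgebra.Repr.arbitrary ℂ (1 : H)
  have s := Coalgebra.Repr.arbitrary ℂ x
  have h := congrArg (fun t => (TensorProduct.lid ℂ H).toLinearMap.lTensor H
    (((counit (R := ℂ)).rTensor H).lTensor H (((1 : H) ⊗ₜ[ℂ] comul (R := ℂ) x) * t)))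
    (WeakHopfAlgebra.weak_comul_one' (H := H))
  simp only [← mul_assoc, Algebra.TensorProduct.tmul_mul_tmul, ← WeakHopfAlgebra.comul_mul,
    mul_one] at h
  have h2 : ((1 : H) ⊗ₜ[ℂ] comul (R := ℂ) x) * comul.lTensor H (comul (R := ℂ) (1 : H)) =
      comul.lTensor H ((1 ⊗ₜ[ℂ] x) * comul (R := ℂ) (1 : H)) := by
    simp [sum_repr_eq r, Finset.mul_sum, WeakHopfAlgebra.comul_mul]
  have h3 : ∀ y : H ⊗[ℂ] H, (TensorProduct.lid ℂ H).toLinearMap.lTensor H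
      (((counit (R := ℂ)).rTensor H).lTensor H (comul.lTensor H y)) = y := by
    intro y
    rw [← LinearMap.comp_apply, ← LinearMap.comp_apply, ← LinearMap.lTensor_comp,
      ← LinearMap.lTensor_comp, LinearMap.comp_assoc, show (TensorProduct.lid ℂ H).toLinearMap.comp
        (((counit (R := ℂ)).rTensor H).comp comul) = LinearMap.id by ext; simp,
      LinearMap.lTensor_id, LinearMap.id_apply]
  rw [h2, h3] at h
  rw [← h]
  simp only [sum_repr_eq r, sum_repr_eq s, TensorProduct.sum_tmul, TensorProduct.tmul_sum, map_sum,
    Finset.sum_mul, Finset.mul_sum, TensorProduct.assoc_tmul,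
    Algebra.TensorProduct.tmul_mul_tmul, one_mul, mul_one, LinearMap.rTensor_tmul,
    TensorProduct.lid_tmul, LinearMap.lTensor_tmul, counitalR_eq r, LinearEquiv.coe_coe,
    TensorProduct.tmul_smul, TensorProduct.smul_tmul']
  rw [Finset.sum_comm]

/-- The two expressions for 1₍₁₎ ⊗ 1₍₂₎ ⊗ 1₍₃₎ differ only in the order of the product in the middle
leg, of a factor from A_L and one from A_R. Functionals on the outer legs make both factors
arbitrary. -/
lemma commute_subL_subR {b c : H} (hb : b ∈ subR H) (hc : c ∈ subL H) : Commute b c := by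
  have r := Coalgebra.Repr.arbitrary ℂ (1 : H)
  have h := (WeakHopfAlgebra.weak_comul_one (H := H)).trans
    (WeakHopfAlgebra.weak_comul_one' (H := H)).symm
  have key : ∀ φ ψ : Module.Dual ℂ H, Commute
      (TensorProduct.rid ℂ H (φ.lTensor H (comul (R := ℂ) (1 : H))))
      (TensorProduct.lid ℂ H (ψ.rTensor H (comul (R := ℂ) (1 : H)))) := by
    intro φ ψ
    have h' := congrArg (fun t => TensorProduct.lid ℂ H (ψ.rTensor H
      ((TensorProduct.rid ℂ H).toLinearMap.lTensor H ((φ.lTensor H).lTensor H t)))) h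
    simp only [sum_repr_eq r, TensorProduct.sum_tmul, TensorProduct.tmul_sum, map_sum,
      Finset.sum_mul, Finset.mul_sum, TensorProduct.assoc_tmul,
      Algebra.TensorProduct.tmul_mul_tmul, one_mul, mul_one, LinearMap.rTensor_tmul,
      TensorProduct.lid_tmul, LinearMap.lTensor_tmul, LinearEquiv.coe_coe,
      TensorProduct.rid_tmul] at h' ⊢
    simp only [Commute, SemiconjBy, Finset.sum_mul, Finset.mul_sum, smul_mul_smul_comm]
    simp only [smul_smul] at h'
    rw [Finset.sum_comm] at h'
    rw [Finset.sum_comm]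
    refine Eq.trans ?_ (h'.symm.trans ?_)
    · rw [Finset.sum_comm]
      refine Finset.sum_congr rfl fun i _ => Finset.sum_congr rfl fun j _ => ?_
      rw [mul_comm]
    · exact Finset.sum_comm
  induction hb using Submodule.span_induction with
  | zero => exact Commute.zero_left _
  | add x y _ _ hx hy => exact hx.add_left hy
  | smul a x _ hx => exact hx.smul_left a
  | mem b hb =>
    obtain ⟨φ, rfl⟩ := hb
    induction hc using Submodule.span_induction with
    | zero => exact Commute.zero_right _
    | add x y _ _ hx hy => exact hx.add_right hy
    | smul a x _ hx => exact hx.smul_right a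
    | mem c hc =>
      obtain ⟨ψ, rfl⟩ := hc
      exact key φ ψ

lemma counit_mul_counitalL (x y : H) :
    counit (R := ℂ) (x * counitalL y) = counit (R := ℂ) (x * y) := by
  have r := Coalgebra.Repr.arbitrary ℂ (1 : H)
  have h := WeakHopfAlgebra.weak_counit' x 1 y
  rw [sum_repr_eq r] at h
  rw [counitalL_eq r]
  simpa [Finset.mul_sum] using h

lemma counit_counitalR_mul (x y : H) :
    counit (R := ℂ) (counitalR x * y) = counit (R := ℂ) (x * y) := by
  have r := Coalgebra.Repr.arbitrary ℂ (1 : H)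
  have h := WeakHopfAlgebra.weak_counit' x 1 y
  rw [sum_repr_eq r] at h
  rw [counitalR_eq r]
  simpa [Finset.sum_mul, mul_comm] using h

lemma counit_counitalL (x : H) : counit (R := ℂ) (counitalL x) = counit (R := ℂ) x := by
  simpa using counit_mul_counitalL 1 x

lemma counit_counitalR (x : H) : counit (R := ℂ) (counitalR x) = counit (R := ℂ) x := by
  simpa using counit_counitalR_mul x 1

lemma counitalL_mul_counitalL (x y : H) : counitalL (x * counitalL y) = counitalL (x * y) := by
  have r := Coalgebra.Repr.arbitrary ℂ (1 : H)
  simp only [counitalL_eq r (_ * _), ← mul_assoc, counit_mul_counitalL]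

lemma counitalR_counitalR_mul (x y : H) : counitalR (counitalR x * y) = counitalR (x * y) := by
  have r := Coalgebra.Repr.arbitrary ℂ (1 : H)
  simp only [counitalR_eq r (_ * _), mul_assoc, counit_counitalR_mul]

lemma conv_mul_of_mem_subL {B : Type*} [Ring B] [Algebra ℂ B] (f g : H →ₗ[ℂ] B) {b : H}
    (hb : b ∈ subL H) (x : H) : conv f g (b * x) = conv (f ∘ₗ LinearMap.mulLeft ℂ b) g x := by
  have r := Coalgebra.Repr.arbitrary ℂ x
  rw [conv_apply, comul_mul_of_mem_subL' hb, conv_repr _ _ r]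
  simp [sum_repr_eq r, Finset.mul_sum]

lemma conv_mul_of_mem_subL' {B : Type*} [Ring B] [Algebra ℂ B] (f g : H →ₗ[ℂ] B) {b : H}
    (hb : b ∈ subL H) (x : H) : conv f g (x * b) = conv (f ∘ₗ LinearMap.mulRight ℂ b) g x := by
  have r := Coalgebra.Repr.arbitrary ℂ x
  rw [conv_apply, comul_mul_of_mem_subL hb, conv_repr _ _ r]
  simp [sum_repr_eq r, Finset.sum_mul]

lemma conv_mul_of_mem_subR {B : Type*} [Ring B] [Algebra ℂ B] (f g : H →ₗ[ℂ] B) {b : H}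
    (hb : b ∈ subR H) (x : H) : conv f g (b * x) = conv f (g ∘ₗ LinearMap.mulLeft ℂ b) x := by
  have r := Coalgebra.Repr.arbitrary ℂ x
  rw [conv_apply, comul_mul_of_mem_subR' hb, conv_repr _ _ r]
  simp [sum_repr_eq r, Finset.mul_sum]

lemma conv_mul_of_mem_subR' {B : Type*} [Ring B] [Algebra ℂ B] (f g : H →ₗ[ℂ] B) {b : H}
    (hb : b ∈ subR H) (x : H) : conv f g (x * b) = conv f (g ∘ₗ LinearMap.mulRight ℂ b) x := by
  have r := Coalgebra.Repr.arbitrary ℂ x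
  rw [conv_apply, comul_mul_of_mem_subR hb, conv_repr _ _ r]
  simp [sum_repr_eq r, Finset.sum_mul]

lemma counitalL_mul_of_mem {b : H} (hb : b ∈ subL H) (x : H) :
    counitalL (b * x) = b * counitalL x := by
  rw [← conv_id_antipode, conv_mul_of_mem_subL _ _ hb, ← LinearMap.mulLeft_apply ℂ b (conv _ _ x),
    ← LinearMap.comp_apply, mulLeft_comp_conv]
  rfl

lemma counitalR_mul_of_mem {b : H} (hb : b ∈ subR H) (x : H) :
    counitalR (x * b) = counitalR x * b := by
  rw [← conv_antipode_id, conv_mul_of_mem_subR' _ _ hb,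
    ← LinearMap.mulRight_apply (R := ℂ) b (conv _ _ x), ← LinearMap.comp_apply, mulRight_comp_conv]
  rfl

lemma counitalL_one : counitalL (1 : H) = 1 := by
  simp [counitalL]

lemma counitalR_one : counitalR (1 : H) = 1 := by
  simp [counitalR]

lemma one_mem_subR : (1 : H) ∈ subR H := counitalR_one (H := H) ▸ counitalR_mem 1

lemma mul_mem_subL {b c : H} (hb : b ∈ subL H) (hc : c ∈ subL H) : b * c ∈ subL H := by
  rw [← counitalL_of_mem hc, ← counitalL_mul_of_mem hb]
  exact counitalL_mem _

lemma mul_mem_subR {b c : H} (hb : b ∈ subR H) (hc : c ∈ subR H) : b * c ∈ subR H := by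
  rw [← counitalR_of_mem hb, ← counitalR_mul_of_mem hc]
  exact counitalR_mem _

/-- From S(b) = S(b₁) Π^L(b₂) and Δ(b) = 1₍₁₎ ⊗ 1₍₂₎ b: the right legs of Δ(1) lie in A_L and come
out of Π^L, and S(1₍₁₎) 1₍₂₎ = 1. -/
lemma counitalL_of_mem_subR {b : H} (hb : b ∈ subR H) : counitalL b = antipode b := by
  obtain ⟨r, hr, hr'⟩ := exists_repr_one (H := H)
  have h : antipode b = conv antipode counitalL b := by rw [conv_antipode_counitalL]
  rw [h, conv_apply, (comul_of_mem_subR hb).2, sum_repr_eq r]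
  have h2 : ∀ i, counitalL (r.right i * b) = r.right i * counitalL b :=
    fun i => counitalL_mul_of_mem (hr' i) b
  simp only [Finset.sum_mul, Algebra.TensorProduct.tmul_mul_tmul, map_sum, TensorProduct.map_tmul,
    LinearMap.mul'_apply, mul_one, h2]
  simp only [← mul_assoc, ← Finset.sum_mul]
  have h3 : ∑ i ∈ r.index, antipode (r.left i) * r.right i = 1 := by
    exact (conv_repr antipode LinearMap.id r).symm.trans (by rw [conv_antipode_id, counitalR_one])
  rw [h3, one_mul]

lemma counitalR_of_mem_subL {c : H} (hc : c ∈ subL H) : counitalR c = antipode c := by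
  obtain ⟨r, hr, hr'⟩ := exists_repr_one (H := H)
  have h : antipode c = conv counitalR antipode c := by rw [conv_counitalR_antipode]
  rw [h, conv_apply, (comul_of_mem_subL hc).1, sum_repr_eq r]
  have h2 : ∀ i, counitalR (c * r.left i) = counitalR c * r.left i :=
    fun i => counitalR_mul_of_mem (hr i) c
  simp only [Finset.mul_sum, Algebra.TensorProduct.tmul_mul_tmul, map_sum, TensorProduct.map_tmul,
    LinearMap.mul'_apply, one_mul, h2]
  simp only [mul_assoc, ← Finset.mul_sum]
  have h3 : ∑ i ∈ r.index, r.left i * antipode (r.right i) = 1 := by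
    exact (conv_repr LinearMap.id antipode r).symm.trans (by rw [conv_id_antipode, counitalL_one])
  rw [h3, mul_one]

lemma antipode_mem_subL {b : H} (hb : b ∈ subR H) : antipode b ∈ subL H :=
  counitalL_of_mem_subR hb ▸ counitalL_mem b

lemma antipode_mem_subR {c : H} (hc : c ∈ subL H) : antipode c ∈ subR H :=
  counitalR_of_mem_subL hc ▸ counitalR_mem c

lemma antipode_one : antipode (1 : H) = 1 := by
  rw [← counitalL_of_mem_subR one_mem_subR, counitalL_one]

/-- Since Δ(bx) = x₁ ⊗ b x₂, one has Π^R(b x) = S(x₁) b x₂; then x₂ S(x₃) = Π^L(x₂) commutes with b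
and is absorbed by S(x₁). -/
lemma conv_counitalR_mulLeft_antipode {b : H} (hb : b ∈ subR H) :
    conv (counitalR ∘ₗ LinearMap.mulLeft ℂ b) antipode =
      LinearMap.mulRight ℂ b ∘ₗ antipode := by
  have h1 : counitalR ∘ₗ LinearMap.mulLeft ℂ b = conv antipode (LinearMap.mulLeft ℂ b) := by
    ext x
    rw [LinearMap.comp_apply, LinearMap.mulLeft_apply, ← conv_antipode_id,
      conv_mul_of_mem_subR _ _ hb]
    rfl
  have h2 : conv (LinearMap.mulLeft ℂ b) antipode = LinearMap.mulRight ℂ b ∘ₗ counitalL := by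
    rw [show LinearMap.mulLeft ℂ b = LinearMap.mulLeft ℂ b ∘ₗ LinearMap.id from rfl,
      ← mulLeft_comp_conv, conv_id_antipode]
    ext x
    exact commute_subL_subR hb (counitalL_mem x)
  rw [h1, conv_assoc, h2, ← mulRight_comp_conv, conv_antipode_counitalL]

/-- The antipode is antimultiplicative. -/
theorem antipode_mul_rev (x y : H) : antipode (x * y) = antipode y * antipode x := by
  let m : H ⊗[ℂ] H →ₗ[ℂ] H := LinearMap.mul' ℂ H
  let f : H ⊗[ℂ] H →ₗ[ℂ] H := antipode ∘ₗ m
  let g : H ⊗[ℂ] H →ₗ[ℂ] H :=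
    m ∘ₗ TensorProduct.map antipode antipode ∘ₗ (TensorProduct.comm ℂ H H).toLinearMap
  have hcomul : ∀ x y : H, ∀ (F G : H ⊗[ℂ] H →ₗ[ℂ] H) (r : Coalgebra.Repr ℂ x (H × H))
      (s : Coalgebra.Repr ℂ y (H × H)), conv F G (x ⊗ₜ[ℂ] y) =
        ∑ i ∈ r.index, ∑ j ∈ s.index, F (r.left i ⊗ₜ s.left j) * G (r.right i ⊗ₜ s.right j) := by
    intro x y F G r s
    rw [conv_apply, TensorProduct.comul_tmul, sum_repr_eq r, sum_repr_eq s]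
    simp [TensorProduct.sum_tmul, TensorProduct.tmul_sum]
    rw [Finset.sum_comm]
  have hmul : ∀ x y : H, ∀ (F G : H →ₗ[ℂ] H), conv (F ∘ₗ m) (G ∘ₗ m) (x ⊗ₜ[ℂ] y) =
      conv F G (x * y) := by
    intro x y F G
    have r := Coalgebra.Repr.arbitrary ℂ x
    have s := Coalgebra.Repr.arbitrary ℂ y
    rw [hcomul x y _ _ r s, conv_apply, WeakHopfAlgebra.comul_mul, sum_repr_eq r, sum_repr_eq s]
    simp [Finset.sum_mul_sum, m]
  have h1 : conv g m = counitalR ∘ₗ m := by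
    refine TensorProduct.ext' fun x y => ?_
    have r := Coalgebra.Repr.arbitrary ℂ x
    have s := Coalgebra.Repr.arbitrary ℂ y
    rw [hcomul x y _ _ r s]
    simp only [g, m, LinearMap.comp_apply, LinearEquiv.coe_coe, TensorProduct.comm_tmul,
      TensorProduct.map_tmul, LinearMap.mul'_apply]
    rw [← counitalR_counitalR_mul, ← conv_antipode_id, conv_mul_of_mem_subR, conv_repr _ _ s,
      conv_repr _ _ r, Finset.sum_comm]
    · simp [Finset.sum_mul, Finset.mul_sum, mul_assoc]
    · rw [conv_antipode_id]; exact counitalR_mem _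
  have h2 : conv m g = counitalL ∘ₗ m := by
    refine TensorProduct.ext' fun x y => ?_
    have r := Coalgebra.Repr.arbitrary ℂ x
    have s := Coalgebra.Repr.arbitrary ℂ y
    rw [hcomul x y _ _ r s]
    simp only [g, m, LinearMap.comp_apply, LinearEquiv.coe_coe, TensorProduct.comm_tmul,
      TensorProduct.map_tmul, LinearMap.mul'_apply]
    rw [← counitalL_mul_counitalL, ← conv_id_antipode, conv_mul_of_mem_subL', conv_repr _ _ r,
      conv_repr _ _ s]
    · simp [Finset.sum_mul, Finset.mul_sum, mul_assoc]
    · rw [conv_id_antipode]; exact counitalL_mem _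
  have h3 : conv f m = counitalR ∘ₗ m := by
    refine TensorProduct.ext' fun x y => ?_
    exact (hmul x y antipode LinearMap.id).trans (by rw [conv_antipode_id]; rfl)
  have h4 : conv m f = counitalL ∘ₗ m := by
    refine TensorProduct.ext' fun x y => ?_
    exact (hmul x y LinearMap.id antipode).trans (by rw [conv_id_antipode]; rfl)
  have h5 : conv (counitalR ∘ₗ m) f = f := by
    refine TensorProduct.ext' fun x y => ?_
    exact (hmul x y counitalR antipode).trans (by rw [conv_counitalR_antipode]; rfl)
  have h6 : conv (counitalR ∘ₗ m) g = g := by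
    refine TensorProduct.ext' fun x y => ?_
    have r := Coalgebra.Repr.arbitrary ℂ x
    have s := Coalgebra.Repr.arbitrary ℂ y
    rw [hcomul x y _ _ r s]
    simp only [g, m, LinearMap.comp_apply, LinearEquiv.coe_coe, TensorProduct.comm_tmul,
      TensorProduct.map_tmul, LinearMap.mul'_apply]
    have h7 : ∀ i, ∑ j ∈ s.index, counitalR (r.left i * s.left j) * antipode (s.right j) =
        antipode y * counitalR (r.left i) := by
      intro i
      have := LinearMap.congr_fun
        (conv_counitalR_mulLeft_antipode (counitalR_mem (r.left i))) y
      rw [conv_repr _ _ s] at this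
      simpa [counitalR_counitalR_mul] using this
    simp only [← mul_assoc, ← Finset.sum_mul, h7]
    simp only [mul_assoc, ← Finset.mul_sum]
    rw [← conv_repr _ _ r, conv_counitalR_antipode]
  -- Both S(xy) and S(y)S(x) are convolution inverses of the product m on H ⊗ H, relative to the
  -- one-sided units Π^R ∘ m and Π^L ∘ m; the usual uniqueness argument reads f = (g m) f = g (m f)
  -- = g (m g) = (g m) g = g.
  have h : f = g := by
    rw [← h5, ← h1, conv_assoc, h4, ← h2, ← conv_assoc, h1, h6]
  exact LinearMap.congr_fun h (x ⊗ₜ y)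

end Basic

/-! ### Modular properties of the counit, and the coproduct of a left integral. -/

section Basic

variable {H : Type u} [Ring H] [Algebra ℂ H] [WeakHopfAlgebra H]

lemma slice_mem_subL (φ : H →ₗ[ℂ] ℂ) :
    TensorProduct.lid ℂ H (φ.rTensor H (comul (R := ℂ) (1 : H))) ∈ subL H :=
  Submodule.subset_span ⟨φ, rfl⟩

lemma slice_mem_subR (φ : H →ₗ[ℂ] ℂ) :
    TensorProduct.rid ℂ H (φ.lTensor H (comul (R := ℂ) (1 : H))) ∈ subR H :=
  Submodule.subset_span ⟨φ, rfl⟩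

lemma nR_eq (r : Coalgebra.Repr ℂ (1 : H) (H × H)) (x : H) :
    nR x = ∑ i ∈ r.index, counit (R := ℂ) (r.right i * x) • r.left i := by
  simp [nR, sum_repr_eq r]

lemma nR_mem (x : H) : nR x ∈ subR H :=
  Submodule.subset_span ⟨(counit (R := ℂ)).comp (LinearMap.mulRight ℂ x), rfl⟩

lemma counit_mul_nR (x y : H) : counit (R := ℂ) (x * nR y) = counit (R := ℂ) (x * y) := by
  have r := Coalgebra.Repr.arbitrary ℂ (1 : H)
  have h := WeakHopfAlgebra.weak_counit x 1 y
  rw [sum_repr_eq r] at h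
  rw [nR_eq r]
  simpa [Finset.mul_sum, mul_comm] using h

/-- The functionals ε(· n_R(x)) and ε(· x) agree, so Π^L does not distinguish n_R(x) from x, and on
A_R it is S. This is how n_R enters the index formulas. -/
lemma antipode_nR (x : H) : antipode (nR x) = counitalL x := by
  have r := Coalgebra.Repr.arbitrary ℂ (1 : H)
  rw [← counitalL_of_mem_subR (nR_mem x), counitalL_eq r, counitalL_eq r]
  simp only [counit_mul_nR]

lemma counit_subL_mul {c : H} (hc : c ∈ subL H) (x : H) :
    counit (R := ℂ) (c * x) = counit (R := ℂ) (antipode c * x) := by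
  rw [← counitalR_of_mem_subL hc, counit_counitalR_mul]

lemma counit_mul_subR {b : H} (hb : b ∈ subR H) (x : H) :
    counit (R := ℂ) (x * b) = counit (R := ℂ) (x * antipode b) := by
  rw [← counitalL_of_mem_subR hb, counit_mul_counitalL]

/-- The counit replaces y by S(y) on the right, S(y) commutes with x, and the counit applies S once
more on the left. So S² is the modular automorphism of ε on A_R. -/
lemma counit_mul_comm_subR {x y : H} (hx : x ∈ subR H) (hy : y ∈ subR H) :
    counit (R := ℂ) (x * y) = counit (R := ℂ) (antipode (antipode y) * x) := by
  rw [counit_mul_subR hy, (commute_subL_subR hx (antipode_mem_subL hy)).eq,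
    counit_subL_mul (antipode_mem_subL hy)]

lemma counit_mul_comm_subL {x y : H} (hx : x ∈ subL H) (hy : y ∈ subL H) :
    counit (R := ℂ) (x * y) = counit (R := ℂ) (y * antipode (antipode x)) := by
  rw [counit_subL_mul hx, (commute_subL_subR (antipode_mem_subR hx) hy).eq,
    counit_mul_subR (antipode_mem_subR hx)]

lemma conv_counit_mulRight_id {b : H} (hb : b ∈ subR H) (φ : H →ₗ[ℂ] ℂ) (x : H) :
    conv ((counit (R := ℂ)) ∘ₗ LinearMap.mulRight ℂ b) φ x = φ (x * antipode b) := by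
  have r := Coalgebra.Repr.arbitrary ℂ x
  have h := conv_mul_of_mem_subL' (counit (R := ℂ)) φ (antipode_mem_subL hb) x
  rw [conv_repr _ _ r] at h ⊢
  simp only [LinearMap.comp_apply, LinearMap.mulRight_apply, counit_mul_subR hb] at h ⊢
  rw [← h]
  have s := Coalgebra.Repr.arbitrary ℂ (x * antipode b)
  rw [conv_repr _ _ s, Hat.sum_counit_mul φ s]

lemma IsLeftIntegral.subR_mul {l : H} (hl : IsLeftIntegral l) {b : H} (hb : b ∈ subR H) :
    b * l = antipode b * l := by
  rw [hl b, counitalL_of_mem_subR hb]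

lemma IsRightIntegral.mul_subL {l : H} (hl : IsRightIntegral l) {c : H} (hc : c ∈ subL H) :
    l * c = l * antipode c := by
  rw [hl c, counitalR_of_mem_subL hc]

/-- Left integrals satisfy `l₍₁₎ ⊗ a l₍₂₎ = S(a) l₍₁₎ ⊗ l₍₂₎`. -/
lemma IsLeftIntegral.tmul_mul_comul {l : H} (hl : IsLeftIntegral l) (a : H) :
    (1 ⊗ₜ[ℂ] a) * comul (R := ℂ) l = (antipode a ⊗ₜ[ℂ] 1) * comul (R := ℂ) l := by
  have r := Coalgebra.Repr.arbitrary ℂ a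
  let iL : H →ₗ[ℂ] H ⊗[ℂ] H := (Algebra.TensorProduct.includeLeft (R := ℂ) (S := ℂ)).toLinearMap
  let iR : H →ₗ[ℂ] H ⊗[ℂ] H := (Algebra.TensorProduct.includeRight (R := ℂ)).toLinearMap
  have hLR : conv iL iR = comul := by
    ext x
    rw [conv_repr _ _ (Coalgebra.Repr.arbitrary ℂ x)]
    simp [iL, iR, ← sum_repr_eq]
  -- The element S(a₁) a₂ l₁ ⊗ a₃ l₂ is computed in two ways: here through S(a₁) a₂ = Π^R(a₁), below
  -- through a₂ l = Π^L(a₂) l and S(a₁) Π^L(a₂) = S(a).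
  have h1 : conv (iL ∘ₗ antipode) comul a = (1 ⊗ₜ[ℂ] a) * comul (R := ℂ) (1 : H) := by
    have h0 : conv (iL ∘ₗ antipode) comul = conv (iL ∘ₗ counitalR) iR := by
      have h00 : conv (iL ∘ₗ antipode) iL = iL ∘ₗ counitalR := by
        ext x
        have s := Coalgebra.Repr.arbitrary ℂ x
        rw [← conv_antipode_id, LinearMap.comp_apply, conv_repr _ _ s, conv_repr _ _ s, map_sum]
        simp [iL]
      rw [← hLR, ← conv_assoc, h00]
    rw [h0, ← counitalR_rTensor_comul, conv_repr _ _ r, sum_repr_eq r]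
    simp [iL, iR]
  have h2 : conv (iL ∘ₗ antipode) comul a * comul (R := ℂ) l =
      (antipode a ⊗ₜ[ℂ] 1) * comul (R := ℂ) l := by
    rw [conv_repr _ _ r, Finset.sum_mul]
    have h3 : ∀ i, (iL ∘ₗ antipode) (r.left i) * comul (R := ℂ) (r.right i) * comul (R := ℂ) l =
        ((antipode (r.left i) * counitalL (r.right i)) ⊗ₜ[ℂ] 1) * comul (R := ℂ) l := by
      intro i
      rw [mul_assoc, ← WeakHopfAlgebra.comul_mul, hl, comul_mul_of_mem_subL' (counitalL_mem _),
        ← mul_assoc]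
      simp [iL]
    simp only [h3]
    rw [← Finset.sum_mul, ← TensorProduct.sum_tmul, ← conv_repr _ _ r, conv_antipode_counitalL]
  rw [← h2, h1, mul_assoc, ← WeakHopfAlgebra.comul_mul, one_mul]

end Basic

/-! ### Anticomultiplicativity of the antipode. -/

section Finite

lemma tensor_ext {V : Type*} [AddCommGroup V] [Module ℂ V] [Module.Finite ℂ V] {s t : V ⊗[ℂ] V}
    (h : ∀ φ ψ : V →ₗ[ℂ] ℂ,
    LinearMap.mul' ℂ ℂ (TensorProduct.map φ ψ s) = LinearMap.mul' ℂ ℂ (TensorProduct.map φ ψ t)) :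
    s = t := by
  have hd : ∀ F : Module.Dual ℂ (V ⊗[ℂ] V), F s = F t := by
    intro F
    obtain ⟨u, rfl⟩ := (TensorProduct.dualDistribEquiv ℂ V V).surjective F
    induction u with
    | zero => simp
    | add x y hx hy => simp only [map_add, LinearMap.add_apply, hx, hy]
    | tmul φ ψ => exact h φ ψ
  rw [← sub_eq_zero, ← Module.forall_dual_apply_eq_zero_iff ℂ]
  intro F
  rw [map_sub, hd, sub_self]

variable {H : Type u} [Ring H] [Algebra ℂ H] [WeakHopfAlgebra H] [Module.Finite ℂ H]

/-- The antipode is anticomultiplicative. -/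
theorem comul_antipode (x : H) : comul (R := ℂ) (antipode x) =
    TensorProduct.map antipode antipode (TensorProduct.comm ℂ H H (comul (R := ℂ) x)) := by
  refine tensor_ext fun φ ψ => ?_
  -- Antimultiplicativity of the antipode of the dual, evaluated at x.
  have h := congrArg (fun χ => Hat.pairing H χ x) (antipode_mul_rev (Hat.of φ) (Hat.of ψ))
  have r := Coalgebra.Repr.arbitrary ℂ x
  change Hat.pairing H (Hat.of φ * Hat.of ψ) (antipode x) = _ at h
  rw [Hat.pairing_mul] at h
  refine Eq.trans h ?_
  rw [Hat.pairing_mul_repr _ _ r, sum_repr_eq r]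
  simp [mul_comm]
  rfl

lemma counit_antipode (x : H) : counit (R := ℂ) (antipode x) = counit (R := ℂ) x :=
  congrArg (fun χ => Hat.pairing H χ x) (antipode_one (H := Hat H))

lemma counitalL_antipode (x : H) : counitalL (antipode x) = antipode (counitalR x) := by
  have r := Coalgebra.Repr.arbitrary ℂ x
  rw [← conv_id_antipode, ← conv_antipode_id, conv_apply, comul_antipode, sum_repr_eq r,
    conv_repr _ _ r]
  simp [antipode_mul_rev]

lemma counitalR_antipode (x : H) : counitalR (antipode x) = antipode (counitalL x) := by
  have r := Coalgebra.Repr.arbitrary ℂ x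
  rw [← conv_id_antipode, ← conv_antipode_id, conv_apply, comul_antipode, sum_repr_eq r,
    conv_repr _ _ r]
  simp [antipode_mul_rev]

end Finite

/-! ### The involution and the inverse of the antipode. -/

/-- Compatibility of the comultiplication of a weak Hopf algebra with an involution. -/
class ComulStar (H : Type u) [Ring H] [StarRing H] [Algebra ℂ H] [StarModule ℂ H]
    [WeakHopfAlgebra H] : Prop where
  comul_star : ∀ x : H, comul (R := ℂ) (star x) = star (comul (R := ℂ) x)

instance (A : Type u) [CStarAlgebra A] [WeakCStarHopfAlgebra A] : ComulStar A where
  comul_star := WeakCStarHopfAlgebra.comul_star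

section Star

variable {H : Type u} [Ring H] [StarRing H] [Algebra ℂ H] [StarModule ℂ H] [WeakHopfAlgebra H]
  [ComulStar H]

/-- The image of a representation of `Δ(a)` under the involution. -/
noncomputable def starRepr {a : H} (r : Coalgebra.Repr ℂ a (H × H)) :
    Coalgebra.Repr ℂ (star a) (H × H) where
  index := r.index
  left i := star (r.left i)
  right i := star (r.right i)
  eq := by
    rw [ComulStar.comul_star, sum_repr_eq r, star_sum]
    rfl

/-- The image of a representation of `Δ(1)` under the involution. -/
noncomputable def starReprOne (r : Coalgebra.Repr ℂ (1 : H) (H × H)) :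
    Coalgebra.Repr ℂ (1 : H) (H × H) where
  index := r.index
  left i := star (r.left i)
  right i := star (r.right i)
  eq := (starRepr r).eq.trans (by rw [star_one])

/-- The linear functional `x ↦ conj φ(x*)`. -/
noncomputable def conjFun (φ : H →ₗ[ℂ] ℂ) : H →ₗ[ℂ] ℂ where
  toFun x := star (φ (star x))
  map_add' x y := by simp
  map_smul' c x := by simp

lemma conjFun_apply (φ : H →ₗ[ℂ] ℂ) (x : H) : conjFun φ x = star (φ (star x)) := rfl

lemma counit_star (x : H) : counit (R := ℂ) (star x) = star (counit (R := ℂ) x) := by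
  have r := Coalgebra.Repr.arbitrary ℂ x
  have h1 := Hat.sum_counit_mul (conjFun (counit (R := ℂ))) (starRepr r)
  have h2 := Hat.sum_mul_counit (conjFun (counit (R := ℂ))) r
  simp only [conjFun_apply, starRepr, star_star] at h1 h2
  rw [eq_comm, star_eq_iff_star_eq, ← h2, ← h1, star_sum] at *
  simp [mul_comm]

/-- The inverse `x ↦ S(x*)*` of the antipode. -/
noncomputable def antipodeInv : H →ₗ[ℂ] H where
  toFun x := star (antipode (star x))
  map_add' x y := by simp
  map_smul' c x := by simp

lemma antipodeInv_apply (x : H) : antipodeInv x = star (antipode (star x)) := rfl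

lemma star_counitalR (x : H) : star (counitalR (star x)) = nR x := by
  have r := Coalgebra.Repr.arbitrary ℂ (1 : H)
  rw [counitalR_eq r, nR_eq (starReprOne r), star_sum]
  simp [starReprOne, ← counit_star]

lemma antipode_star_counitalL (x : H) : antipode (star (counitalL (star x))) = counitalR x := by
  have r := Coalgebra.Repr.arbitrary ℂ (1 : H)
  have h : star (counitalL (star x)) = ∑ i ∈ r.index, counit (R := ℂ) (x * r.left i) •
      r.right i := by
    have r' := starReprOne r
    rw [counitalL_eq (starReprOne r), star_sum]
    simp [starReprOne, ← counit_star]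
  have h' : star (counitalL (star x)) ∈ subL H := by
    rw [h]
    have := slice_mem_subL ((counit (R := ℂ)).comp (LinearMap.mulLeft ℂ x))
    simpa [sum_repr_eq r] using this
  rw [← counitalR_of_mem_subL h', h, counitalR_eq r, counitalR_eq r]
  refine Finset.sum_congr rfl fun i _ => ?_
  congr 1
  have := WeakHopfAlgebra.weak_counit x 1 (r.right i)
  rw [sum_repr_eq r] at this
  simpa [Finset.sum_mul] using this

/-- Applying the involution and then S to the antipode axioms at x* shows that T = S ∘ `antipodeInv`
satisfies the same convolution identities against S as the identity map. This is the first of the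
three needed. -/
lemma conv_antipode_antipodeInv :
    conv (antipode ∘ₗ antipodeInv) antipode = counitalL (H := H) := by
  ext x
  have r := Coalgebra.Repr.arbitrary ℂ x
  have h := congrArg star (conv_repr antipode LinearMap.id (starRepr r))
  rw [conv_antipode_id, star_counitalR] at h
  rw [← antipode_nR, h, conv_repr _ _ r]
  simp [starRepr, antipode_mul_rev, antipodeInv_apply]

lemma conv_antipode_antipodeInv' :
    conv antipode (antipode ∘ₗ antipodeInv) = counitalR (H := H) := by
  ext x
  have r := Coalgebra.Repr.arbitrary ℂ x
  have h := congrArg star (conv_repr LinearMap.id antipode (starRepr r))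
  rw [conv_id_antipode] at h
  rw [← antipode_star_counitalL, h, conv_repr _ _ r]
  simp [starRepr, antipode_mul_rev, antipodeInv_apply]

lemma conv_antipode_antipodeInv_counitalR :
    conv (antipode ∘ₗ antipodeInv) counitalR = antipode ∘ₗ antipodeInv (H := H) := by
  ext x
  have r := Coalgebra.Repr.arbitrary ℂ x
  have h := congrArg (fun y => antipode (star y)) (conv_repr antipode counitalL (starRepr r))
  rw [conv_antipode_counitalL] at h
  rw [LinearMap.comp_apply, antipodeInv_apply, h, conv_repr _ _ r]
  simp [starRepr, antipode_mul_rev, antipodeInv_apply, antipode_star_counitalL]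

/-- Uniqueness of convolution inverses of S: T = T Π^R = T (S T) = Π^L T = (id S) T = id Π^R = id.
-/
lemma antipode_antipodeInv (x : H) : antipode (antipodeInv x) = x := by
  have h : antipode ∘ₗ antipodeInv = LinearMap.id (R := ℂ) (M := H) := by
    rw [← conv_antipode_antipodeInv_counitalR, ← conv_antipode_antipodeInv', ← conv_assoc,
      conv_antipode_antipodeInv, ← conv_id_antipode, conv_assoc, conv_antipode_antipodeInv',
      conv_id_counitalR]
  exact LinearMap.congr_fun h x

lemma star_mem_subL {c : H} (hc : c ∈ subL H) : star c ∈ subL H := by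
  have r := Coalgebra.Repr.arbitrary ℂ (1 : H)
  induction hc using Submodule.span_induction with
  | zero => simp
  | add x y _ _ hx hy => rw [star_add]; exact add_mem hx hy
  | smul a x _ hx => rw [star_smul]; exact Submodule.smul_mem _ _ hx
  | mem c hc =>
    obtain ⟨φ, rfl⟩ := hc
    refine Submodule.subset_span ⟨conjFun φ, ?_⟩
    simp only
    nth_rw 1 [sum_repr_eq (starReprOne r)]
    rw [sum_repr_eq r]
    simp [starReprOne, conjFun_apply]

lemma star_mem_subR {c : H} (hc : c ∈ subR H) : star c ∈ subR H := by
  have r := Coalgebra.Repr.arbitrary ℂ (1 : H)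
  induction hc using Submodule.span_induction with
  | zero => simp
  | add x y _ _ hx hy => rw [star_add]; exact add_mem hx hy
  | smul a x _ hx => rw [star_smul]; exact Submodule.smul_mem _ _ hx
  | mem c hc =>
    obtain ⟨φ, rfl⟩ := hc
    refine Submodule.subset_span ⟨conjFun φ, ?_⟩
    simp only
    nth_rw 1 [sum_repr_eq (starReprOne r)]
    rw [sum_repr_eq r]
    simp [starReprOne, conjFun_apply]

lemma antipodeInv_mem_subL {b : H} (hb : b ∈ subR H) : antipodeInv b ∈ subL H :=
  star_mem_subL (antipode_mem_subL (star_mem_subR hb))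

variable [Module.Finite ℂ H]

lemma antipode_injective : Function.Injective (antipode (H := H)) :=
  LinearMap.injective_iff_surjective.2 fun x => ⟨antipodeInv x, antipode_antipodeInv x⟩

lemma antipodeInv_antipode (x : H) : antipodeInv (antipode x) = x :=
  antipode_injective (antipode_antipodeInv _)

lemma star_antipode_star_antipode (x : H) : star (antipode (star (antipode x))) = x :=
  antipodeInv_antipode x

end Star

/-- The representation of `Δ(S(a))` obtained from one of `Δ(a)`. -/
noncomputable def antipodeRepr {H : Type u} [Ring H] [Algebra ℂ H] [WeakHopfAlgebra H]
    [Module.Finite ℂ H] {a : H} (r : Coalgebra.Repr ℂ a (H × H)) :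
    Coalgebra.Repr ℂ (antipode a) (H × H) where
  index := r.index
  left i := antipode (r.right i)
  right i := antipode (r.left i)
  eq := by
    rw [comul_antipode, sum_repr_eq r]
    simp

/-! ### The *-structure of the dual. -/

namespace Hat

variable {A : Type u} [Ring A] [StarRing A] [Algebra ℂ A] [StarModule ℂ A] [WeakHopfAlgebra A]

lemma pairing_star (φ : Hat A) (a : A) :
    pairing A (star φ) a = star (pairing A φ (star (antipode a))) := rfl

variable [ComulStar A] [Module.Finite ℂ A]

noncomputable instance : StarRing (Hat A) where
  star_involutive φ := ext fun a => by
    rw [pairing_star, pairing_star, star_star, star_antipode_star_antipode]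
  star_mul φ ψ := ext fun a => by
    have r := Coalgebra.Repr.arbitrary ℂ a
    rw [pairing_star, pairing_mul_repr _ _ (starRepr (antipodeRepr r)), pairing_mul_repr _ _ r,
      star_sum]
    simp only [starRepr, antipodeRepr, pairing_star, star_mul']
    exact Finset.sum_congr rfl fun i _ => mul_comm _ _
  star_add φ ψ := ext fun a => by
    simp only [pairing_star, map_add, LinearMap.add_apply, star_add]

instance : StarModule ℂ (Hat A) where
  star_smul c φ := ext fun a => by
    simp only [pairing_star, map_smul, LinearMap.smul_apply, smul_eq_mul, star_mul']

lemma pairing₂_star (t : Hat A ⊗[ℂ] Hat A) (a b : A) :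
    pairing₂ A (star t) (a ⊗ₜ b) =
      star (pairing₂ A t (star (antipode a) ⊗ₜ star (antipode b))) := by
  induction t with
  | zero => simp
  | add x y hx hy => simp only [star_add, map_add, LinearMap.add_apply, hx, hy]
  | tmul φ ψ => simp [TensorProduct.star_tmul, pairing_star]

instance : ComulStar (Hat A) where
  comul_star φ := ext₂ fun a b => by
    rw [pairing₂_star, pairing₂_comul, pairing₂_comul, LinearMap.mul'_apply, LinearMap.mul'_apply,
      pairing_star, antipode_mul_rev, star_mul]

end Hat

/-! ### Dual pairings, symmetric in A and Â. -/

section Pairing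

variable {K : Type u} [Ring K] [StarRing K] [Algebra ℂ K] [StarModule ℂ K] [WeakHopfAlgebra K]
  {L : Type u} [Ring L] [StarRing L] [Algebra ℂ L] [StarModule ℂ L] [WeakHopfAlgebra L]

/-- Nondegenerate pairings of weak Hopf `*`-algebras, along which the product, unit, antipode and
involution of each of them is dual to the structure of the other one. -/
structure IsDualPairing (p : K →ₗ[ℂ] L →ₗ[ℂ] ℂ) : Prop where
  mul_left : ∀ (φ ψ : K) (a : L), p (φ * ψ) a = conv (p φ) (p ψ) a
  mul_right : ∀ (φ : K) (a b : L), p φ (a * b) = conv (p.flip a) (p.flip b) φ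
  one_left : ∀ a : L, p 1 a = counit (R := ℂ) a
  one_right : ∀ φ : K, p φ 1 = counit (R := ℂ) φ
  antipode : ∀ (φ : K) (a : L), p (antipode φ) a = p φ (antipode a)
  counitalL : ∀ (φ : K) (a : L), p (counitalL φ) a = p φ (counitalL a)
  counitalR : ∀ (φ : K) (a : L), p (counitalR φ) a = p φ (counitalR a)
  star_left : ∀ (φ : K) (a : L), p (star φ) a = star (p φ (star (WeakHopfAlgebra.antipode a)))
  star_right : ∀ (φ : K) (a : L), p φ (star a) = star (p (star (WeakHopfAlgebra.antipode φ)) a)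
  injective : Function.Injective p
  injective_flip : Function.Injective p.flip

/-- This symmetry lets every result on integrals of A be applied to integrals of Â, without
identifying the bidual with A. -/
lemma IsDualPairing.flip {p : K →ₗ[ℂ] L →ₗ[ℂ] ℂ} (hp : IsDualPairing p) :
    IsDualPairing p.flip where
  mul_left φ ψ a := hp.mul_right a φ ψ
  mul_right φ a b := by simpa using hp.mul_left a b φ
  one_left := hp.one_right
  one_right := hp.one_left
  antipode φ a := (hp.antipode a φ).symm
  counitalL φ a := (hp.counitalL a φ).symm
  counitalR φ a := (hp.counitalR a φ).symm
  star_left φ a := hp.star_right a φ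
  star_right φ a := hp.star_left a φ
  injective := hp.injective_flip
  injective_flip := by simpa using hp.injective

lemma Hat.isDualPairing {A : Type u} [Ring A] [StarRing A] [Algebra ℂ A] [StarModule ℂ A]
    [WeakHopfAlgebra A] [ComulStar A] [Module.Finite ℂ A] :
    IsDualPairing (Hat.pairing A) where
  mul_left φ ψ a := rfl
  mul_right φ a b := by
    rw [← LinearMap.mul'_apply (R := ℂ), ← Hat.pairing₂_comul, conv_apply]
    induction comul (R := ℂ) φ with
    | zero => simp
    | add x y hx hy => simp only [map_add, LinearMap.add_apply, hx, hy]
    | tmul φ ψ => simp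
  one_left a := rfl
  one_right φ := rfl
  antipode φ a := rfl
  counitalL := Hat.pairing_counitalL
  counitalR := Hat.pairing_counitalR
  star_left φ a := rfl
  star_right φ a := by
    change _ = star (Hat.pairing A (star (Hat.antipodeMap A φ)) a)
    rw [Hat.pairing_star, Hat.pairing_antipodeMap, star_star]
    nth_rw 1 [← star_antipode_star_antipode a]
    simp
  injective := (Hat.toDual A).injective
  injective_flip := by
    rw [injective_iff_map_eq_zero]
    intro a ha
    rw [← Module.forall_dual_apply_eq_zero_iff ℂ]
    exact fun f => LinearMap.congr_fun ha (Hat.of f)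

end Pairing

/-! ### Positivity in finite-dimensional *-algebras embedded in a C*-algebra. -/

section CStarLike

/-- `*`-algebras that embed into a `C*`-algebra. -/
def IsCStarLike (B : Type u) [Ring B] [StarRing B] [Algebra ℂ B] : Prop :=
  ∃ (C : Type u) (_ : CStarAlgebra C) (ι : B →⋆ₐ[ℂ] C), Function.Injective ι

lemma IsCStarLike.of_cStarAlgebra (A : Type u) [CStarAlgebra A] : IsCStarLike A :=
  ⟨A, inferInstance, StarAlgHom.id ℂ A, Function.injective_id⟩

variable {B : Type u} [Ring B] [StarRing B] [Algebra ℂ B] [StarModule ℂ B] [Module.Finite ℂ B]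

section Embedding

variable {C : Type u} [CStarAlgebra C] (ι : B →⋆ₐ[ℂ] C)

/-- The spectrum consists of roots of the minimal polynomial of a. -/
lemma finite_spectrum_map (a : B) : (spectrum ℂ (ι a)).Finite := by
  have ha : IsIntegral ℂ a := Algebra.IsIntegral.isIntegral a
  refine ((minpoly ℂ a).rootSet_finite ℂ).subset fun k hk => ?_
  rw [Polynomial.mem_rootSet]
  refine ⟨minpoly.ne_zero ha, ?_⟩
  have h1 := spectrum.subset_polynomial_aeval (ι a) (minpoly ℂ a) ⟨k, hk, rfl⟩
  have h2 : Polynomial.aeval (ι a) (minpoly ℂ a) = 0 := by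
    have := Polynomial.aeval_algHom_apply ι.toAlgHom a (minpoly ℂ a)
    rw [minpoly.aeval, map_zero] at this
    exact this
  rw [h2] at h1
  by_contra h3
  refine h1 ?_
  rw [spectrum.mem_resolventSet_iff, sub_zero]
  exact (IsUnit.mk0 _ (by simpa using h3)).map (algebraMap ℂ C)

/-- On a finite spectrum f coincides with its Lagrange interpolation. So functional calculus in the
ambient C*-algebra does not leave B, nor any unital subalgebra that contains a. -/
lemma exists_aeval_eq_cfc {a : B} (ha : star a = a) (f : ℝ → ℝ) :
    ∃ q : Polynomial ℂ, ι (Polynomial.aeval a q) = cfc f (ι a) := by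
  have ha' : IsSelfAdjoint (ι a) := by rw [IsSelfAdjoint, ← map_star, ha]
  have hfin : (spectrum ℝ (ι a)).Finite := by
    refine Set.Finite.of_finite_image (f := (algebraMap ℝ ℂ))
      ((finite_spectrum_map ι a).subset ?_) (algebraMap ℝ ℂ).injective.injOn
    rw [Set.image_subset_iff]
    intro x hx
    exact (spectrum.algebraMap_mem_iff ℂ).2 hx
  let p : Polynomial ℝ := Lagrange.interpolate hfin.toFinset id f
  refine ⟨p.map (algebraMap ℝ ℂ), ?_⟩
  have h1 : cfc f (ι a) = cfc p.eval (ι a) := cfc_congr fun x hx => by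
    simp only [p]
    rw [show x = id x from rfl, Lagrange.eval_interpolate_at_node _ (Set.injOn_id _)
      (hfin.mem_toFinset.2 hx)]
    rfl
  rw [h1, cfc_polynomial p (ι a), ← Polynomial.aeval_map_algebraMap ℂ (ι a) p]
  exact (Polynomial.aeval_algHom_apply ι.toAlgHom a _).symm

lemma star_eq_of_map_cfc (hι : Function.Injective ι) {a b : B} {f : ℝ → ℝ}
    (hb : ι b = cfc f (ι a)) : star b = b := by
  apply hι
  rw [map_star, hb]
  exact cfc_predicate f (ι a)

open CStarAlgebra in
lemma isPos_of_spectrum (hι : Function.Injective ι) {a : B} (ha : star a = a)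
    (h : ∀ x ∈ spectrum ℝ (ι a), 0 ≤ x) :
    ∃ q : Polynomial ℂ, IsPos (Polynomial.aeval a q) ∧
      Polynomial.aeval a q * Polynomial.aeval a q = a := by
  have ha' : IsSelfAdjoint (ι a) := by rw [IsSelfAdjoint, ← map_star, ha]
  obtain ⟨q, hq⟩ := exists_aeval_eq_cfc ι ha (fun x => √x)
  obtain ⟨q', hq'⟩ := exists_aeval_eq_cfc ι ha (fun x => √√x)
  refine ⟨q, ⟨Polynomial.aeval a q', ?_⟩, ?_⟩
  · apply hι
    rw [star_eq_of_map_cfc ι hι hq', map_mul, hq, hq', ← cfc_mul _ _ (ι a)]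
    exact cfc_congr fun x hx => (Real.mul_self_sqrt (Real.sqrt_nonneg x)).symm
  · apply hι
    rw [map_mul, hq, ← cfc_mul _ _ (ι a)]
    refine (cfc_congr fun x hx => ?_).trans (cfc_id ℝ (ι a))
    exact Real.mul_self_sqrt (h x hx)

lemma map_nonneg_of_isPos [PartialOrder C] [StarOrderedRing C] {a : B} (h : IsPos a) :
    0 ≤ ι a := by
  obtain ⟨y, rfl⟩ := h
  rw [map_mul, map_star]
  exact star_mul_self_nonneg _

end Embedding

omit [StarModule ℂ B] [Module.Finite ℂ B] [Algebra ℂ B] in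
lemma IsPos.star_eq {a : B} (h : IsPos a) : star a = a := by
  obtain ⟨y, rfl⟩ := h
  simp

/-- A positive element has a positive square root, which is a polynomial in it. -/
lemma IsCStarLike.exists_sqrt (hB : IsCStarLike B) {a : B} (h : IsPos a) :
    ∃ q : Polynomial ℂ, IsPos (Polynomial.aeval a q) ∧
      Polynomial.aeval a q * Polynomial.aeval a q = a := by
  obtain ⟨C, _, ι, hι⟩ := hB
  let := CStarAlgebra.spectralOrder C
  have := CStarAlgebra.spectralOrderedRing C
  exact isPos_of_spectrum ι hι h.star_eq fun x hx =>
    spectrum_nonneg_of_nonneg (map_nonneg_of_isPos ι h) hx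

lemma IsCStarLike.eq_of_mul_self_eq (hB : IsCStarLike B) {s t : B} (hs : IsPos s) (ht : IsPos t)
    (h : s * s = t * t) : s = t := by
  obtain ⟨C, _, ι, hι⟩ := hB
  let := CStarAlgebra.spectralOrder C
  have := CStarAlgebra.spectralOrderedRing C
  have hs' := map_nonneg_of_isPos ι hs
  have ht' := map_nonneg_of_isPos ι ht
  apply hι
  rw [← CFC.sqrt_unique (a := ι s * ι s) rfl hs', ← map_mul, h, map_mul,
    CFC.sqrt_unique (a := ι t * ι t) rfl ht']

lemma IsCStarLike.posSqrt_eq (hB : IsCStarLike B) {s : B} (hs : IsPos s) :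
    posSqrt (s * s) = s := by
  have H : ∃ t : B, IsPos t ∧ t * t = s * s := ⟨s, hs, rfl⟩
  rw [posSqrt, dif_pos H]
  exact hB.eq_of_mul_self_eq H.choose_spec.1 hs H.choose_spec.2

lemma IsCStarLike.isPos_of_nonneg (hB : IsCStarLike B) {a : B}
    (h : ∀ (C : Type u) (_ : CStarAlgebra C) (_ : PartialOrder C) (_ : StarOrderedRing C)
      (ι : B →⋆ₐ[ℂ] C), 0 ≤ ι a) : IsPos a := by
  obtain ⟨C, _, ι, hι⟩ := hB
  let := CStarAlgebra.spectralOrder C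
  have := CStarAlgebra.spectralOrderedRing C
  have h0 := h C _ _ inferInstance ι
  have ha : star a = a := hι (by rw [map_star]; exact IsSelfAdjoint.of_nonneg h0)
  obtain ⟨q, hq, hq'⟩ := isPos_of_spectrum ι hι ha fun x hx => spectrum_nonneg_of_nonneg h0 hx
  refine ⟨Polynomial.aeval a q, ?_⟩
  rw [hq.star_eq, hq']

lemma IsCStarLike.isPos_sum (hB : IsCStarLike B) {n : Type*} (s : Finset n) (x : n → B)
    (h : ∀ i, IsPos (x i)) : IsPos (∑ i ∈ s, x i) :=
  hB.isPos_of_nonneg fun C _ _ _ ι => by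
    rw [map_sum]
    exact Finset.sum_nonneg fun i _ => map_nonneg_of_isPos ι (h i)

omit [StarModule ℂ B] [Module.Finite ℂ B] [Algebra ℂ B] in
lemma isPos_mul_star (x : B) : IsPos (x * star x) :=
  ⟨star x, by rw [star_star]⟩

/-- Evaluations of polynomials in an element of a subspace closed under products. -/
lemma aeval_mem {R : Submodule ℂ B} (h1 : (1 : B) ∈ R) (hmul : ∀ x ∈ R, ∀ y ∈ R, x * y ∈ R)
    {a : B} (ha : a ∈ R) (q : Polynomial ℂ) : Polynomial.aeval a q ∈ R := by
  rw [Polynomial.aeval_eq_sum_range]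
  refine Submodule.sum_mem _ fun i _ => Submodule.smul_mem _ _ ?_
  clear * - h1 hmul ha
  induction i with
  | zero => simpa using h1
  | succ n ih => rw [pow_succ]; exact hmul _ ih _ ha

/-- A selfadjoint element is positive if it is so as a quadratic form with respect to a faithful
positive functional. -/
lemma IsCStarLike.isPos_of_form (hB : IsCStarLike B) {R : Submodule ℂ B} (h1 : (1 : B) ∈ R)
    (hmul : ∀ x ∈ R, ∀ y ∈ R, x * y ∈ R) (ω : B →ₗ[ℂ] ℂ)
    (hω : ∀ b ∈ R, 0 ≤ ω (star b * b)) (hω' : ∀ b ∈ R, ω (star b * b) = 0 → b = 0) {d : B}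
    (hd : d ∈ R) (hd' : star d = d) (h : ∀ b ∈ R, 0 ≤ ω (star b * d * b)) : IsPos d := by
  obtain ⟨C, _, ι, hι⟩ := hB
  have ha' : IsSelfAdjoint (ι d) := by rw [IsSelfAdjoint, ← map_star, hd']
  -- The test vector is the square root of the negative part d₋ of d: the form takes there the value
  -- -ω(d₋²), so faithfulness gives d₋ = 0.
  obtain ⟨q, hq⟩ := exists_aeval_eq_cfc ι hd' (fun x => √(max (-x) 0))
  obtain ⟨q', hq'⟩ := exists_aeval_eq_cfc ι hd' (fun x => max (-x) 0)
  have e : star (Polynomial.aeval d q) * d * Polynomial.aeval d q =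
      - (star (Polynomial.aeval d q') * Polynomial.aeval d q') := by
    apply hι
    rw [star_eq_of_map_cfc ι hι hq', star_eq_of_map_cfc ι hι hq, map_neg, map_mul, map_mul,
      map_mul, hq, hq']
    nth_rw 2 [← cfc_id ℝ (ι d)]
    rw [← cfc_mul _ _ (ι d), ← cfc_mul _ _ (ι d), ← cfc_mul _ _ (ι d), ← cfc_neg]
    refine cfc_congr fun x hx => ?_
    have := Real.mul_self_sqrt (le_max_right (-x) 0)
    rcases le_total (-x) 0 with h | h
    · simp [max_eq_right h]
    · rw [max_eq_left h] at this ⊢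
      simp only [id]
      linear_combination x * this
  have h3 := h _ (aeval_mem h1 hmul hd q)
  rw [e, map_neg] at h3
  have h4 := hω _ (aeval_mem h1 hmul hd q')
  have h5 := hω' _ (aeval_mem h1 hmul hd q') (le_antisymm (neg_nonneg.1 h3) h4)
  rw [h5, map_zero] at hq'
  have h6 : ∀ x ∈ spectrum ℝ (ι d), 0 ≤ x := by
    intro x hx
    have h7 := (cfc_eq_cfc_iff_eqOn (R := ℝ) (a := ι d) (f := fun _ => 0)
      (g := fun x => max (-x) 0)).1 (by rw [← hq']; simp) hx
    simp only at h7
    have := le_max_left (-x) 0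
    linarith
  obtain ⟨q, hq, hq'⟩ := isPos_of_spectrum ι hι hd' h6
  refine ⟨Polynomial.aeval d q, ?_⟩
  rw [hq.star_eq, hq']

/-! ### Faithfulness of the regular traces. -/

section Trace

lemma trace_nonneg_of_eigenvalues {V : Type*} [AddCommGroup V] [Module ℂ V] [Module.Finite ℂ V]
    (T : Module.End ℂ V) (h : ∀ μ, T.HasEigenvalue μ → 0 ≤ μ) :
    0 ≤ LinearMap.trace ℂ V T ∧ (LinearMap.trace ℂ V T = 0 → ∀ μ, T.HasEigenvalue μ → μ = 0) := by
  have h0 : LinearMap.trace ℂ V T = T.charpoly.roots.sum :=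
    Module.End.trace_eq_sum_roots_charpoly_of_splits (IsAlgClosed.splits _)
  have h1 : ∀ μ, μ ∈ T.charpoly.roots ↔ T.HasEigenvalue μ := fun μ => by
    rw [Polynomial.mem_roots T.charpoly_monic.ne_zero,
      Module.End.hasEigenvalue_iff_isRoot_charpoly]
  have h2 : ∀ μ ∈ T.charpoly.roots, 0 ≤ μ := fun μ hμ => h μ ((h1 μ).1 hμ)
  rw [h0]
  exact ⟨Multiset.sum_nonneg h2, fun h3 μ hμ =>
    Multiset.all_zero_of_le_zero_le_of_sum_eq_zero h2 h3 μ ((h1 μ).2 hμ)⟩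

/-- Linear operators with the same spectrum as a positive element have nonnegative trace. -/
lemma IsCStarLike.trace_nonneg_of_spectrum (hB : IsCStarLike B) (a : B) (T : Module.End ℂ B)
    (h : ∀ μ : ℂ, T.HasEigenvalue μ ↔ μ ∈ spectrum ℂ (star a * a))
    (h' : ∀ μ : ℂ, T.HasEigenvalue μ → ∃ y : B, y ≠ 0 ∧
      ((star a * a - algebraMap ℂ B μ) * y = 0 ∨ y * (star a * a - algebraMap ℂ B μ) = 0)) :
    0 ≤ LinearMap.trace ℂ B T ∧ (LinearMap.trace ℂ B T = 0 → a = 0) := by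
  obtain ⟨C, _, ι, hι⟩ := hB
  let := CStarAlgebra.spectralOrder C
  have := CStarAlgebra.spectralOrderedRing C
  have h0 : 0 ≤ ι (star a * a) := map_nonneg_of_isPos ι ⟨a, rfl⟩
  have hpos : ∀ μ, T.HasEigenvalue μ → 0 ≤ μ := by
    intro μ hμ
    refine spectrum_nonneg_of_nonneg h0 ?_
    obtain ⟨y, hy, hy'⟩ := h' μ hμ
    have hy0 : ι y ≠ 0 := fun h => hy (hι (by rw [h, map_zero]))
    intro hu
    rw [spectrum.mem_resolventSet_iff, ← IsUnit.neg_iff, neg_sub] at hu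
    have e : ι (star a * a) - algebraMap ℂ C μ = ι (star a * a - algebraMap ℂ B μ) := by
      rw [map_sub]
      congr 1
      exact (AlgHomClass.commutes ι μ).symm
    rw [e] at hu
    rcases hy' with h1 | h1
    · exact hy0 (hu.mul_right_eq_zero.1 (by rw [← map_mul, h1, map_zero]))
    · exact hy0 (hu.mul_left_eq_zero.1 (by rw [← map_mul, h1, map_zero]))
  obtain ⟨h1, h2⟩ := trace_nonneg_of_eigenvalues T hpos
  refine ⟨h1, fun h3 => ?_⟩
  have h4 : ι (star a * a) = 0 := by
    refine CFC.eq_zero_of_spectrum_subset_zero (R := ℝ) (ι (star a * a)) (fun k hk => ?_)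
      (IsSelfAdjoint.of_nonneg h0)
    have h5 : algebraMap ℝ ℂ k ∈ spectrum ℂ (star a * a) :=
      AlgHom.spectrum_apply_subset ι.toAlgHom _ ((spectrum.algebraMap_mem_iff ℂ).2 hk)
    have h6 := h2 h3 _ ((h _).2 h5)
    simpa using h6
  rw [map_mul, map_star, CStarRing.star_mul_self_eq_zero_iff] at h4
  exact hι (by rw [h4, map_zero])

/-- The traces of left multiplications. -/
noncomputable def trL (B : Type u) [Ring B] [Algebra ℂ B] : B →ₗ[ℂ] ℂ :=
  LinearMap.trace ℂ B ∘ₗ LinearMap.mul ℂ B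

/-- The traces of right multiplications. -/
noncomputable def trR (B : Type u) [Ring B] [Algebra ℂ B] : B →ₗ[ℂ] ℂ :=
  LinearMap.trace ℂ B ∘ₗ (LinearMap.mul ℂ B).flip

omit [StarRing B] [StarModule ℂ B] [Module.Finite ℂ B] in
lemma trL_mul_comm (x y : B) : trL B (x * y) = trL B (y * x) := by
  have h : ∀ x y : B, LinearMap.mul ℂ B (x * y) = LinearMap.mul ℂ B x * LinearMap.mul ℂ B y := by
    intro x y; ext z; simp [mul_assoc]
  simp only [trL, LinearMap.comp_apply, h]
  rw [LinearMap.trace_mul_comm]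

omit [StarRing B] [StarModule ℂ B] in
lemma isUnit_of_mulLeft_injective {x : B} (h : ∀ y, x * y = 0 → y = 0) : IsUnit x := by
  have hi : Function.Injective (LinearMap.mulLeft ℂ x) :=
    (injective_iff_map_eq_zero _).2 h
  obtain ⟨y, hy⟩ := LinearMap.injective_iff_surjective.1 hi 1
  simp only [LinearMap.mulLeft_apply] at hy
  refine ⟨⟨x, y, hy, ?_⟩, rfl⟩
  rw [← sub_eq_zero]
  exact h _ (by rw [mul_sub, ← mul_assoc, hy]; simp)

omit [StarRing B] [StarModule ℂ B] in
lemma isUnit_of_mulRight_injective {x : B} (h : ∀ y, y * x = 0 → y = 0) : IsUnit x := by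
  have hi : Function.Injective (LinearMap.mulRight ℂ x) :=
    (injective_iff_map_eq_zero _).2 h
  obtain ⟨y, hy⟩ := LinearMap.injective_iff_surjective.1 hi 1
  simp only [LinearMap.mulRight_apply] at hy
  refine ⟨⟨x, y, ?_, hy⟩, rfl⟩
  rw [← sub_eq_zero]
  exact h _ (by rw [sub_mul, mul_assoc, hy]; simp)

/-- In finite dimension a non-unit is a zero divisor, so the eigenvalues of left multiplication by
a*a are exactly the spectrum of a*a, which is nonnegative; their sum vanishes only if a*a = 0. -/
lemma IsCStarLike.trL_nonneg (hB : IsCStarLike B) (a : B) :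
    0 ≤ trL B (star a * a) ∧ (trL B (star a * a) = 0 → a = 0) := by
  have key : ∀ μ : ℂ, Module.End.HasEigenvalue (LinearMap.mul ℂ B (star a * a)) μ → ∃ y : B, y ≠ 0 ∧
      (star a * a - algebraMap ℂ B μ) * y = 0 := by
    intro μ hμ
    obtain ⟨y, hy, hy0⟩ := hμ.exists_hasEigenvector
    refine ⟨y, hy0, ?_⟩
    rw [Module.End.mem_eigenspace_iff] at hy
    rw [sub_mul, ← Algebra.smul_def, ← hy]
    simp
  refine hB.trace_nonneg_of_spectrum a _ (fun μ => ⟨fun hμ hu => ?_, fun hμ => ?_⟩)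
    fun μ hμ => ?_
  · obtain ⟨y, hy0, hy⟩ := key μ hμ
    rw [spectrum.mem_resolventSet_iff, ← IsUnit.neg_iff, neg_sub] at hu
    exact hy0 (hu.mul_right_eq_zero.1 hy)
  · by_contra hμ'
    refine hμ ?_
    rw [spectrum.mem_resolventSet_iff, ← IsUnit.neg_iff, neg_sub]
    refine isUnit_of_mulLeft_injective fun y hy => ?_
    by_contra hy0
    refine hμ' (Module.End.hasEigenvalue_of_hasEigenvector (x := y) ⟨?_, hy0⟩)
    rw [Module.End.mem_eigenspace_iff]
    rw [sub_mul, ← Algebra.smul_def, sub_eq_zero] at hy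
    exact hy
  · obtain ⟨y, hy0, hy⟩ := key μ hμ
    exact ⟨y, hy0, Or.inl hy⟩

lemma IsCStarLike.trR_nonneg (hB : IsCStarLike B) (a : B) :
    0 ≤ trR B (star a * a) ∧ (trR B (star a * a) = 0 → a = 0) := by
  have key : ∀ μ : ℂ, Module.End.HasEigenvalue ((LinearMap.mul ℂ B).flip (star a * a)) μ →
      ∃ y : B, y ≠ 0 ∧ y * (star a * a - algebraMap ℂ B μ) = 0 := by
    intro μ hμ
    obtain ⟨y, hy, hy0⟩ := hμ.exists_hasEigenvector
    refine ⟨y, hy0, ?_⟩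
    rw [Module.End.mem_eigenspace_iff] at hy
    rw [mul_sub, ← Algebra.commutes, ← Algebra.smul_def, ← hy]
    simp
  refine hB.trace_nonneg_of_spectrum a _ (fun μ => ⟨fun hμ hu => ?_, fun hμ => ?_⟩)
    fun μ hμ => ?_
  · obtain ⟨y, hy0, hy⟩ := key μ hμ
    rw [spectrum.mem_resolventSet_iff, ← IsUnit.neg_iff, neg_sub] at hu
    exact hy0 (hu.mul_left_eq_zero.1 hy)
  · by_contra hμ'
    refine hμ ?_
    rw [spectrum.mem_resolventSet_iff, ← IsUnit.neg_iff, neg_sub]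
    refine isUnit_of_mulRight_injective fun y hy => ?_
    by_contra hy0
    refine hμ' (Module.End.hasEigenvalue_of_hasEigenvector (x := y) ⟨?_, hy0⟩)
    rw [Module.End.mem_eigenspace_iff]
    rw [mul_sub, ← Algebra.commutes, ← Algebra.smul_def, sub_eq_zero] at hy
    exact hy
  · obtain ⟨y, hy0, hy⟩ := key μ hμ
    exact ⟨y, hy0, Or.inr hy⟩

end Trace

/-! ### Faithful positive functionals: GNS representation and orthonormal bases. -/

section Functional

/-- Faithful positive functionals. -/
structure IsFaithfulPos (ω : B →ₗ[ℂ] ℂ) : Prop where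
  nonneg : ∀ x, 0 ≤ ω (star x * x)
  faithful : ∀ x, ω (star x * x) = 0 → x = 0

omit [Module.Finite ℂ B] in
/-- A sesquilinear form with real diagonal is hermitian. -/
lemma apply_star_mul_eq_star {R : Submodule ℂ B} {ω : B →ₗ[ℂ] ℂ} {d : B}
    (h : ∀ b ∈ R, 0 ≤ ω (star b * d * b)) {x y : B} (hx : x ∈ R) (hy : y ∈ R) :
    ω (star x * d * y) = star (ω (star y * d * x)) := by
  have h0 : ∀ b ∈ R, (ω (star b * d * b)).im = 0 := fun b hb =>
    (Complex.nonneg_iff.1 (h b hb)).2.symm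
  -- Polarization: the diagonal values at x + y and x + iy give the imaginary and the real part of
  -- the identity.
  have h1 := h0 _ (add_mem hx hy)
  have h2 := h0 _ (add_mem hx (R.smul_mem Complex.I hy))
  have hxx := h0 x hx
  have hyy := h0 y hy
  simp only [star_add, star_smul, add_mul, mul_add, map_add, smul_mul_assoc, mul_smul_comm,
    map_smul, smul_eq_mul, Complex.add_im, Complex.mul_im, Complex.mul_re, Complex.star_def,
    Complex.conj_I, Complex.neg_re, Complex.neg_im, Complex.I_re, Complex.I_im, hxx, hyy] at h1 h2
  apply Complex.ext
  · simp only [Complex.star_def, Complex.conj_re]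
    linarith
  · simp only [Complex.star_def, Complex.conj_im]
    linarith

namespace IsFaithfulPos

variable {ω : B →ₗ[ℂ] ℂ} (hω : IsFaithfulPos ω)
include hω

lemma conj_symm (x y : B) : ω (star x * y) = star (ω (star y * x)) := by
  have := apply_star_mul_eq_star (R := ⊤) (ω := ω) (d := 1)
    (fun b _ => by simpa using hω.nonneg b) (Submodule.mem_top (x := x))
    (Submodule.mem_top (x := y))
  simpa using this

end IsFaithfulPos

/-- The inner product `⟨x, y⟩ = ω(x* y)`. -/
@[reducible] noncomputable def IsFaithfulPos.core {ω : B →ₗ[ℂ] ℂ} (hω : IsFaithfulPos ω) :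
    InnerProductSpace.Core ℂ B where
  inner x y := ω (star x * y)
  conj_inner_symm x y := (hω.conj_symm x y).symm
  re_inner_nonneg x := (Complex.nonneg_iff.1 (hω.nonneg x)).1
  add_left x y z := by simp [add_mul]
  smul_left x y r := by simp
  definite := hω.faithful

/-- The Gelfand–Naimark–Segal representation of a faithful positive functional. -/
lemma IsFaithfulPos.isCStarLike {ω : B →ₗ[ℂ] ℂ} (hω : IsFaithfulPos ω) : IsCStarLike B := by
  let c := hω.core
  let i1 : NormedAddCommGroup B := c.toNormedAddCommGroup
  let i2 : InnerProductSpace ℂ B := InnerProductSpace.ofCore c.toCore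
  have : CompleteSpace B := FiniteDimensional.complete ℂ B
  refine ⟨B →L[ℂ] B, inferInstance,
    { toFun := fun x => LinearMap.toContinuousLinearMap (LinearMap.mulLeft ℂ x)
      map_one' := by ext; simp
      map_mul' := fun x y => by ext; simp
      map_zero' := by ext; simp
      map_add' := fun x y => by ext; simp [add_mul]
      commutes' := fun r => by ext; simp [Algebra.smul_def]
      map_star' := fun x => by
        rw [ContinuousLinearMap.star_eq_adjoint, ContinuousLinearMap.eq_adjoint_iff]
        intro y z
        change ω (star (star x * y) * z) = ω (star y * (x * z))
        simp [mul_assoc] }, fun x y hxy => ?_⟩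
  have := congrArg (fun T : B →L[ℂ] B => T 1) hxy
  simpa using this

/-- Dual bases `uᵢ`, `uᵢ*` with respect to a faithful positive functional. -/
lemma IsFaithfulPos.exists_dual_basis {ω : B →ₗ[ℂ] ℂ} (hω : IsFaithfulPos ω) :
    ∃ (n : ℕ) (u : Module.Basis (Fin n) ℂ B), (∀ x, ∑ i, ω (x * u i) • star (u i) = x) ∧
      ∀ i j, ω (star (u i) * u j) = if i = j then 1 else 0 := by
  let c := hω.core
  let i1 : NormedAddCommGroup B := c.toNormedAddCommGroup
  let i2 : InnerProductSpace ℂ B := InnerProductSpace.ofCore c.toCore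
  let b := stdOrthonormalBasis ℂ B
  refine ⟨Module.finrank ℂ B, b.toBasis, fun x => ?_, fun i j => ?_⟩
  · have h := b.sum_repr (star x)
    have h' : ∀ i, b.repr (star x) i = ω (star (b i) * star x) := fun i => b.repr_apply_apply _ i
    simp only [h'] at h
    apply star_injective
    rw [← h, star_sum]
    refine Finset.sum_congr rfl fun i _ => ?_
    rw [star_smul, star_star, hω.conj_symm, star_star]
    simp
  · have h := orthonormal_iff_ite.1 b.orthonormal i j
    rw [OrthonormalBasis.coe_toBasis]
    exact h

end Functional

end CStarLike

/-! ### Inverses and square roots inside a subalgebra. -/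

section Inverse

variable {B : Type u} [Ring B] [StarRing B] [Algebra ℂ B] [StarModule ℂ B] [Module.Finite ℂ B]

/-- In a finite-dimensional unital subalgebra, left non-zero-divisors are invertible. -/
lemma exists_inverse_mem {R : Submodule ℂ B} (h1 : (1 : B) ∈ R)
    (hmul : ∀ x ∈ R, ∀ y ∈ R, x * y ∈ R) {x : B} (hx : x ∈ R) (h : ∀ y ∈ R, x * y = 0 → y = 0) :
    ∃ y ∈ R, x * y = 1 ∧ y * x = 1 := by
  let T : R →ₗ[ℂ] R := (LinearMap.mulLeft ℂ x).restrict fun y hy => hmul x hx y hy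
  have hT : Function.Injective T := (injective_iff_map_eq_zero T).2 fun y hy =>
    Subtype.ext (h y y.2 (congrArg Subtype.val hy))
  obtain ⟨y, hy⟩ := LinearMap.injective_iff_surjective.1 hT ⟨1, h1⟩
  have hy' : x * y = 1 := congrArg Subtype.val hy
  refine ⟨y, y.2, hy', sub_eq_zero.1 (h _ (sub_mem (hmul _ y.2 _ hx) h1) ?_)⟩
  rw [mul_sub, ← mul_assoc, hy', one_mul, mul_one, sub_self]

lemma IsPos.inv {a a' : B} (h : IsPos a) (h1 : a * a' = 1) (h2 : a' * a = 1) : IsPos a' := by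
  have h3 : star a' = a' := by
    have := congrArg star h1
    rw [star_mul, h.star_eq, star_one] at this
    exact left_inv_eq_right_inv this h1
  obtain ⟨y, rfl⟩ := h
  refine ⟨y * a', ?_⟩
  rw [star_mul, h3, mul_assoc, ← mul_assoc (star y), h1, mul_one]

/-- Positive invertible square roots in a subalgebra. -/
lemma IsCStarLike.exists_sqrt_mem (hB : IsCStarLike B) {R : Submodule ℂ B} (h1 : (1 : B) ∈ R)
    (hmul : ∀ x ∈ R, ∀ y ∈ R, x * y ∈ R) {a a' : B} (ha : a ∈ R) (ha' : a' ∈ R) (hp : IsPos a)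
    (h2 : a * a' = 1) (h3 : a' * a = 1) :
    ∃ s ∈ R, ∃ s' ∈ R, IsPos s ∧ s * s = a ∧ s * s' = 1 ∧ s' * s = 1 ∧
      ∀ b, Commute a b → Commute s b := by
  obtain ⟨q, hq, hq'⟩ := hB.exists_sqrt hp
  set s := Polynomial.aeval a q with hs
  have hc : ∀ b, Commute a b → Commute s b := fun b hb => by
    -- Being a polynomial in a, the root lies in every centralizer that contains a. Biduality needs
    -- this to keep the roots of a central element central.
    have h := aeval_mem (R := (Subalgebra.centralizer ℂ {b}).toSubmodule) (Subalgebra.one_mem _)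
      (fun x hx y hy => Subalgebra.mul_mem _ hx hy) (a := a)
      ((Subalgebra.mem_centralizer_iff ℂ).2 fun g hg => by
        rw [Set.mem_singleton_iff.1 hg]; exact hb.symm.eq) q
    exact ((Subalgebra.mem_centralizer_iff ℂ).1 h b rfl).symm
  have hsR : s ∈ R := aeval_mem h1 hmul ha q
  refine ⟨s, hsR, s * a', hmul _ hsR _ ha', hq, hq', by rw [← mul_assoc, hq', h2], ?_, hc⟩
  rw [(hc a' (h2.trans h3.symm)).eq, mul_assoc, hq', h3]

end Inverse

/-! ### The trace element of A_R: the counit as a weighted trace. -/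

section TraceElement

variable {L : Type u} [Ring L] [StarRing L] [Algebra ℂ L] [StarModule ℂ L] [WeakHopfAlgebra L]
  [ComulStar L] [Module.Finite ℂ L]

/-- As a bijective antihomomorphism, S conjugates right multiplication by x into left multiplication
by S(x). -/
lemma trL_antipode (x : L) : trL L (antipode x) = trR L x := by
  let e : L ≃ₗ[ℂ] L := LinearEquiv.ofBijective antipode
    ⟨antipode_injective, LinearMap.injective_iff_surjective.1 antipode_injective⟩
  have h : LinearMap.mul ℂ L (antipode x) = e.conj ((LinearMap.mul ℂ L).flip x) := by
    ext y
    obtain ⟨y, rfl⟩ := e.surjective y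
    simp only [LinearEquiv.conj_apply, LinearMap.comp_apply, LinearEquiv.coe_coe,
      LinearEquiv.symm_apply_apply, LinearMap.flip_apply, LinearMap.mul_apply']
    exact (antipode_mul_rev y x).symm
  simp only [trL, trR, LinearMap.comp_apply, h]
  exact LinearMap.trace_conj' _ e

lemma trR_mul_comm (x y : L) : trR L (x * y) = trR L (y * x) := by
  rw [← trL_antipode, ← trL_antipode, antipode_mul_rev, antipode_mul_rev, trL_mul_comm]

/-- The element `1₍₁₎ τ(1₍₂₎)`, where `τ` is the trace of the left regular representation. -/
noncomputable def traceElt (L : Type u) [Ring L] [Algebra ℂ L] [WeakHopfAlgebra L] : L :=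
  TensorProduct.rid ℂ L ((trL L).lTensor L (comul (R := ℂ) (1 : L)))

lemma traceElt_mem : traceElt L ∈ subR L := slice_mem_subR _

/-- On A_R the maps S and Π^L agree, so the right trace of x is the left trace of Π^L(x) = ε(1₍₁₎ x)
1₍₂₎. -/
lemma counit_traceElt_mul {x : L} (hx : x ∈ subR L) :
    counit (R := ℂ) (traceElt L * x) = trR L x := by
  have r := Coalgebra.Repr.arbitrary ℂ (1 : L)
  rw [← trL_antipode, ← counitalL_of_mem_subR hx, counitalL_eq r, traceElt, sum_repr_eq r]
  simp [Finset.sum_mul, mul_comm]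

lemma mul_self_comul_one : star (comul (R := ℂ) (1 : L)) * comul (R := ℂ) (1 : L) =
    comul (R := ℂ) (1 : L) := by
  rw [← ComulStar.comul_star, star_one, ← WeakHopfAlgebra.comul_mul, one_mul]

variable (hL : IsCStarLike L)
include hL

lemma IsCStarLike.isFaithfulPos_trL : IsFaithfulPos (trL L) :=
  ⟨fun x => (hL.trL_nonneg x).1, fun x => (hL.trL_nonneg x).2⟩

/-- Write Δ(1) = ∑ xᵢ ⊗ uᵢ with u orthonormal for the trace. Since Δ(1) = Δ(1)*Δ(1), the trace of
the second leg is ∑ xᵢ* xᵢ. -/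
lemma IsCStarLike.isPos_traceElt : IsPos (traceElt L) := by
  obtain ⟨n, u, hu, hu'⟩ := hL.isFaithfulPos_trL.exists_dual_basis
  obtain ⟨x, hx⟩ : ∃ x : Fin n → L, comul (R := ℂ) (1 : L) = ∑ i, x i ⊗ₜ[ℂ] u i := by
    have r := Coalgebra.Repr.arbitrary ℂ (1 : L)
    refine ⟨fun i => ∑ j ∈ r.index, u.repr (r.right j) i • r.left j, ?_⟩
    simp only [TensorProduct.sum_tmul, TensorProduct.smul_tmul]
    rw [Finset.sum_comm, sum_repr_eq r]
    refine Finset.sum_congr rfl fun j _ => ?_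
    rw [← TensorProduct.tmul_sum, u.sum_repr]
  have h : traceElt L = ∑ i, star (x i) * x i := by
    rw [traceElt, ← mul_self_comul_one, hx]
    simp [Finset.sum_mul_sum, star_sum, TensorProduct.star_tmul, hu', ite_smul]
  rw [h]
  exact hL.isPos_sum _ _ fun i => ⟨_, rfl⟩

/-- The trace element is invertible. -/
lemma IsCStarLike.exists_traceElt_inv :
    ∃ t' ∈ subR L, traceElt L * t' = 1 ∧ t' * traceElt L = 1 := by
  refine exists_inverse_mem one_mem_subR (fun x hx y hy => mul_mem_subR hx hy) traceElt_mem
    fun y hy h => ?_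
  -- If t y = 0, then the trace of y y* is ε(t y y*) = 0, and faithfulness of the trace gives y = 0.
  have h1 := counit_traceElt_mul (mul_mem_subR hy (star_mem_subR hy))
  rw [← mul_assoc, h, zero_mul, map_zero] at h1
  have h2 := (hL.trR_nonneg (star y)).2 (by rw [star_star, ← h1])
  rw [← star_star y, h2, star_zero]

/-- On A_R one has ε(x) = tr(t⁻¹ x). With t⁻¹ = y*y this makes ε(b*b) the trace of (y b*)*(y b*). -/
lemma IsCStarLike.counit_nonneg {b : L} (hb : b ∈ subR L) :
    0 ≤ counit (R := ℂ) (star b * b) ∧ (counit (R := ℂ) (star b * b) = 0 → b = 0) := by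
  obtain ⟨t', ht', h1, h2⟩ := hL.exists_traceElt_inv
  obtain ⟨y, hy⟩ := hL.isPos_traceElt.inv h1 h2
  have h3 : counit (R := ℂ) (star b * b) = trR L (star (y * star b) * (y * star b)) := by
    rw [star_mul, star_star, mul_assoc, ← mul_assoc (star y), ← hy, trR_mul_comm, mul_assoc,
      ← counit_traceElt_mul (mul_mem_subR ht' (mul_mem_subR (star_mem_subR hb) hb)), ← mul_assoc,
      h1, one_mul]
  rw [h3]
  refine ⟨(hL.trR_nonneg _).1, fun h => ?_⟩
  have h4 := (hL.trR_nonneg _).2 h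
  have h5 : star b = 0 := by
    rw [← one_mul (star b), ← h1, mul_assoc, hy, mul_assoc, h4, mul_zero, mul_zero]
  rw [← star_star b, h5, star_zero]

lemma IsCStarLike.eq_zero_of_counit {b : L} (hb : b ∈ subR L)
    (h : ∀ c ∈ subR L, counit (R := ℂ) (c * b) = 0) : b = 0 :=
  (hL.counit_nonneg hb).2 (h _ (star_mem_subR hb))

/-- The square of the antipode is inner on `A_R`. -/
lemma IsCStarLike.antipode_antipode {t' : L} (ht' : t' ∈ subR L) (h1 : traceElt L * t' = 1)
    (h2 : t' * traceElt L = 1) {b : L} (hb : b ∈ subR L) :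
    antipode (antipode b) = traceElt L * b * t' := by
  -- The modular automorphism of ε on A_R is S² by `counit_mul_comm_subR`, and conjugation by t by
  -- this weighted-trace formula; ε being faithful, the two coincide.
  have hm : ∀ x ∈ subR L, counit (R := ℂ) x = trR L (t' * x) := fun x hx => by
    rw [← counit_traceElt_mul (mul_mem_subR ht' hx), ← mul_assoc, h1, one_mul]
  have ht := traceElt_mem (L := L)
  have hS := antipode_mem_subR (antipode_mem_subL hb)
  have hT := mul_mem_subR (mul_mem_subR ht hb) ht'
  rw [← sub_eq_zero]
  have h0 := sub_mem hS hT
  have h3 : ∀ c ∈ subR L,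
      counit (R := ℂ) ((antipode (antipode b) - traceElt L * b * t') * c) = 0 := by
    intro c hc
    rw [sub_mul, map_sub, ← counit_mul_comm_subR hc hb, hm _ (mul_mem_subR hc hb),
      hm _ (mul_mem_subR hT hc),
      show t' * (traceElt L * b * t' * c) = (t' * traceElt L) * b * (t' * c)
        by simp only [mul_assoc], h2, one_mul, trR_mul_comm b, mul_assoc, sub_self]
  have h4 := (hL.counit_nonneg (star_mem_subR h0)).2
  rw [star_star] at h4
  rw [← star_star (_ - _), h4 (h3 _ (star_mem_subR h0)), star_zero]

end TraceElement

/-! ### Slices of the coproduct. -/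

section Slices

variable {H : Type u} [Ring H] [Algebra ℂ H] [WeakHopfAlgebra H]

/-- The map `x ↦ x₍₁₎ f(x₍₂₎)`. -/
noncomputable abbrev slice (f : H →ₗ[ℂ] ℂ) : H →ₗ[ℂ] H :=
  leftAct (LinearMap.id (R := ℂ) (M := H →ₗ[ℂ] ℂ)) f

/-- The map `x ↦ g(x₍₁₎) x₍₂₎`. -/
noncomputable def sliceL (g : H →ₗ[ℂ] ℂ) : H →ₗ[ℂ] H :=
  (TensorProduct.lid ℂ H).toLinearMap ∘ₗ g.rTensor H ∘ₗ comul

lemma slice_repr (f : H →ₗ[ℂ] ℂ) {x : H} (r : Coalgebra.Repr ℂ x (H × H)) :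
    slice f x = ∑ i ∈ r.index, f (r.right i) • r.left i := leftAct_repr _ f r

lemma sliceL_repr (g : H →ₗ[ℂ] ℂ) {x : H} (r : Coalgebra.Repr ℂ x (H × H)) :
    sliceL g x = ∑ i ∈ r.index, g (r.left i) • r.right i := by
  simp [sliceL, sum_repr_eq r]

lemma apply_slice (f g : H →ₗ[ℂ] ℂ) (x : H) : g (slice f x) = conv g f x := by
  have r := Coalgebra.Repr.arbitrary ℂ x
  rw [slice_repr f r, conv_repr g f r, map_sum]
  simp [mul_comm]

lemma apply_sliceL (f g : H →ₗ[ℂ] ℂ) (x : H) : f (sliceL g x) = conv g f x := by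
  have r := Coalgebra.Repr.arbitrary ℂ x
  rw [sliceL_repr g r, conv_repr g f r, map_sum]
  simp

lemma counit_slice (f : H →ₗ[ℂ] ℂ) (x : H) : counit (R := ℂ) (slice f x) = f x := by
  have r := Coalgebra.Repr.arbitrary ℂ x
  rw [apply_slice, conv_repr _ _ r, Hat.sum_counit_mul f r]

lemma slice_counit (x : H) : slice (counit (R := ℂ)) x = x := leftAct_one x

lemma slice_subL_mul (f : H →ₗ[ℂ] ℂ) {c : H} (hc : c ∈ subL H) (x : H) :
    slice f (c * x) = c * slice f x := by
  have r := Coalgebra.Repr.arbitrary ℂ x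
  rw [slice_repr f r]
  simp [slice, leftAct, comul_mul_of_mem_subL' hc, sum_repr_eq r, Finset.mul_sum]

lemma slice_mul_subL (f : H →ₗ[ℂ] ℂ) {c : H} (hc : c ∈ subL H) (x : H) :
    slice f (x * c) = slice f x * c := by
  have r := Coalgebra.Repr.arbitrary ℂ x
  rw [slice_repr f r]
  simp [slice, leftAct, comul_mul_of_mem_subL hc, sum_repr_eq r, Finset.sum_mul]

lemma slice_subR_mul (f : H →ₗ[ℂ] ℂ) {b : H} (hb : b ∈ subR H) (x : H) :
    slice f (b * x) = slice (f ∘ₗ LinearMap.mulLeft ℂ b) x := by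
  have r := Coalgebra.Repr.arbitrary ℂ x
  rw [slice_repr _ r]
  simp [slice, leftAct, comul_mul_of_mem_subR' hb, sum_repr_eq r, Finset.mul_sum]

lemma slice_mul_subR (f : H →ₗ[ℂ] ℂ) {b : H} (hb : b ∈ subR H) (x : H) :
    slice f (x * b) = slice (f ∘ₗ LinearMap.mulRight ℂ b) x := by
  have r := Coalgebra.Repr.arbitrary ℂ x
  rw [slice_repr _ r]
  simp [slice, leftAct, comul_mul_of_mem_subR hb, sum_repr_eq r, Finset.sum_mul]

lemma IsLeftIntegral.slice_mulLeft {l : H} (hl : IsLeftIntegral l) (f : H →ₗ[ℂ] ℂ) (a : H) :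
    slice (f ∘ₗ LinearMap.mulLeft ℂ a) l = antipode a * slice f l := by
  have r := Coalgebra.Repr.arbitrary ℂ l
  have h := congrArg (fun t => TensorProduct.rid ℂ H (f.lTensor H t)) (hl.tmul_mul_comul a)
  simp only [sum_repr_eq r, Finset.mul_sum, map_sum, Algebra.TensorProduct.tmul_mul_tmul, one_mul,
    LinearMap.lTensor_tmul, TensorProduct.rid_tmul] at h
  rw [slice_repr _ r, slice_repr _ r, Finset.mul_sum]
  simpa using h

lemma IsLeftIntegral.mul {l : H} (hl : IsLeftIntegral l) (a : H) : IsLeftIntegral (l * a) := by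
  intro b
  rw [← mul_assoc, hl b, mul_assoc]

end Slices

/-! ### The identification b ↦ b ⇀ 1 of A_R with Â_R. -/

section Pairing

variable {K : Type u} [Ring K] [StarRing K] [Algebra ℂ K] [StarModule ℂ K] [WeakHopfAlgebra K]
  {L : Type u} [Ring L] [StarRing L] [Algebra ℂ L] [StarModule ℂ L] [WeakHopfAlgebra L]
  {p : K →ₗ[ℂ] L →ₗ[ℂ] ℂ} (hp : IsDualPairing p)

lemma leftAct_eq_slice (p : K →ₗ[ℂ] L →ₗ[ℂ] ℂ) (φ : K) (x : L) :
    leftAct p φ x = slice (p φ) x := rfl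

namespace IsDualPairing

include hp

lemma ext_left {φ ψ : K} (h : ∀ a, p φ a = p ψ a) : φ = ψ := hp.injective (LinearMap.ext h)

lemma ext_right {a b : L} (h : ∀ φ, p φ a = p φ b) : a = b := hp.injective_flip (LinearMap.ext h)

lemma apply_leftAct (φ ψ : K) (a : L) : p φ (leftAct p ψ a) = p (φ * ψ) a := by
  rw [leftAct_eq_slice, apply_slice, hp.mul_left]

lemma apply_leftAct_flip (φ : K) (a b : L) : p (leftAct p.flip a φ) b = p φ (b * a) :=
  hp.flip.apply_leftAct b a φ

lemma leftAct_mul (φ ψ : K) (a : L) : leftAct p (φ * ψ) a = leftAct p φ (leftAct p ψ a) :=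
  hp.ext_right fun χ => by simp only [hp.apply_leftAct, mul_assoc]

lemma leftAct_counitalL_one (φ : K) : leftAct p (WeakHopf.counitalL φ) 1 = leftAct p φ 1 :=
  hp.ext_right fun χ => by
    rw [hp.apply_leftAct, hp.apply_leftAct, hp.one_right, hp.one_right, counit_mul_counitalL]

lemma counitalL_leftAct {lam : K} (h : IsLeftIntegral lam) (a : L) :
    WeakHopf.counitalL (leftAct p lam a) = leftAct p lam a :=
  hp.ext_right fun χ => by
    rw [← hp.counitalL, hp.apply_leftAct, hp.apply_leftAct, ← h]

/-- The functional `x ↦ ε(x b)` is the element `b ⇀ 1` of the dual. -/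
lemma apply_leftAct_flip_one (b x : L) : p (leftAct p.flip b 1) x = counit (R := ℂ) (x * b) := by
  rw [hp.apply_leftAct_flip, hp.one_left]

lemma leftAct_flip_one_mem (b : L) : leftAct p.flip b 1 ∈ subR K := slice_mem_subR _

/-- Factors from A_R can be moved across the pairing: right multiplication by b ⇀ 1 is translation
of the argument by b. Here Δ(xb) = Δ(x)(1 ⊗ b) is used. -/
lemma mul_leftAct_flip_one {b : L} (hb : b ∈ subR L) (φ : K) (x : L) :
    p (φ * leftAct p.flip b 1) x = p φ (x * b) := by
  rw [← hp.apply_leftAct]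
  congr 1
  have h := slice_mul_subR (counit (R := ℂ)) hb x
  rw [leftAct_eq_slice]
  refine Eq.trans ?_ (h.symm.trans ?_)
  · congr 2
    ext y
    exact hp.apply_leftAct_flip_one b y
  · exact slice_counit _

lemma leftAct_flip_one_mul {b : L} (hb : b ∈ subR L) (φ : K) (x : L) :
    p (leftAct p.flip b 1 * φ) x = p φ (x * WeakHopfAlgebra.antipode b) := by
  rw [hp.mul_left, ← conv_counit_mulRight_id hb]
  congr 2
  ext y
  exact hp.apply_leftAct_flip_one b y

lemma leftAct_flip_one_mul_leftAct_flip_one (a : L) {b : L} (hb : b ∈ subR L) :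
    leftAct p.flip a 1 * leftAct p.flip b 1 = leftAct p.flip (b * a) 1 :=
  hp.ext_left fun x => by
    rw [hp.mul_leftAct_flip_one hb, hp.apply_leftAct_flip_one, hp.apply_leftAct_flip_one, mul_assoc]

variable [Module.Finite ℂ K] [Module.Finite ℂ L]

lemma finrank_eq : Module.finrank ℂ K = Module.finrank ℂ L := by
  have h1 := LinearMap.finrank_le_finrank_of_injective hp.injective
  have h2 := LinearMap.finrank_le_finrank_of_injective hp.injective_flip
  have h3 : Module.finrank ℂ (L →ₗ[ℂ] ℂ) = Module.finrank ℂ L := Subspace.dual_finrank_eq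
  have h4 : Module.finrank ℂ (K →ₗ[ℂ] ℂ) = Module.finrank ℂ K := Subspace.dual_finrank_eq
  omega

lemma surjective_of_injective {T : K →ₗ[ℂ] L} (h : ∀ φ, T φ = 0 → φ = 0) :
    Function.Surjective T :=
  (LinearMap.injective_iff_surjective_of_finrank_eq_finrank hp.finrank_eq).1
    ((injective_iff_map_eq_zero T).2 h)

lemma surjective : Function.Surjective p :=
  (LinearMap.injective_iff_surjective_of_finrank_eq_finrank
    (hp.finrank_eq.trans Subspace.dual_finrank_eq.symm)).1 hp.injective

/-- An arbitrary b may be replaced by n_R(b) in A_R, since ε(· b) = ε(· n_R(b)). -/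
lemma exists_of_mem_subR {χ : K} (hχ : χ ∈ subR K) :
    ∃ b ∈ subR L, χ = leftAct p.flip b 1 := by
  have h : ∀ f : K →ₗ[ℂ] ℂ, ∃ b ∈ subR L,
      TensorProduct.rid ℂ K (f.lTensor K (comul (R := ℂ) (1 : K))) = leftAct p.flip b 1 := by
    intro f
    obtain ⟨b, rfl⟩ := hp.flip.surjective f
    refine ⟨nR b, nR_mem b, hp.ext_left fun x => ?_⟩
    rw [hp.apply_leftAct_flip_one, counit_mul_nR, ← hp.apply_leftAct_flip_one]
    rfl
  induction hχ using Submodule.span_induction with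
  | mem x hx =>
    obtain ⟨f, rfl⟩ := hx
    exact h f
  | zero => exact ⟨0, zero_mem _, by simp [leftAct]⟩
  | add x y _ _ hx hy =>
    obtain ⟨b, hb, rfl⟩ := hx
    obtain ⟨c, hc, rfl⟩ := hy
    exact ⟨b + c, add_mem hb hc, by simp [leftAct]⟩
  | smul c x _ hx =>
    obtain ⟨b, hb, rfl⟩ := hx
    exact ⟨c • b, Submodule.smul_mem _ _ hb, by simp [leftAct]⟩

-- The involution of Â involves S, and moving the factor back to the right of the argument costs a
-- second S; the resulting S² is conjugation by t.
omit [Module.Finite ℂ K] in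
lemma star_leftAct_flip_one [ComulStar L] (hL : IsCStarLike L) {t' : L} (ht' : t' ∈ subR L)
    (h1 : traceElt L * t' = 1) (h2 : t' * traceElt L = 1) {b : L} (hb : b ∈ subR L) :
    star (leftAct p.flip b 1) = leftAct p.flip (t' * star b * traceElt L) 1 :=
  hp.ext_left fun x => by
    have ht := traceElt_mem (L := L)
    have hc := mul_mem_subR (mul_mem_subR ht' (star_mem_subR hb)) ht
    have h3 := hL.antipode_antipode ht' h1 h2 hc
    rw [show traceElt L * (t' * star b * traceElt L) * t' =
      (traceElt L * t') * star b * (traceElt L * t') by simp only [mul_assoc], h1, one_mul,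
      mul_one] at h3
    rw [hp.star_left, hp.apply_leftAct_flip_one, hp.apply_leftAct_flip_one, ← counit_star,
      star_mul, star_star]
    conv_lhs => rw [← h3, ← antipode_mul_rev, counit_antipode, ← counit_mul_subR hc]

end IsDualPairing

end Pairing

/-- Nondegenerate positive functionals are faithful. -/
lemma isFaithfulPos_of_nondegenerate {B : Type u} [Ring B] [StarRing B] [Algebra ℂ B]
    [StarModule ℂ B] {ω : B →ₗ[ℂ] ℂ} (h0 : ∀ x, 0 ≤ ω (star x * x))
    (h : ∀ y, (∀ x, ω (x * y) = 0) → y = 0) : IsFaithfulPos ω := by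
  refine ⟨h0, fun y hy => h y fun x => ?_⟩
  let c : PreInnerProductSpace.Core ℂ B :=
    { inner := fun x y => ω (star x * y)
      conj_inner_symm := fun x y => by
        have := apply_star_mul_eq_star (R := ⊤) (ω := ω) (d := 1)
          (fun b _ => by simpa using h0 b) (Submodule.mem_top (x := x))
          (Submodule.mem_top (x := y))
        simpa using this.symm
      re_inner_nonneg := fun x => (Complex.nonneg_iff.1 (h0 x)).1
      add_left := fun x y z => by simp [add_mul]
      smul_left := fun x y r => by simp }
  -- Cauchy–Schwarz: a null vector of the form is orthogonal to everything.
  have h1 := InnerProductSpace.Core.inner_mul_inner_self_le (c := c) (star x) y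
  have h2 : ω (star (star x) * y) = star (ω (star y * star x)) := (c.conj_inner_symm _ _).symm
  have h3 : ‖ω (star (star x) * y)‖ * ‖ω (star y * star x)‖ ≤
    (ω (star (star x) * star x)).re * (ω (star y * y)).re := h1
  rw [hy, Complex.zero_re, mul_zero, h2, norm_star] at h3
  rw [← star_star x, h2, norm_eq_zero.1 (mul_self_eq_zero.1 (le_antisymm h3 (by positivity))),
    star_zero]

/-! ### The Haar integral, and the normal form l = h s². -/

section Haar

variable {L : Type u} [Ring L] [StarRing L] [Algebra ℂ L] [StarModule ℂ L] [WeakHopfAlgebra L]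
  [ComulStar L] [Module.Finite ℂ L]

lemma IsLeftIntegral.antipode {h : L} (hh : IsLeftIntegral h) :
    IsRightIntegral (antipode h) := by
  intro a
  rw [← antipode_antipodeInv a, ← antipode_mul_rev, hh, antipode_mul_rev, counitalR_antipode]

/-- Evaluating S(h) h in two ways, with S(h) a right and h a left integral, gives S(h) = h; so h is
two-sided and Π^L(h) = S(Π^R(h)) = 1. -/
lemma IsLeftIntegral.isHaar {h : L} (hh : IsLeftIntegral h) (h1 : counitalR h = 1) :
    IsHaar h := by
  have h2 := hh.antipode h
  rw [h1, mul_one, hh, counitalL_antipode, h1, antipode_one, one_mul] at h2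
  refine ⟨hh, h2 ▸ hh.antipode, ?_, h1⟩
  rw [h2, counitalL_antipode, h1, antipode_one]

lemma IsHaar.haar_eq {h : L} (hh : IsHaar h) : haar L = h := by
  have H : ∃ h : L, IsHaar h := ⟨h, hh⟩
  rw [haar, dif_pos H]
  exact H.choose_spec.unique hh

lemma IsHaar.antipode_eq {h : L} (hh : IsHaar h) : WeakHopfAlgebra.antipode h = h := by
  have h2 := hh.left.antipode h
  rw [hh.counitalR_eq_one, mul_one, hh.left, counitalL_antipode, hh.counitalR_eq_one, antipode_one,
    one_mul] at h2
  exact h2.symm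

/-- The adjoint h* is again a left integral, because a h* = n_R(a) h* = S(n_R(a)) h* = Π^L(a) h*,
and it is normalized; Haar integrals are unique. -/
lemma IsHaar.star_eq {h : L} (hh : IsHaar h) : star h = h := by
  have hb : ∀ b ∈ subR L, b * star h = WeakHopfAlgebra.antipode b * star h := by
    intro b hb
    have h1 := hh.right.mul_subL (antipodeInv_mem_subL (star_mem_subR hb))
    rw [antipode_antipodeInv, antipodeInv_apply, star_star] at h1
    have h2 := congrArg star h1
    rw [star_mul, star_mul, star_star, star_star] at h2
    exact h2.symm
  have hn : ∀ a, a * star h = nR a * star h := by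
    intro a
    have h1 := congrArg star (hh.right (star a))
    rwa [star_mul, star_mul, star_star, star_counitalR] at h1
  have h1 : IsLeftIntegral (star h) := fun a => by
    rw [hn, hb _ (nR_mem a), antipode_nR]
  refine (h1.isHaar ?_).unique hh
  have h2 := star_counitalR h
  have h3 : nR h = 1 := antipode_injective (by rw [antipode_nR, hh.counitalL_eq_one, antipode_one])
  rw [h3] at h2
  rw [← star_star (counitalR _), h2, star_one]

/-- The Haar integral `h` and the square root `s` (with inverse `s'`) of the Radon–Nikodym
derivative of a left integral `l = h s²`. -/
structure IsRootDatum (l h s s' : L) : Prop where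
  mem : s ∈ subR L
  mem' : s' ∈ subR L
  isPos : IsPos s
  mul_inv : s * s' = 1
  inv_mul : s' * s = 1
  haar : IsHaar h
  eq : l = h * (s * s)
  jones_eq : jones l = s * h * s

namespace IsRootDatum

variable {l h s s' : L} (D : IsRootDatum l h s s')
include D

lemma isPos' : IsPos s' := D.isPos.inv D.mul_inv D.inv_mul

lemma isLeftIntegral : IsLeftIntegral l := D.eq ▸ D.haar.left.mul _

lemma antipode_mul_inv : antipode s * antipode s' = 1 := by
  rw [← antipode_mul_rev, D.inv_mul, antipode_one]

lemma antipode_inv_mul : antipode s' * antipode s = 1 := by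
  rw [← antipode_mul_rev, D.mul_inv, antipode_one]

lemma mul_inv_eq : l * s' = h * s := by
  rw [D.eq, mul_assoc, mul_assoc s, D.mul_inv, mul_one]

lemma jones_eq_mul_mul : jones l = s * l * s' := by
  rw [D.jones_eq, mul_assoc, mul_assoc, D.mul_inv_eq]

lemma jones_eq_antipode : jones l = antipode s * h * s := by
  rw [D.jones_eq, D.haar.left.subR_mul D.mem]

lemma jones_eq_antipode_mul : jones l = antipode s * (l * s') := by
  rw [D.jones_eq_antipode, mul_assoc, D.mul_inv_eq]

lemma star_jones : star (jones l) = jones l := by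
  simp only [D.jones_eq, star_mul, D.isPos.star_eq, D.haar.star_eq, mul_assoc]

/-- Reduces slices of e_l to slices of l, through e_l = S(s) l s⁻¹ with S(s) in A_L acting on the
first leg and s⁻¹ in A_R on the second. -/
lemma slice_jones (f : L →ₗ[ℂ] ℂ) :
    slice f (jones l) = antipode s * slice (f ∘ₗ LinearMap.mulRight ℂ s') l := by
  rw [D.jones_eq_antipode_mul, slice_subL_mul _ (antipode_mem_subL D.mem),
    slice_mul_subR _ D.mem']

lemma slice_mulLeft_jones (f : L →ₗ[ℂ] ℂ) (x : L) : slice (f ∘ₗ LinearMap.mulLeft ℂ x) (jones l) =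
    antipode s * antipode x * antipode s' * slice f (jones l) := by
  rw [D.slice_jones, D.slice_jones, LinearMap.comp_assoc, show LinearMap.mulLeft ℂ x ∘ₗ
    LinearMap.mulRight ℂ s' = LinearMap.mulRight ℂ s' ∘ₗ LinearMap.mulLeft ℂ x by
      ext; simp [mul_assoc], ← LinearMap.comp_assoc, D.isLeftIntegral.slice_mulLeft]
  simp only [← mul_assoc]
  rw [mul_assoc _ (WeakHopfAlgebra.antipode s') (WeakHopfAlgebra.antipode s), D.antipode_inv_mul,
    mul_one]

lemma conv_jones (f g : L →ₗ[ℂ] ℂ) : conv f g (jones l) =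
    conv f (g ∘ₗ LinearMap.mulRight ℂ s' ∘ₗ LinearMap.mulLeft ℂ s) l := by
  rw [D.jones_eq_mul_mul, conv_mul_of_mem_subR' _ _ D.mem', conv_mul_of_mem_subR _ _ D.mem,
    LinearMap.comp_assoc]

end IsRootDatum

end Haar

/-! ### Existence of root data and of the p-dual. -/

section PDual

variable {K : Type u} [Ring K] [StarRing K] [Algebra ℂ K] [StarModule ℂ K] [WeakHopfAlgebra K]
  [Module.Finite ℂ K]
  {L : Type u} [Ring L] [StarRing L] [Algebra ℂ L] [StarModule ℂ L] [WeakHopfAlgebra L]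
  [ComulStar L] [Module.Finite ℂ L]
  {p : K →ₗ[ℂ] L →ₗ[ℂ] ℂ} (hp : IsDualPairing p)

lemma IsPosNondegLeftIntegral.isFaithfulPos {l : L} (hl : IsPosNondegLeftIntegral p l) :
    IsFaithfulPos (p.flip l) :=
  isFaithfulPos_of_nondegenerate hl.pos hl.nondeg_right

namespace IsDualPairing

include hp

/-- The positivity of a left integral, in terms of its Radon–Nikodym derivative. -/
lemma apply_star_mul_self (hL : IsCStarLike L) (l : L) {b : L} (hb : b ∈ subR L) :
    p (star (leftAct p.flip b 1) * leftAct p.flip b 1) l =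
      counit (R := ℂ) (star b * WeakHopf.counitalR l * b) := by
  obtain ⟨t', ht', h1, h2⟩ := hL.exists_traceElt_inv
  have ht := traceElt_mem (L := L)
  have hb' := star_mem_subR hb
  have hc := mul_mem_subR (mul_mem_subR ht' hb') ht
  have hd := counitalR_mem l
  have h3 := hL.antipode_antipode ht' h1 h2 hc
  rw [show traceElt L * (t' * star b * traceElt L) * t' =
    (traceElt L * t') * star b * (traceElt L * t') by simp only [mul_assoc], h1, one_mul,
    mul_one] at h3
  rw [hp.star_leftAct_flip_one hL ht' h1 h2 hb, hp.leftAct_flip_one_mul_leftAct_flip_one _ hb,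
    hp.apply_leftAct_flip_one, ← counit_counitalR_mul, ← mul_assoc,
    counit_mul_comm_subR (mul_mem_subR hd hb) hc, h3, mul_assoc]

lemma eq_zero_of_leftAct_flip_one (hL : IsCStarLike L) {b : L} (hb : b ∈ subR L)
    (h : leftAct p.flip b 1 = 0) : b = 0 :=
  hL.eq_zero_of_counit hb fun c _ => by
    rw [← hp.apply_leftAct_flip_one, h, map_zero, LinearMap.zero_apply]

/-- By `apply_star_mul_self`, l restricted to Â_R is the form ε(b* d b) on A_R with d = d_R(l). As ε
is faithful there, d is positive, and faithfulness of l makes it invertible; l d⁻¹ is a left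
integral with Π^R(l d⁻¹) = 1, hence Haar. -/
lemma exists_rootDatum (hL : IsCStarLike L) {l : L} (hl : IsPosNondegLeftIntegral p l) :
    ∃ h s s', IsRootDatum l h s s' := by
  set d := WeakHopf.counitalR l with hd
  have hdR : d ∈ subR L := counitalR_mem l
  have hform : ∀ b ∈ subR L, 0 ≤ counit (R := ℂ) (star b * d * b) := fun b hb => by
    rw [← hp.apply_star_mul_self hL l hb]
    exact hl.pos _
  have hstar : star d = d := by
    have h0 := sub_mem (star_mem_subR hdR) hdR
    rw [← sub_eq_zero]
    refine hL.eq_zero_of_counit h0 fun c hc => ?_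
    have h1 := apply_star_mul_eq_star hform (star_mem_subR hc) one_mem_subR
    rw [star_star, mul_one, star_one, one_mul, ← counit_star, star_mul, star_star] at h1
    rw [mul_sub, map_sub, h1, sub_self]
  have hpos : IsPos d := hL.isPos_of_form one_mem_subR (fun x hx y hy => mul_mem_subR hx hy)
    (counit (R := ℂ)) (fun b hb => (hL.counit_nonneg hb).1) (fun b hb => (hL.counit_nonneg hb).2)
    hdR hstar hform
  obtain ⟨d', hd', h1, h2⟩ := exists_inverse_mem one_mem_subR
    (fun x hx y hy => mul_mem_subR hx hy) hdR fun b hb h => by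
      refine hp.eq_zero_of_leftAct_flip_one hL hb (hl.isFaithfulPos.faithful _ ?_)
      rw [LinearMap.flip_apply, hp.apply_star_mul_self hL l hb, mul_assoc, ← hd, h, mul_zero,
        map_zero]
  obtain ⟨s, hs, s', hs', hsp, hss, h3, h4, -⟩ := hL.exists_sqrt_mem one_mem_subR
    (fun x hx y hy => mul_mem_subR hx hy) hdR hd' hpos h1 h2
  have hh : IsHaar (l * d') := (hl.isLeftIntegral.mul d').isHaar (by
    rw [counitalR_mul_of_mem hd', ← hd, h1])
  refine ⟨l * d', s, s', hs, hs', hsp, h3, h4, hh, ?_, ?_⟩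
  · rw [hss, mul_assoc, h2, mul_one]
  · rw [jones, hh.haar_eq, ← hd, ← hss, hL.posSqrt_eq hsp]

variable {l h s s' : L}

/-- Up to the invertible factor S(s), φ ⇀ e_l is φ(· s⁻¹) ⇀ l, so nondegeneracy of l gives φ(· s⁻¹)
= 0. -/
lemma eq_zero_of_leftAct_jones (hl : IsPosNondegLeftIntegral p l) (D : IsRootDatum l h s s') {φ : K}
    (h0 : leftAct p φ (jones l) = 0) : φ = 0 := by
  rw [leftAct_eq_slice, D.slice_jones] at h0
  have h1 : leftAct p (φ * leftAct p.flip s' 1) l = 0 := by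
    rw [leftAct_eq_slice, show p (φ * leftAct p.flip s' 1) = p φ ∘ₗ LinearMap.mulRight ℂ s' from
      LinearMap.ext fun x => hp.mul_leftAct_flip_one D.mem' φ x,
      ← one_mul (slice _ l), ← D.antipode_inv_mul, mul_assoc, h0, mul_zero]
  have h2 := hl.nondeg_right (φ * leftAct p.flip s' 1) fun ψ => by
    rw [← hp.apply_leftAct, h1, map_zero]
  refine hp.ext_left fun x => ?_
  have h3 := hp.mul_leftAct_flip_one D.mem' φ (x * s)
  rw [mul_assoc, D.mul_inv, mul_one, h2] at h3
  rw [← h3, map_zero, LinearMap.zero_apply, LinearMap.zero_apply]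

/-- The analogue for the other leg of e_l: injectivity of ψ ↦ ψ(e₁) e₂ comes from nondegeneracy in
the left argument, surjectivity from dimension. -/
lemma exists_sliceL_jones (hl : IsPosNondegLeftIntegral p l) (D : IsRootDatum l h s s') (y : L) :
    ∃ ψ : K, y = sliceL (p ψ) (jones l) := by
  let T : K →ₗ[ℂ] L :=
    { toFun := fun ψ => sliceL (p ψ) (jones l)
      map_add' := fun φ ψ => by simp [sliceL]
      map_smul' := fun c φ => by simp [sliceL] }
  obtain ⟨ψ, hψ⟩ := hp.surjective_of_injective (T := T) (fun ψ hψ => by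
    obtain ⟨ψ', h1⟩ := hp.surjective (p ψ ∘ₗ LinearMap.mulLeft ℂ (WeakHopfAlgebra.antipode s))
    have h2 : ∀ f, conv (p ψ) f (jones l) = 0 := fun f => by
      rw [← apply_sliceL]
      exact (congrArg f hψ).trans (map_zero f)
    have h3 : ψ' = 0 := hl.nondeg_left ψ' fun φ => by
      have h4 := h2 (p (φ * leftAct p.flip s 1))
      rw [← apply_slice, D.slice_jones, show p (φ * leftAct p.flip s 1) ∘ₗ
        LinearMap.mulRight ℂ s' = p φ from LinearMap.ext fun x => by
          rw [LinearMap.comp_apply, LinearMap.mulRight_apply, hp.mul_leftAct_flip_one D.mem,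
            mul_assoc, D.inv_mul, mul_one]] at h4
      rw [hp.mul_left, ← apply_slice, h1]
      exact h4
    refine hp.ext_left fun x => ?_
    have h5 := LinearMap.congr_fun h1 (WeakHopfAlgebra.antipode s' * x)
    rw [h3, LinearMap.comp_apply, LinearMap.mulLeft_apply, ← mul_assoc, D.antipode_mul_inv,
      one_mul] at h5
    rw [← h5, map_zero, LinearMap.zero_apply, LinearMap.zero_apply]) y
  exact ⟨ψ, hψ.symm⟩

section Dual

variable {lam : K} (hlam : leftAct p lam (jones l) = 1)
include hlam

lemma slice_mulLeft_jones (D : IsRootDatum l h s s') (x : L) :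
    slice (p lam ∘ₗ LinearMap.mulLeft ℂ x) (jones l) =
      WeakHopfAlgebra.antipode s * WeakHopfAlgebra.antipode x * WeakHopfAlgebra.antipode s' := by
  rw [D.slice_mulLeft_jones, ← leftAct_eq_slice, hlam, mul_one]

/-- This transports positivity from l to λ. For y = ψ(e₁) e₂, λ(y*y) = ψ(e₁) λ(y* e₂) = ψ(S(s) S(y*)
S(s⁻¹)). As e_l is selfadjoint, y* is the slice by the conjugate of ψ, and e_l = s l s⁻¹ cancels the
conjugation by S(s). -/
lemma apply_star_mul_self_sliceL (D : IsRootDatum l h s s') (ψ : K) :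
    p lam (star (sliceL (p ψ) (jones l)) * sliceL (p ψ) (jones l)) =
      p (star (WeakHopfAlgebra.antipode ψ) * WeakHopfAlgebra.antipode ψ) l := by
  have h1 : star (sliceL (p ψ) (jones l)) = sliceL (conjFun (p ψ)) (jones l) := by
    have r := Coalgebra.Repr.arbitrary ℂ (jones l)
    have h2 := sliceL_repr (conjFun (p ψ)) (starRepr r)
    have h3 : sliceL (conjFun (p ψ)) (star (jones l)) = sliceL (conjFun (p ψ)) (jones l) := by
      rw [D.star_jones]
    rw [sliceL_repr _ r, ← h3, h2, star_sum]
    simp [conjFun_apply, starRepr]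
  set y := sliceL (p ψ) (jones l) with hy
  have h2 : p lam (star y * y) = p ψ (WeakHopfAlgebra.antipode s *
      WeakHopfAlgebra.antipode (star y) * WeakHopfAlgebra.antipode s') := by
    rw [← hp.slice_mulLeft_jones hlam D, apply_slice, ← apply_sliceL, ← hy]
    rfl
  let f : L →ₗ[ℂ] ℂ := p ψ ∘ₗ LinearMap.mulRight ℂ (WeakHopfAlgebra.antipode s') ∘ₗ
    LinearMap.mulLeft ℂ (WeakHopfAlgebra.antipode s) ∘ₗ WeakHopfAlgebra.antipode
  have h3 : f (star y) = p lam (star y * y) := h2.symm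
  rw [← h3, h1, apply_sliceL, D.conv_jones, hp.mul_left]
  congr 2
  · ext x
    rw [conjFun_apply, hp.star_left, hp.antipode]
    nth_rw 1 [← star_antipode_star_antipode x]
    rw [star_star]
  · ext x
    simp only [f, LinearMap.comp_apply, LinearMap.mulRight_apply, LinearMap.mulLeft_apply,
      antipode_mul_rev, hp.antipode]
    congr 1
    simp only [← mul_assoc]
    rw [D.antipode_mul_inv, one_mul, mul_assoc, D.antipode_mul_inv, mul_one]

/-- Acting on e_l, φλ gives φ ⇀ 1 and Π^L(φ)λ gives Π^L(φ) ⇀ 1, which are equal; the action on e_l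
is faithful. -/
lemma isLeftIntegral_of_leftAct_jones (hl : IsPosNondegLeftIntegral p l)
    (D : IsRootDatum l h s s') : IsLeftIntegral lam := by
  intro φ
  rw [← sub_eq_zero]
  refine hp.eq_zero_of_leftAct_jones hl D ?_
  rw [map_sub, LinearMap.sub_apply, hp.leftAct_mul, hp.leftAct_mul, hlam,
    hp.leftAct_counitalL_one, sub_self]

lemma isFaithfulPos_of_leftAct_jones (hl : IsPosNondegLeftIntegral p l)
    (D : IsRootDatum l h s s') : IsFaithfulPos (p lam) := by
  refine ⟨fun y => ?_, fun y hy => ?_⟩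
  · obtain ⟨ψ, rfl⟩ := hp.exists_sliceL_jones hl D y
    rw [hp.apply_star_mul_self_sliceL hlam D]
    exact hl.pos _
  · obtain ⟨ψ, rfl⟩ := hp.exists_sliceL_jones hl D y
    rw [hp.apply_star_mul_self_sliceL hlam D] at hy
    have h1 := hl.isFaithfulPos.faithful _ hy
    have h2 : p ψ = 0 := by
      ext x
      rw [← antipode_antipodeInv x, ← hp.antipode, h1, map_zero]
      rfl
    simp [sliceL, h2]

lemma isPosNondegLeftIntegral_of_leftAct_jones (hl : IsPosNondegLeftIntegral p l)
    (D : IsRootDatum l h s s') : IsPosNondegLeftIntegral p.flip lam := by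
  have hf := hp.isFaithfulPos_of_leftAct_jones hlam hl D
  refine ⟨hp.isLeftIntegral_of_leftAct_jones hlam hl D, hf.nonneg, fun x hx => ?_, fun x hx => ?_⟩
  · have h1 := hf.faithful (star x) (by rw [star_star]; exact hx (star x))
    rw [← star_star x, h1, star_zero]
  · exact hf.faithful x (hx (star x))

lemma isPDual_of_leftAct_jones (hl : IsPosNondegLeftIntegral p l)
    (D : IsRootDatum l h s s') : IsPDual p l lam := by
  refine ⟨hp.isPosNondegLeftIntegral_of_leftAct_jones hlam hl D, hlam, fun μ _ hμ => ?_⟩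
  rw [← sub_eq_zero]
  refine hp.eq_zero_of_leftAct_jones hl D ?_
  rw [map_sub, LinearMap.sub_apply, hlam, hμ, sub_self]

end Dual

lemma exists_isPDual (hl : IsPosNondegLeftIntegral p l) (D : IsRootDatum l h s s') :
    ∃ lam : K, IsPDual p l lam := by
  obtain ⟨lam, hlam⟩ := hp.surjective_of_injective (T := (leftAct p).flip (jones l))
    (fun φ hφ => hp.eq_zero_of_leftAct_jones hl D hφ) 1
  exact ⟨lam, hp.isPDual_of_leftAct_jones hlam hl D⟩

end IsDualPairing

end PDual

/-! ### The element ∑ u u* of an orthonormal basis. -/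

section DualBases

variable {B : Type u} [Ring B] [StarRing B] [Algebra ℂ B] [StarModule ℂ B]
  [Module.Finite ℂ B] {ω : B →ₗ[ℂ] ℂ} {n : ℕ} {u : Fin n → B}

lemma IsFaithfulPos.map_star (hω : IsFaithfulPos ω) (x : B) : ω (star x) = star (ω x) := by
  have := hω.conj_symm x 1
  simpa using this

/-- The dual basis property on the other side. -/
lemma IsFaithfulPos.sum_smul (hω : IsFaithfulPos ω)
    (hu : ∀ x, ∑ i, ω (x * u i) • star (u i) = x) (x : B) :
    ∑ i, ω (star (u i) * x) • u i = x := by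
  have h := congrArg star (hu (star x))
  rw [star_star, star_sum] at h
  refine Eq.trans ?_ h
  refine Finset.sum_congr rfl fun i _ => ?_
  rw [star_smul, star_star, ← hω.map_star, star_mul, star_star]

lemma IsFaithfulPos.sum_mul_star_comm (hω : IsFaithfulPos ω)
    (hu : ∀ x, ∑ i, ω (x * u i) • star (u i) = x) (x : B) :
    x * ∑ i, u i * star (u i) = (∑ i, u i * star (u i)) * x := by
  have h1 : ∀ i, x * (u i * star (u i)) = ∑ j, ω (star (u j) * (x * u i)) • (u j * star (u i)) := by
    intro i
    nth_rw 1 [← mul_assoc, ← hω.sum_smul hu (x * u i)]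
    rw [Finset.sum_mul]
    simp
  have h2 : ∀ j, u j * star (u j) * x = ∑ i, ω (star (u j) * (x * u i)) • (u j * star (u i)) := by
    intro j
    nth_rw 1 [mul_assoc, ← hu (star (u j) * x)]
    rw [Finset.mul_sum]
    simp [mul_assoc]
  rw [Finset.mul_sum, Finset.sum_mul, Finset.sum_congr rfl fun i _ => h1 i, Finset.sum_comm,
    Finset.sum_congr rfl fun i _ => h2 i]

/-- If ∑ uᵢ uᵢ* y = 0, pairing with y* gives ∑ ω((uᵢ* y)*(uᵢ* y)) = 0, so every uᵢ* y vanishes; and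
1 is a combination of the uᵢ*. -/
lemma IsFaithfulPos.isUnit_sum_mul_star (hω : IsFaithfulPos ω)
    (hu : ∀ x, ∑ i, ω (x * u i) • star (u i) = x) : IsUnit (∑ i, u i * star (u i)) := by
  refine isUnit_of_mulLeft_injective fun y hy => ?_
  have h1 : ∑ i, ω (star (star (u i) * y) * (star (u i) * y)) = 0 := by
    have h2 := congrArg (fun z => ω (star y * z)) hy
    simp only [mul_zero, map_zero, Finset.sum_mul, Finset.mul_sum, map_sum] at h2
    rw [← h2]
    exact Finset.sum_congr rfl fun i _ => by simp [mul_assoc]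
  have h2 := (Finset.sum_eq_zero_iff_of_nonneg fun i _ => hω.nonneg (star (u i) * y)).1 h1
  rw [← one_mul y, ← hu 1, Finset.sum_mul]
  refine Finset.sum_eq_zero fun i hi => ?_
  rw [smul_mul_assoc, hω.faithful _ (h2 i hi), smul_zero]

end DualBases

/-! ### The index of the p-dual. -/

section Index

variable {K : Type u} [Ring K] [StarRing K] [Algebra ℂ K] [StarModule ℂ K] [WeakHopfAlgebra K]
  [Module.Finite ℂ K]
  {L : Type u} [Ring L] [StarRing L] [Algebra ℂ L] [StarModule ℂ L] [WeakHopfAlgebra L]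
  [ComulStar L] [Module.Finite ℂ L]
  {p : K →ₗ[ℂ] L →ₗ[ℂ] ℂ} (hp : IsDualPairing p)

lemma antipodeInv_mul_rev (x y : L) :
    antipodeInv (x * y) = antipodeInv y * antipodeInv x := by
  simp [antipodeInv_apply, antipode_mul_rev]

/-- `x₍₂₎ S⁻¹(x₍₁₎) = S⁻¹(Π^L(x))`. -/
lemma sum_mul_antipodeInv {x : L} (r : Coalgebra.Repr ℂ x (L × L)) :
    ∑ i ∈ r.index, r.right i * antipodeInv (r.left i) = antipodeInv (counitalL x) := by
  rw [← conv_id_antipode, conv_repr _ _ r, map_sum]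
  simp [antipodeInv_mul_rev, antipodeInv_antipode]

lemma leftAct_star {lam : K} (hf : IsFaithfulPos (p lam)) (x : L) :
    leftAct p lam (star x) = star (leftAct p lam x) := by
  have r := Coalgebra.Repr.arbitrary ℂ x
  rw [leftAct_repr p lam r, leftAct_repr p lam (starRepr r), star_sum]
  refine Finset.sum_congr rfl fun i _ => ?_
  rw [star_smul, ← hf.map_star]
  rfl

namespace IsDualPairing

include hp

/-- `λ ⇀ x = 1₍₂₎ λ(S⁻¹(1₍₁₎) x)` for left integrals `λ`. -/
lemma leftAct_eq_sum {lam : K} (hlam : IsLeftIntegral lam) {r : Coalgebra.Repr ℂ (1 : L) (L × L)}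
    (hr : ∀ i, r.left i ∈ subR L) (x : L) :
    leftAct p lam x = ∑ i ∈ r.index, p lam (antipodeInv (r.left i) * x) • r.right i := by
  rw [← hp.counitalL_leftAct hlam, counitalL_eq r]
  refine Finset.sum_congr rfl fun i _ => ?_
  have hc := antipodeInv_mem_subL (hr i)
  have h1 := counit_subL_mul hc (leftAct p lam x)
  rw [antipode_antipodeInv, leftAct_eq_slice, ← slice_subL_mul _ hc, counit_slice] at h1
  rw [h1]
  rfl

/-- Inserting λ ⇀ x = 1₍₂₎ λ(S⁻¹(1₍₁₎) x), the dual basis property collapses ∑ E(m uᵢ) uᵢ* to 1₍₂₎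
S⁻¹(1₍₁₎) m = m. The other identity is its adjoint, as E commutes with the involution. -/
lemma isQuasiBasis {lam : K} (hlam : IsLeftIntegral lam) (hf : IsFaithfulPos (p lam)) {n : ℕ}
    {u : Fin n → L} (hu : ∀ x, ∑ i, p lam (x * u i) • star (u i) = x) :
    IsQuasiBasis (leftAct p lam) u (fun i => star (u i)) := by
  obtain ⟨r, hr, -⟩ := exists_repr_one (H := L)
  have h1 : ∀ m, ∑ i, leftAct p lam (m * u i) * star (u i) = m := by
    intro m
    simp only [hp.leftAct_eq_sum hlam hr, Finset.sum_mul, smul_mul_assoc]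
    rw [Finset.sum_comm]
    have h2 : ∀ j, ∑ i, p lam (antipodeInv (r.left j) * (m * u i)) • (r.right j * star (u i)) =
        r.right j * antipodeInv (r.left j) * m := by
      intro j
      conv_rhs => rw [mul_assoc, ← hu (antipodeInv (r.left j) * m), Finset.mul_sum]
      simp only [mul_smul_comm, mul_assoc]
    rw [Finset.sum_congr rfl fun j _ => h2 j, ← Finset.sum_mul, sum_mul_antipodeInv,
      counitalL_one, antipodeInv_apply, star_one, antipode_one, star_one, one_mul]
  intro m
  refine ⟨?_, h1 m⟩
  have h2 := congrArg star (h1 (star m))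
  rw [star_star, star_sum] at h2
  refine Eq.trans ?_ h2
  refine Finset.sum_congr rfl fun i _ => ?_
  rw [star_mul, star_star, ← leftAct_star hf, star_mul, star_star]

variable {l h s s' : L} {lam : K} (hlam : leftAct p lam (jones l) = 1)
include hlam

lemma sum_mul_star_eq_nR (hf : IsFaithfulPos (p lam)) (D : IsRootDatum l h s s') {n : ℕ}
    {u : Fin n → L} (hu : ∀ x, ∑ i, p lam (x * u i) • star (u i) = x) :
    ∑ i, u i * star (u i) = nR l := by
  -- The left integral q is chosen so that λ ⇀ q = 1, which holds because λ ⇀ (h s) = S(s⁻¹).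
  -- Moreover Π^L(q) = Π^L(h s²) = Π^L(l).
  let q : L := h * s * WeakHopfAlgebra.antipode s
  have hSs := antipode_mem_subL D.mem
  have hq : IsLeftIntegral q := (D.haar.left.mul _).mul _
  have hq1 : slice (p lam) q = 1 := by
    have h1 : WeakHopfAlgebra.antipode s * slice (p lam) (h * s) = 1 := by
      rw [← slice_subL_mul _ hSs, ← mul_assoc, ← D.jones_eq_antipode]
      exact hlam
    rw [slice_mul_subL _ hSs, ← left_inv_eq_right_inv D.antipode_inv_mul h1, D.antipode_inv_mul]
  have r := Coalgebra.Repr.arbitrary ℂ q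
  -- The left integral identity with λ ⇀ q = 1 reads q₁ λ(x q₂) = S(x): the legs S⁻¹(q₁) and q₂ form
  -- a second dual basis for λ.
  have h1 : ∀ x, ∑ j ∈ r.index, p lam (x * r.right j) • antipodeInv (r.left j) = x := by
    intro x
    have h2 := hq.slice_mulLeft (p lam) x
    rw [hq1, mul_one, slice_repr _ r] at h2
    have h3 := congrArg antipodeInv h2
    rw [antipodeInv_antipode, map_sum] at h3
    simpa using h3
  have h2 : ∀ i, u i * star (u i) = ∑ j ∈ r.index,
      (p lam (star (u i) * r.right j) • u i) * antipodeInv (r.left j) := by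
    intro i
    conv_lhs => rw [← h1 (star (u i)), Finset.mul_sum]
    simp
  rw [Finset.sum_congr rfl fun i _ => h2 i, Finset.sum_comm]
  simp only [← Finset.sum_mul, hf.sum_smul hu]
  rw [sum_mul_antipodeInv]
  apply antipode_injective
  rw [antipode_antipodeInv, antipode_nR, D.eq, ← mul_assoc]
  simp only [q]
  rw [← counitalL_of_mem_subR D.mem, counitalL_mul_counitalL]

/-- The index of the p-dual of a left integral. -/
lemma index_of_leftAct_jones (hL : IsCStarLike L) (hl : IsPosNondegLeftIntegral p l)
    (D : IsRootDatum l h s s') :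
    IndexFiniteType (leftAct p lam) ∧ IsPos (integralIndex p lam) ∧ IsUnit (integralIndex p lam) ∧
      integralIndex p lam = nR l ∧ nR l ∈ Subalgebra.center ℂ L ∧ nR l ∈ subR L := by
  have hf := hp.isFaithfulPos_of_leftAct_jones hlam hl D
  obtain ⟨n, u, hu, -⟩ := hf.exists_dual_basis
  have hq := hp.isQuasiBasis (hp.isLeftIntegral_of_leftAct_jones hlam hl D) hf hu
  have h1 : integralIndex p lam = ∑ i, u i * star (u i) := hq.watataniIndex_eq
  have h2 := hp.sum_mul_star_eq_nR hlam hf D hu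
  refine ⟨⟨n, _, _, hq⟩, ?_, ?_, h1.trans h2, ?_, nR_mem l⟩
  · rw [h1]
    exact hL.isPos_sum _ _ fun i => isPos_mul_star _
  · rw [h1]
    exact hf.isUnit_sum_mul_star hu
  · rw [← h2, Subalgebra.mem_center_iff]
    exact hf.sum_mul_star_comm hu

end IsDualPairing

end Index

/-! ### Biduality. -/

section Biduality

variable {K : Type u} [Ring K] [StarRing K] [Algebra ℂ K] [StarModule ℂ K] [WeakHopfAlgebra K]
  [ComulStar K] [Module.Finite ℂ K]
  {L : Type u} [Ring L] [StarRing L] [Algebra ℂ L] [StarModule ℂ L] [WeakHopfAlgebra L]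
  [ComulStar L] [Module.Finite ℂ L]
  {p : K →ₗ[ℂ] L →ₗ[ℂ] ℂ} (hp : IsDualPairing p)

namespace IsDualPairing

include hp

omit [Module.Finite ℂ L] [ComulStar L] in
/-- The modular property of the Haar functional. -/
lemma haar_apply_antipode_antipode_mul {k : K} (hk : IsHaar k) {b : L} (hb : b ∈ subR L) (x : L) :
    p k (WeakHopfAlgebra.antipode (WeakHopfAlgebra.antipode b) * x) = p k (x * b) := by
  have hb' := antipode_mem_subR (antipode_mem_subL hb)
  -- The square of the antipode of Â undoes S² on A_R. Since k is S-invariant, the factor S²(b)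
  -- turns into an element of Â_L to the right of k, and the right integral property adds the second
  -- antipode.
  have h1 : WeakHopfAlgebra.antipode (WeakHopfAlgebra.antipode (leftAct p.flip
      (WeakHopfAlgebra.antipode (WeakHopfAlgebra.antipode b)) 1)) = leftAct p.flip b 1 :=
    hp.ext_left fun y => by
      rw [hp.antipode, hp.antipode, hp.apply_leftAct_flip_one, hp.apply_leftAct_flip_one,
        ← antipode_mul_rev, ← antipode_mul_rev, ← hp.one_left, ← hp.one_left, ← hp.antipode,
        ← hp.antipode, antipode_one, antipode_one]
  rw [← hk.antipode_eq, hp.antipode, antipode_mul_rev, ← hp.leftAct_flip_one_mul hb', ← hp.antipode,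
    antipode_mul_rev, hk.antipode_eq,
    hk.right.mul_subL (antipode_mem_subL (hp.leftAct_flip_one_mem _)), h1,
    hp.mul_leftAct_flip_one hb]

section HaarSlice

variable {h : L} (hh : IsHaar h) {k : K} (hk : IsHaar k)
include hh hk

-- With `slice_haar_mul_antipode`, this makes y ↦ k ⇀ (h y) equivariant on both sides under A_R, up
-- to powers of S². The left side uses the modular property of k, the right side only that h is a
-- right integral.
omit [ComulStar L] [Module.Finite ℂ L] in
lemma antipode_mul_slice_haar {b : L} (hb : b ∈ subR L) (y : L) :
    WeakHopfAlgebra.antipode (WeakHopfAlgebra.antipode (WeakHopfAlgebra.antipode b)) *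
      slice (p k) (h * y) = slice (p k) (h * (y * b)) := by
  have hb' := antipode_mem_subR (antipode_mem_subL hb)
  rw [← slice_subL_mul _ (antipode_mem_subL hb'), ← mul_assoc, ← hh.left.subR_mul hb', mul_assoc,
    slice_subR_mul _ hb', ← mul_assoc, slice_mul_subR _ hb]
  congr 2
  ext x
  exact hp.haar_apply_antipode_antipode_mul hk hb x

omit hk hp [ComulStar K] [Module.Finite ℂ K] [ComulStar L] [Module.Finite ℂ L] in
lemma slice_haar_mul_antipode {b y : L} (hb : b ∈ subR L) (hy : y ∈ subR L) :
    slice (p k) (h * y) * WeakHopfAlgebra.antipode b =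
      slice (p k) (h * (WeakHopfAlgebra.antipode (WeakHopfAlgebra.antipode b) * y)) := by
  have hb' := antipode_mem_subL hb
  rw [← slice_mul_subL _ hb', mul_assoc, (commute_subL_subR hy hb').eq, ← mul_assoc,
    hh.right.mul_subL hb', mul_assoc]

end HaarSlice

variable {l h s s' : L} {lam k σ σ' : K}

/-- As h = l s⁻², the slice is (k χ) ⇀ l with χ = s⁻² y ⇀ 1. Nondegeneracy of l gives k χ = 0, and
Π^R(k χ) = χ since Π^R(k) = 1. -/
lemma eq_zero_of_slice_haar (hL : IsCStarLike L) (hl : IsPosNondegLeftIntegral p l)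
    (D : IsRootDatum l h s s') (hk : IsHaar k) {y : L} (hy : y ∈ subR L)
    (h0 : slice (p k) (h * y) = 0) : y = 0 := by
  have hs := mul_mem_subR D.mem' D.mem'
  have h1 : h = l * (s' * s') := by
    rw [D.eq, mul_assoc, mul_assoc s, ← mul_assoc s s', D.mul_inv, one_mul, D.mul_inv, mul_one]
  have h2 : leftAct p (k * leftAct p.flip (s' * s' * y) 1) l = 0 := by
    rw [← h0, leftAct_eq_slice, h1, mul_assoc l, slice_mul_subR _ (mul_mem_subR hs hy)]
    congr 2
    ext x
    exact hp.mul_leftAct_flip_one (mul_mem_subR hs hy) k x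
  have h3 := hl.nondeg_right _ fun ψ => by rw [← hp.apply_leftAct, h2, map_zero]
  have h4 := counitalR_mul_of_mem (hp.leftAct_flip_one_mem (s' * s' * y)) k
  rw [h3, map_zero, hk.counitalR_eq_one, one_mul] at h4
  have h5 := hp.eq_zero_of_leftAct_flip_one hL (mul_mem_subR hs hy) h4.symm
  calc y = s * (s * s') * s' * y := by rw [D.mul_inv, mul_one, D.mul_inv, one_mul]
    _ = s * s * (s' * s' * y) := by simp only [mul_assoc]
    _ = 0 := by rw [h5, mul_zero]

/-- The square root of the Radon–Nikodym derivative of the p-dual, as a functional. -/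
lemma exists_dual_root (hL : IsCStarLike L) (hK : IsCStarLike K)
    (hl : IsPosNondegLeftIntegral p l) (D : IsRootDatum l h s s')
    (hlam : leftAct p lam (jones l) = 1) (D' : IsRootDatum lam k σ σ') :
    ∃ r ∈ subR L, σ = leftAct p.flip r 1 ∧ ∀ b ∈ subR L,
      slice (p k) (h * (WeakHopfAlgebra.antipode (WeakHopfAlgebra.antipode r) * b * r)) =
        WeakHopfAlgebra.antipode (s' * b * s') := by
  obtain ⟨t', ht', tt', t't⟩ := hL.exists_traceElt_inv
  have ht := traceElt_mem (L := L)
  have hθ : ∀ b ∈ subR L, WeakHopfAlgebra.antipode (WeakHopfAlgebra.antipode b) =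
    traceElt L * b * t' := fun b hb => hL.antipode_antipode ht' tt' t't hb
  have hstar : ∀ b ∈ subR L, star (leftAct p.flip b 1) =
      leftAct p.flip (t' * star b * traceElt L) 1 :=
    fun b hb => hp.star_leftAct_flip_one hL ht' tt' t't hb
  have htp := hL.isPos_traceElt
  have hm : ∀ x ∈ subR L, ∀ y ∈ subR L, x * y ∈ subR L := fun x hx y hy => mul_mem_subR hx hy
  set t := traceElt L
  obtain ⟨r₀, hr₀, hσ⟩ := hp.exists_of_mem_subR D'.mem
  have hs := D.mem
  have hs' := D.mem'
  have ss' := D.mul_inv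
  have s's := D.inv_mul
  have hr₀' := star_mem_subR hr₀
  have c1 : ∀ x, t * (t' * x) = x := fun x => by rw [← mul_assoc, tt', one_mul]
  have c2 : ∀ x, t' * (t * x) = x := fun x => by rw [← mul_assoc, t't, one_mul]
  have c3 : ∀ x, s * (s' * x) = x := fun x => by rw [← mul_assoc, ss', one_mul]
  have c4 : ∀ x, s' * (s * x) = x := fun x => by rw [← mul_assoc, s's, one_mul]
  -- the Radon–Nikodym derivative of the p-dual
  let ρ := r₀ * (t' * star r₀ * t)
  have hρ : ρ ∈ subR L := hm _ hr₀ _ (hm _ (hm _ ht' _ hr₀') _ ht)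
  have hσσ : σ * σ = leftAct p.flip ρ 1 := by
    nth_rw 1 [← D'.isPos.star_eq]
    rw [hσ, hstar r₀ hr₀, hp.leftAct_flip_one_mul_leftAct_flip_one _ hr₀]
  let G : L → L := fun y => slice (p k) (h * y)
  have G1 : ∀ b ∈ subR L, ∀ y,
      WeakHopfAlgebra.antipode (t * b * t') * G y = G (y * b) := fun b hb y => by
    rw [← hθ b hb]; exact hp.antipode_mul_slice_haar D.haar D'.haar hb y
  have G2 : ∀ b ∈ subR L, ∀ y ∈ subR L, G y * WeakHopfAlgebra.antipode b = G (t * b * t' * y) :=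
    fun b hb y hy => by rw [← hθ b hb]; exact slice_haar_mul_antipode D.haar hb hy
  have G3 : ∀ y ∈ subR L, G y = 0 → y = 0 := fun y hy =>
    hp.eq_zero_of_slice_haar hL hl D D'.haar hy
  -- The defining equation λ ⇀ e_l = 1, rewritten with λ = k σ² and σ² = ρ ⇀ 1.
  have G4 : G (s * ρ) = WeakHopfAlgebra.antipode s' := by
    have h1 : WeakHopfAlgebra.antipode s * slice (p lam) (h * s) = 1 := by
      rw [← slice_subL_mul _ (antipode_mem_subL hs), ← mul_assoc, ← D.jones_eq_antipode]
      exact hlam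
    rw [left_inv_eq_right_inv D.antipode_inv_mul h1]
    simp only [G]
    rw [← mul_assoc, slice_mul_subR _ hρ]
    congr 2
    ext x
    rw [D'.eq, hσσ, hp.mul_leftAct_flip_one hρ]
    rfl
  let y₀ := s * r₀ * t' * (star r₀ * s)
  have hy₀ : y₀ ∈ subR L := hm _ (hm _ (hm _ hs _ hr₀) _ ht') _ (hm _ hr₀' _ hs)
  -- Equals s ρ (t⁻¹ s t), the argument at which G takes the value 1.
  let κ := y₀ * t
  have hκ : κ ∈ subR L := hm _ hy₀ _ ht
  have Gκ : G κ = 1 := by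
    have h1 : κ = s * ρ * (t' * s * t) := by simp only [κ, ρ, y₀, mul_assoc, c1]
    rw [h1, ← G1 _ (hm _ (hm _ ht' _ hs) _ ht), G4]
    simp only [mul_assoc, c1, tt', mul_one]
    exact D.antipode_mul_inv
  have Gκb : ∀ b ∈ subR L, G (κ * b) = WeakHopfAlgebra.antipode (t * b * t') := fun b hb => by
    rw [← G1 b hb κ, Gκ, mul_one]
  -- Because G(κ) = 1, the two equivariance properties express S(t b t⁻¹) as a value of G in two
  -- ways; injectivity of G on A_R compares the arguments. Hence z = t⁻² κ is central in A_R.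
  have hκb : ∀ b ∈ subR L, κ * b = t * (t * b * t') * t' * κ := fun b hb => by
    have hb' := hm _ (hm _ ht _ hb) _ ht'
    have h1 := G2 _ hb' κ hκ
    rw [Gκ, one_mul, ← Gκb b hb] at h1
    have hb'' := hm _ (hm _ (hm _ ht _ hb') _ ht') _ hκ
    rw [← sub_eq_zero]
    refine G3 _ (sub_mem (hm _ hκ _ hb) hb'') ?_
    simp only [G] at h1 ⊢
    rw [mul_sub, map_sub, h1, sub_self]
  let z := t' * (t' * κ)
  have hz : z ∈ subR L := hm _ ht' _ (hm _ ht' _ hκ)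
  have zc : ∀ b ∈ subR L, z * b = b * z := fun b hb => by
    simp only [z, mul_assoc, hκb b hb, c2]
  have hκz : κ = z * (t * t) := by
    rw [zc _ (hm _ ht _ ht)]
    simp only [z, mul_assoc, c1]
  have hy₀z : y₀ = z * t := by
    have h1 : κ * t' = y₀ := by simp only [κ, mul_assoc, tt', mul_one]
    rw [← h1, hκz]
    simp only [mul_assoc, tt', mul_one]
  obtain ⟨z', hz', zz', z'z⟩ := exists_inverse_mem one_mem_subR hm hz fun y hy h0 => by
    have h1 : G (κ * (t' * (t' * y))) = 0 := by
      have h2 : κ * (t' * (t' * y)) = z * y := by simp only [hκz, mul_assoc, c1]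
      rw [h2, h0]
      simp [G]
    rw [Gκb _ (hm _ ht' _ (hm _ ht' _ hy))] at h1
    have h3 := antipode_injective (h1.trans (map_zero _).symm)
    calc y = t * (t * (t' * (t' * y)) * t') * t := by simp only [mul_assoc, c1, t't, mul_one]
      _ = 0 := by rw [h3, mul_zero, zero_mul]
  obtain ⟨v, hv, v', hv', vp, vv, vv', v'v, -⟩ :=
    hL.exists_sqrt_mem one_mem_subR hm ht ht' htp tt' t't
  have c5 : ∀ x, v * (v' * x) = x := fun x => by rw [← mul_assoc, vv', one_mul]
  have c6 : ∀ x, v' * (v * x) = x := fun x => by rw [← mul_assoc, v'v, one_mul]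
  have ht'v : t' = v' * v' := by
    refine left_inv_eq_right_inv t't ?_
    rw [← vv, mul_assoc, c5, vv']
  have v'star := (vp.inv vv' v'v).star_eq
  have zp : IsPos z := by
    -- Centrality splits t⁻¹ symmetrically around y₀ = z t, and y₀ = (s r₀) t⁻¹ (s r₀)*.
    have h1 : z = (v' * (s * r₀) * v') * star (v' * (s * r₀) * v') := by
      have h2 : z = v' * y₀ * v' := by
        rw [hy₀z, ← vv, ← mul_assoc, ← mul_assoc, ← zc v' hv']
        simp only [mul_assoc, c6, vv', mul_one]
      rw [h2]
      simp only [star_mul, v'star, D.isPos.star_eq, y₀, ht'v, mul_assoc]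
    rw [h1]
    exact isPos_mul_star _
  obtain ⟨w, hw, w', hw', wp, ww, ww', w'w, wc⟩ :=
    hL.exists_sqrt_mem one_mem_subR hm hz hz' zp zz' z'z
  obtain ⟨u, hu, u', hu', up, uu, -, -, uc⟩ :=
    hL.exists_sqrt_mem one_mem_subR hm hw hw' wp ww' w'w
  obtain ⟨m, hm', -, -, mp, mm, -⟩ :=
    hL.exists_sqrt_mem one_mem_subR hm hs' hs D.isPos' s's ss'
  replace wc : ∀ b ∈ subR L, w * b = b * w := fun b hb => wc b (zc b hb)
  replace uc : ∀ b ∈ subR L, u * b = b * u := fun b hb => uc b (wc b hb)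
  -- The candidate z^{1/2} s⁻¹ t for the root of d_R(λ); its square is ρ because ρ = z s⁻¹ t s⁻¹ t.
  let r := w * (s' * t)
  have hr : r ∈ subR L := hm _ hw _ (hm _ hs' _ ht)
  -- Here a = z^{1/4} s^{-1/2} t^{1/2}, so that r = a (t⁻¹ a* t); as b ↦ b ⇀ 1 twists the involution
  -- by t, this exhibits r ⇀ 1 as a positive element of Â.
  let a := u * (m * v)
  have ha : a ∈ subR L := hm _ hu _ (hm _ hm' _ hv)
  have har : a * (t' * star a * t) = r := by
    have h1 : a * (t' * star a * t) = u * (m * m) * u * t := by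
      simp only [a, star_mul, up.star_eq, mp.star_eq, vp.star_eq, ht'v, mul_assoc, c5, c6]
    rw [h1, mm, mul_assoc u, ← uc _ hs', ← mul_assoc, uu]
    simp only [r, mul_assoc]
  have hrr : r * r = ρ := by
    have h1 : r * r = z * (s' * t * (s' * t)) := by
      simp only [r]
      rw [mul_assoc, ← mul_assoc (s' * t), ← wc _ (hm _ hs' _ ht), ← ww]
      simp only [mul_assoc]
    have h2 : ρ = s' * y₀ * s' * t := by simp only [ρ, y₀, mul_assoc, c3, c4]
    rw [h1, h2, hy₀z, ← mul_assoc s', ← zc s' hs']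
    simp only [mul_assoc]
  have hσr : σ = leftAct p.flip r 1 := by
    refine hK.eq_of_mul_self_eq D'.isPos ⟨leftAct p.flip a 1, ?_⟩ ?_
    · rw [hstar a ha, hp.leftAct_flip_one_mul_leftAct_flip_one _ ha, har]
    · rw [hσσ, hp.leftAct_flip_one_mul_leftAct_flip_one _ hr, hrr]
  refine ⟨r, hr, hσr, fun b hb => ?_⟩
  have hc := hm _ (hm _ hs' _ hb) _ hs'
  have h1 := Gκb _ (hm _ (hm _ ht' _ hc) _ ht)
  rw [show t * (t' * (s' * b * s') * t) * t' = s' * b * s' by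
    simp only [mul_assoc, c1, tt', mul_one]] at h1
  rw [← h1, hθ r hr]
  simp only [G]
  congr 2
  -- The remaining identity is t r t⁻¹ b r = z t s⁻¹ b s⁻¹ t, with z^{1/2} central.
  rw [hκz]
  have h2 : t * r * t' * b * r = w * (t * s' * b) * w * (s' * t) := by
    simp only [r, mul_assoc, c1]
    rw [← mul_assoc t w, ← wc t ht]
    simp only [mul_assoc]
  rw [h2, mul_assoc w, ← wc _ (hm _ (hm _ ht _ hs') _ hb), ← mul_assoc w, ww]
  simp only [mul_assoc, c1]

/-- The values of `e_λ` on products with the Haar integral. -/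
lemma apply_jones_mul_haar_mul (D : IsRootDatum l h s s') (D' : IsRootDatum lam k σ σ') {r : L}
    (hr : r ∈ subR L) (hσ : σ = leftAct p.flip r 1)
    (H : ∀ b ∈ subR L,
      slice (p k) (h * (WeakHopfAlgebra.antipode (WeakHopfAlgebra.antipode r) * b * r)) =
        WeakHopfAlgebra.antipode (s' * b * s')) {b c : L} (hb : b ∈ subR L) (hc : c ∈ subL L) :
    p (jones lam) (c * (h * b)) =
      counit (R := ℂ) (c * WeakHopfAlgebra.antipode (s' * b * s')) := by
  have hr' := antipode_mem_subL hr
  rw [D'.jones_eq, hσ, hp.mul_leftAct_flip_one hr, hp.leftAct_flip_one_mul hr, ← H b hb,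
    ← slice_subL_mul _ hc, counit_slice]
  congr 1
  simp only [mul_assoc]
  rw [(commute_subL_subR hr hr').eq, ← mul_assoc b, (commute_subL_subR hb hr').eq, mul_assoc,
    ← mul_assoc h, D.haar.right.mul_subL hr', mul_assoc]

lemma exists_apply_jones (hL : IsCStarLike L) (hK : IsCStarLike K)
    (hl : IsPosNondegLeftIntegral p l) (D : IsRootDatum l h s s')
    (hlam : leftAct p lam (jones l) = 1) :
    ∀ b ∈ subR L, ∀ c ∈ subL L, p (jones lam) (c * (h * b)) =
      counit (R := ℂ) (c * WeakHopfAlgebra.antipode (s' * b * s')) := by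
  obtain ⟨k, σ, σ', D'⟩ := hp.flip.exists_rootDatum hK
    (hp.isPosNondegLeftIntegral_of_leftAct_jones hlam hl D)
  obtain ⟨r, hr, hσ, H⟩ := hp.exists_dual_root hL hK hl D hlam D'
  exact fun b hb c hc => hp.apply_jones_mul_haar_mul D D' hr hσ H hb hc

/-- Biduality: `l ⇀ e_λ = 1` for the p-dual `λ` of `l`. -/
lemma leftAct_flip_jones (hL : IsCStarLike L) (hK : IsCStarLike K)
    (hl : IsPosNondegLeftIntegral p l) (D : IsRootDatum l h s s')
    (hlam : leftAct p lam (jones l) = 1) : leftAct p.flip l (jones lam) = 1 :=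
  hp.ext_left fun x => by
    rw [hp.apply_leftAct_flip, D.isLeftIntegral, D.eq, hp.exists_apply_jones hL hK hl D hlam _
      (mul_mem_subR D.mem D.mem) _ (counitalL_mem x), ← mul_assoc, D.inv_mul, one_mul, D.mul_inv,
      antipode_one, mul_one, counit_counitalL, hp.one_left]

/-- Says that e_λ(a ·) = 1̂ for a = S⁻¹(s) S(s) h, which is what e ê e = e requires. As h is a right
integral, x may be replaced by Π^R(x); then the evaluation on c h b applies, and the modular
property of ε on A_L removes s. -/
lemma apply_jones_mul (hL : IsCStarLike L) (hK : IsCStarLike K)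
    (hl : IsPosNondegLeftIntegral p l) (D : IsRootDatum l h s s')
    (hlam : leftAct p lam (jones l) = 1) (x : L) :
    p (jones lam) (antipodeInv s * WeakHopfAlgebra.antipode s * h * x) = counit (R := ℂ) x := by
  have h1 := antipodeInv_mem_subL D.mem
  have h2 := antipode_mem_subL D.mem
  have hx := counitalR_mem x
  rw [mul_assoc _ h, D.haar.right, hp.exists_apply_jones hL hK hl D hlam _ hx _
    (mul_mem_subL h1 h2), mul_assoc, ← antipode_mul_rev, mul_assoc _ s', D.inv_mul, mul_one,
    counit_mul_comm_subL h1 (antipode_mem_subL (mul_mem_subR D.mem' hx)), antipode_antipodeInv,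
    ← antipode_mul_rev, ← mul_assoc, D.mul_inv, one_mul, counit_antipode, counit_counitalR]

end IsDualPairing

end Biduality

/-! ### Multiplicativity in crossed products. -/

namespace CrossedProduct

variable {H : Type u} [Ring H] [Algebra ℂ H] [WeakHopfAlgebra H]
  {M : Type v} [Ring M] [Algebra ℂ M] (α : ModuleAlgebra H M)

/-- Since a₁ ▷ 1 = Π^L(a₁) ▷ 1 with Π^L(a₁) in A_L, this factor crosses the relative tensor product,
and Π^L(a₁) a₂ = a. -/
lemma mk_mul_mk_one (m : M) (a b : H) : mk α m a * mk α 1 b = mk α m (a * b) := by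
  have r := Coalgebra.Repr.arbitrary ℂ a
  have h1 := counitalL_mul_comul a
  simp only [sum_repr_eq r, map_sum, LinearMap.rTensor_tmul, LinearMap.mul'_apply] at h1
  rw [mk_mul_mk α m r]
  simp only [← act_counitalL_one α (r.left _), mk_mul_act α _ _ (counitalL_mem _)]
  conv_rhs => rw [← h1]
  simp only [mk, Finset.sum_mul, mul_assoc, TensorProduct.tmul_sum, map_sum]

lemma mk_one_mul_mk (m n : M) (a : H) : mk α m 1 * mk α n a = mk α (m * n) a := by
  have r := Coalgebra.Repr.arbitrary ℂ (1 : H)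
  have h1 := congrArg (fun t => proj α (TensorProduct.map
    (LinearMap.mulLeft ℂ m ∘ₗ α.act.toLinearMap.flip n)
    (LinearMap.mulRight ℂ a) t)) (counitalL_lTensor_comul_one (H := H))
  have h2 := α.act_mul_repr r n 1
  rw [map_one, Module.End.one_apply, mul_one] at h2
  simp only [sum_repr_eq r, map_sum, LinearMap.lTensor_tmul, TensorProduct.map_tmul,
    LinearMap.mulRight_apply, proj_tmul, LinearMap.flip_apply, AlgHom.toLinearMap_apply,
    LinearMap.comp_apply, LinearMap.mulLeft_apply] at h1
  rw [mk_mul_mk α m r, ← h1]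
  simp only [← mk_mul_act α _ _ (counitalL_mem _), act_counitalL_one]
  conv_rhs => rw [h2]
  simp only [mk, Finset.mul_sum, TensorProduct.sum_tmul, map_sum, mul_assoc]

end CrossedProduct

/-! ### Commutation relations in the iterated crossed product. -/

section Iterated

variable {A : Type u} [Ring A] [Algebra ℂ A] [WeakHopfAlgebra A] [Module.Finite ℂ A]
  {M : Type v} [Ring M] [Algebra ℂ M] (α : ModuleAlgebra A M)

lemma inclA_mul (a b : A) : inclA α (a * b) = inclA α a * inclA α b := by
  rw [inclA, inclA, inclA, CrossedProduct.mk_one_mul_mk, CrossedProduct.mk_mul_mk_one]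

lemma inclHat_mul (φ ψ : Hat A) : inclHat α (φ * ψ) = inclHat α φ * inclHat α ψ :=
  (CrossedProduct.mk_mul_mk_one (dualAction α) _ φ ψ).symm

lemma inclA_one : inclA α 1 = 1 := rfl

lemma inclHat_one : inclHat α 1 = 1 := rfl

/-- `inclA` as a linear map. -/
noncomputable def inclALin : A →ₗ[ℂ] IteratedCrossedProduct α :=
  CrossedProduct.proj (dualAction α) ∘ₗ (TensorProduct.mk ℂ _ _).flip 1 ∘ₗ
    CrossedProduct.proj α ∘ₗ TensorProduct.mk ℂ M A 1

/-- `inclHat` as a linear map. -/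
noncomputable def inclHatLin : Hat A →ₗ[ℂ] IteratedCrossedProduct α :=
  CrossedProduct.proj (dualAction α) ∘ₗ TensorProduct.mk ℂ _ _ (CrossedProduct.mk α 1 1)

/-- The map `φ ⊗ ψ ↦ (φ ⇀ a) ψ`. -/
noncomputable def actTensor (a : A) : Hat A ⊗[ℂ] Hat A →ₗ[ℂ] IteratedCrossedProduct α :=
  LinearMap.mul' ℂ _ ∘ₗ TensorProduct.map (inclALin α ∘ₗ (leftAct (Hat.pairing A)).flip a)
    (inclHatLin α)

lemma actTensor_tmul (a : A) (φ ψ : Hat A) : actTensor α a (φ ⊗ₜ ψ) =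
    inclA α (leftAct (Hat.pairing A) φ a) * inclHat α ψ := rfl

/-- The commutation relation of `Â` and `A` in the iterated crossed product. -/
lemma inclHat_mul_inclA (φ : Hat A) (a : A) :
    inclHat α φ * inclA α a = actTensor α a (comul (R := ℂ) φ) := by
  have r := Coalgebra.Repr.arbitrary ℂ φ
  rw [sum_repr_eq r, map_sum, inclHat, inclA, CrossedProduct.mk_mul_mk _ _ r]
  refine Finset.sum_congr rfl fun i _ => ?_
  rw [actTensor_tmul, inclA, inclHat, CrossedProduct.mk_one_mul_mk, mul_one,
    ← CrossedProduct.one_def, one_mul, mul_one]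
  rfl

lemma actTensor_comul_one (a : A) : actTensor α a (comul (R := ℂ) (1 : Hat A)) = inclA α a := by
  rw [← inclHat_mul_inclA, inclHat_one, one_mul]

lemma actTensor_mul_tmul (a : A) (t : Hat A ⊗[ℂ] Hat A) (φ ψ : Hat A) :
    actTensor α a (t * (φ ⊗ₜ ψ)) =
      actTensor α (leftAct (Hat.pairing A) φ a) t * inclHat α ψ := by
  induction t with
  | zero => simp
  | add x y hx hy => simp only [add_mul, map_add, hx, hy]
  | tmul χ ω =>
    rw [Algebra.TensorProduct.tmul_mul_tmul, actTensor_tmul, actTensor_tmul, inclHat_mul,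
      leftAct_mul, mul_assoc]

/-- For φ in Â_R the coproduct is Δ̂(1̂)(1̂ ⊗ φ), so the action on a is that of the unit. -/
lemma commute_inclHat_inclA_of_mem_subR {φ : Hat A} (hφ : φ ∈ subR (Hat A)) (a : A) :
    inclHat α φ * inclA α a = inclA α a * inclHat α φ := by
  have h : comul (R := ℂ) φ = comul (R := ℂ) (1 : Hat A) * (1 ⊗ₜ φ) := by
    have := comul_mul_of_mem_subR hφ 1
    rwa [one_mul] at this
  rw [inclHat_mul_inclA, h, actTensor_mul_tmul, leftAct_one, actTensor_comul_one]

lemma commute_inclHat_inclA_of_mem_subL (φ : Hat A) {c : A} (hc : c ∈ subL A) :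
    inclHat α φ * inclA α c = inclA α c * inclHat α φ := by
  have h : ∀ t, actTensor α c t = inclA α c * actTensor α 1 t := by
    intro t
    induction t with
    | zero => simp
    | add x y hx hy => simp only [mul_add, map_add, hx, hy]
    | tmul χ ω =>
      have := leftAct_mem_subL_mul χ hc 1
      rw [mul_one] at this
      rw [actTensor_tmul, actTensor_tmul, this, inclA_mul, mul_assoc]
  rw [inclHat_mul_inclA, h, ← inclHat_mul_inclA, inclA_one, mul_one]

/-- In (φ₁ ⇀ a) φ₂ k the factor φ₂ may be replaced by Π^L(φ₂), and φ₁ ⊗ Π^L(φ₂) = Δ̂(1̂)(φ ⊗ 1̂). -/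
lemma inclHat_mul_inclA_mul_inclHat {k : Hat A} (hk : IsLeftIntegral k) (φ : Hat A) (a : A) :
    inclHat α φ * inclA α a * inclHat α k =
      inclA α (leftAct (Hat.pairing A) φ a) * inclHat α k := by
  have h : ∀ t, actTensor α a t * inclHat α k =
      actTensor α a (counitalL.lTensor (Hat A) t) * inclHat α k := by
    intro t
    induction t with
    | zero => simp
    | add x y hx hy => simp only [add_mul, map_add, hx, hy]
    | tmul χ ω =>
      rw [LinearMap.lTensor_tmul, actTensor_tmul, actTensor_tmul, mul_assoc, mul_assoc,
        ← inclHat_mul, ← inclHat_mul, hk]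
  rw [inclHat_mul_inclA, h, counitalL_lTensor_comul, actTensor_mul_tmul, actTensor_comul_one,
    inclHat_one, mul_one]

/-- The functional `φ(a ·)`. -/
noncomputable def Hat.mulLeft (a : A) : Hat A →ₗ[ℂ] Hat A :=
  (Hat.toDual A).symm.toLinearMap ∘ₗ LinearMap.lcomp ℂ ℂ (LinearMap.mulLeft ℂ a) ∘ₗ Hat.pairing A

lemma Hat.pairing_mulLeft (a x : A) (φ : Hat A) :
    Hat.pairing A (Hat.mulLeft a φ) x = Hat.pairing A φ (a * x) := rfl

lemma Hat.comul_mulLeft (a : A) (φ : Hat A) :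
    comul (R := ℂ) (Hat.mulLeft a φ) = (Hat.mulLeft a).rTensor (Hat A) (comul (R := ℂ) φ) := by
  refine Hat.ext₂ fun x y => ?_
  have h : ∀ t : Hat A ⊗[ℂ] Hat A, Hat.pairing₂ A ((Hat.mulLeft a).rTensor (Hat A) t) (x ⊗ₜ y) =
      Hat.pairing₂ A t ((a * x) ⊗ₜ y) := by
    intro t
    induction t with
    | zero => simp
    | add x y hx hy => simp only [map_add, LinearMap.add_apply, hx, hy]
    | tmul χ ω => simp [Hat.pairing_mulLeft]
  rw [h, Hat.pairing₂_comul, Hat.pairing₂_comul, LinearMap.mul'_apply, LinearMap.mul'_apply,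
    Hat.pairing_mulLeft, mul_assoc]

/-- `Π^R(φ ⇀ a) = φ(a ·) ⇀ 1`. -/
lemma counitalR_leftAct (φ : Hat A) (a : A) : counitalR (leftAct (Hat.pairing A) φ a) =
    leftAct (Hat.pairing A) (Hat.mulLeft a φ) 1 := by
  have r := Coalgebra.Repr.arbitrary ℂ a
  have r' := Coalgebra.Repr.arbitrary ℂ (1 : A)
  have h := congrArg (fun t => TensorProduct.rid ℂ A ((Hat.pairing A φ).lTensor A t))
    (counitalR_rTensor_comul a)
  simp only [sum_repr_eq r, sum_repr_eq r', Finset.mul_sum, map_sum, LinearMap.rTensor_tmul,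
    LinearMap.lTensor_tmul, TensorProduct.rid_tmul, Algebra.TensorProduct.tmul_mul_tmul,
    one_mul] at h
  rw [leftAct_repr _ _ r, leftAct_repr _ _ r', map_sum]
  simp only [map_smul, Hat.pairing_mulLeft]
  exact h

/-- In h (φ₁ ⇀ a) φ₂ the middle factor may be replaced by its Π^R, which is φ₁(a ·) ⇀ 1; and φ₁(a ·)
⊗ φ₂ is the coproduct of φ(a ·). -/
lemma inclA_mul_inclHat_mul_inclA {h : A} (hh : IsRightIntegral h) (φ : Hat A) (a : A) :
    inclA α h * (inclHat α φ * inclA α a) = inclA α h * inclHat α (Hat.mulLeft a φ) := by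
  have h1 : ∀ t, inclA α h * actTensor α a t =
      inclA α h * actTensor α 1 ((Hat.mulLeft a).rTensor (Hat A) t) := by
    intro t
    induction t with
    | zero => simp
    | add x y hx hy => simp only [mul_add, map_add, hx, hy]
    | tmul χ ω =>
      rw [LinearMap.rTensor_tmul, actTensor_tmul, actTensor_tmul, ← mul_assoc, ← mul_assoc,
        ← inclA_mul, ← inclA_mul, hh, counitalR_leftAct]
  rw [inclHat_mul_inclA, h1, ← Hat.comul_mulLeft, ← inclHat_mul_inclA, inclA_one, mul_one]

end Iterated

/-! ### The Temperley–Lieb–Jones relations. -/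

section TemperleyLieb

lemma IsRootDatum.jones_mul_jones {L : Type u} [Ring L] [StarRing L] [Algebra ℂ L]
    [StarModule ℂ L] [WeakHopfAlgebra L] [ComulStar L] [Module.Finite ℂ L] {l h s s' : L}
    (D : IsRootDatum l h s s') (hc : nR l ∈ Subalgebra.center ℂ L) :
    jones l * jones l = jones l * nR l := by
  have h1 : l * h = nR l * h := by
    rw [D.haar.left, ← antipode_nR, ← D.haar.left.subR_mul (nR_mem l)]
  rw [Subalgebra.mem_center_iff.1 hc, D.jones_eq_antipode]
  calc antipode s * h * s * (antipode s * h * s) = antipode s * h * s * (s * h * s) := by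
        rw [D.haar.left.subR_mul D.mem]
    _ = antipode s * (h * (s * s) * h) * s := by simp only [mul_assoc]
    _ = (antipode s * nR l) * h * s := by rw [← D.eq, h1]; simp only [mul_assoc]
    _ = nR l * (antipode s * h * s) := by
        rw [Subalgebra.mem_center_iff.1 hc]; simp only [mul_assoc]

variable {A : Type u} [Ring A] [StarRing A] [Algebra ℂ A] [StarModule ℂ A] [WeakHopfAlgebra A]
  [ComulStar A] [Module.Finite ℂ A] {M : Type v} [Ring M] [Algebra ℂ M] (α : ModuleAlgebra A M)
  {l h s s' : A} {lam k σ σ' : Hat A}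

/-- With the left ê written as S(σ) λ σ⁻¹ and the right one as σ k σ, the factor σ⁻¹ in Â_R passes
through e and cancels σ; then λ e k = (λ ⇀ e_l) k = k. -/
lemma inclHat_jones_mul_inclA_jones_mul (hlam : leftAct (Hat.pairing A) lam (jones l) = 1)
    (D' : IsRootDatum lam k σ σ') :
    inclHat α (jones lam) * inclA α (jones l) * inclHat α (jones lam) =
      inclHat α (jones lam) := by
  have h1 := commute_inclHat_inclA_of_mem_subR α D'.mem' (jones l)
  have h2 := inclHat_mul_inclA_mul_inclHat α D'.haar.left lam (jones l)
  rw [hlam, inclA_one, one_mul] at h2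
  have h3 : inclHat α σ' * inclHat α σ = 1 := by rw [← inclHat_mul, D'.inv_mul, inclHat_one]
  nth_rw 1 [D'.jones_eq_antipode_mul]
  nth_rw 1 [D'.jones_eq]
  rw [D'.jones_eq_antipode]
  simp only [inclHat_mul]
  calc _ = inclHat α (antipode σ) * (inclHat α lam * (inclHat α σ' * inclA α (jones l)) *
        inclHat α σ * inclHat α k) * inclHat α σ := by simp only [mul_assoc]
    _ = inclHat α (antipode σ) * (inclHat α lam * inclA α (jones l) *
        (inclHat α σ' * inclHat α σ) * inclHat α k) * inclHat α σ := by
        rw [h1]; simp only [mul_assoc]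
    _ = _ := by rw [h3, mul_one, h2]

/-- With the left e written as S(s) h S⁻¹(s) and the right one as S(s) h s, the factor S⁻¹(s) in A_L
passes through ê. What remains is h ê a = h e_λ(a ·) with a = S⁻¹(s) S(s) h, and e_λ(a ·) = 1̂. -/
lemma inclA_jones_mul_inclHat_jones_mul (D : IsRootDatum l h s s')
    (hjones : ∀ x, Hat.pairing A (jones lam) (antipodeInv s * antipode s * h * x) =
      counit (R := ℂ) x) :
    inclA α (jones l) * inclHat α (jones lam) * inclA α (jones l) = inclA α (jones l) := by
  have h1 : h * s = h * antipodeInv s := by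
    rw [D.haar.right.mul_subL (antipodeInv_mem_subL D.mem), antipode_antipodeInv]
  have h2 := commute_inclHat_inclA_of_mem_subL α (jones lam) (antipodeInv_mem_subL D.mem)
  have h3 : Hat.mulLeft (antipodeInv s * antipode s * h) (jones lam) = 1 := Hat.ext hjones
  have h4 := inclA_mul_inclHat_mul_inclA α D.haar.right (jones lam)
    (antipodeInv s * antipode s * h)
  rw [h3, inclHat_one, mul_one] at h4
  have h5 : jones l = antipode s * (h * antipodeInv s) := by
    rw [D.jones_eq_antipode, mul_assoc, h1]
  nth_rw 1 [h5]
  rw [D.jones_eq_antipode]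
  simp only [inclA_mul] at h4 ⊢
  calc _ = inclA α (antipode s) * (inclA α h * ((inclA α (antipodeInv s) *
        inclHat α (jones lam)) * (inclA α (antipode s) * inclA α h))) * inclA α s := by
        simp only [mul_assoc]
    _ = inclA α (antipode s) * (inclA α h * (inclHat α (jones lam) *
        (inclA α (antipodeInv s) * inclA α (antipode s) * inclA α h))) * inclA α s := by
        rw [← h2]; simp only [mul_assoc]
    _ = _ := by rw [h4]

end TemperleyLieb
end WeakHopf

theorem theorem3p18 {A : Type u} [CStarAlgebra A] [FiniteDimensional ℂ A]
    [WeakCStarHopfAlgebra A] (l : A) (hl : IsPosNondegLeftIntegral (Hat.pairing A) l) :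
    (∃ lam : Hat A, IsPDual (Hat.pairing A) l lam) ∧
    ∀ lam : Hat A, IsPDual (Hat.pairing A) l lam →
      IsPDual (Hat.pairing A).flip lam l ∧
      (IndexFiniteType (leftAct (Hat.pairing A).flip l) ∧
        IsPos (integralIndex (Hat.pairing A).flip l) ∧
        IsUnit (integralIndex (Hat.pairing A).flip l) ∧
        integralIndex (Hat.pairing A).flip l = nR lam ∧
        nR lam ∈ Subalgebra.center ℂ (Hat A) ∧ nR lam ∈ subR (Hat A)) ∧
      (IndexFiniteType (leftAct (Hat.pairing A) lam) ∧
        IsPos (integralIndex (Hat.pairing A) lam) ∧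
        IsUnit (integralIndex (Hat.pairing A) lam) ∧
        integralIndex (Hat.pairing A) lam = nR l ∧
        nR l ∈ Subalgebra.center ℂ A ∧ nR l ∈ subR A) ∧
      ∀ {M : Type v} [Ring M] [Algebra ℂ M] [StarRing M] [StarModule ℂ M]
        (α : StarModuleAlgebra A M),
        inclA α.toModuleAlgebra (jones l) * inclA α.toModuleAlgebra (jones l) =
          inclA α.toModuleAlgebra (jones l) *
            inclA α.toModuleAlgebra (integralIndex (Hat.pairing A) lam) ∧
        inclHat α.toModuleAlgebra (jones lam) * inclHat α.toModuleAlgebra (jones lam) =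
          inclHat α.toModuleAlgebra (jones lam) *
            inclHat α.toModuleAlgebra (integralIndex (Hat.pairing A).flip l) ∧
        inclHat α.toModuleAlgebra (jones lam) * inclA α.toModuleAlgebra (jones l) *
          inclHat α.toModuleAlgebra (jones lam) = inclHat α.toModuleAlgebra (jones lam) ∧
        inclA α.toModuleAlgebra (jones l) * inclHat α.toModuleAlgebra (jones lam) *
          inclA α.toModuleAlgebra (jones l) = inclA α.toModuleAlgebra (jones l) := by
  have hA := IsCStarLike.of_cStarAlgebra A
  have hp := Hat.isDualPairing (A := A)
  -- The integral l, as a faithful positive functional on Â, supplies the GNS embedding.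
  have hK : IsCStarLike (Hat A) := hl.isFaithfulPos.isCStarLike
  obtain ⟨h, s, s', D⟩ := hp.exists_rootDatum hA hl
  refine ⟨hp.exists_isPDual hl D, fun lam hlam => ?_⟩
  have hlam1 := hlam.act_jones
  have hlam2 := hlam.isPosNondegLeftIntegral
  obtain ⟨k, σ, σ', D'⟩ := hp.flip.exists_rootDatum hK hlam2
  -- From here on l and λ play symmetric roles: l satisfies the defining equation of the p-dual of
  -- λ, so the results on p-duals and indices apply to the flipped pairing.
  have hl1 := hp.leftAct_flip_jones hA hK hl D hlam1
  have i1 := hp.flip.index_of_leftAct_jones hl1 hK hlam2 D'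
  have i2 := hp.index_of_leftAct_jones hlam1 hA hl D
  refine ⟨hp.flip.isPDual_of_leftAct_jones hl1 hlam2 D', i1, i2, fun α => ⟨?_, ?_, ?_, ?_⟩⟩
  · rw [i2.2.2.2.1, ← inclA_mul, ← inclA_mul, D.jones_mul_jones i2.2.2.2.2.1]
  · rw [i1.2.2.2.1, ← inclHat_mul, ← inclHat_mul, D'.jones_mul_jones i1.2.2.2.2.1]
  · exact inclHat_jones_mul_inclA_jones_mul _ hlam1 D'
  · exact inclA_jones_mul_inclHat_jones_mul _ D fun x => hp.apply_jones_mul hA hK hl D hlam1 x
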